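/- By a Borel space we mean a non-empty Borel subset of a complete separable metric space, with its Borel $\sigma$-algebra $\mathcal B(\cdot)$. Consider a constrained Markov decision process with $m$ constraints: the state space $S$ and the action space $A$ are Borel spaces; $A(s)\subset A$ is the non-empty set of actions available in $s\in S$, and $\mathbb K=\{(s,a): s\in S,\ a\in A(s)\}$ is Borel in $S\times A$; $p(\cdot|s,a)$ is a transition probability from $\mathbb K$ to $S$; $\mu$ is a probability measure on $S$ (the initial distribution); $r_0,r_1,\dots,r_m:\mathbb K\to\mathbb R\cup\{-\infty\}$ are Borel measurable; $\beta\in(0,1)$. A policy is a sequence $\pi=(\pi_n)_{n\ge1}$ of transition probabilities $\pi_n$ from the space $\mathbb K^{n-1}\times S$ of histories $h_n=(s_1,a_1,\dots,s_{n-1},a_{n-1},s_n)$ to $A$ with $\pi_n(A(s_n)|h_n)=1$ for all $h_n$; $\Pi$ is the set of all policies. A stationary policy is a transition probability $\phi$ from $S$ to $A$ with $\phi(A(s)|s)=1$ for all $s$, used at every step. A deterministic stationary policy is a Borel measurable $f:S\to A$ with $f(s)\in A(s)$ for all $s$. Let $P_\mu^\pi$ be the law of the process $(s_n,a_n)_{n\ge1}$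 generated by $\pi$, $p$ and $\mu$, let $E_\mu^\pi$ be its expectation, and let $$J_i(\pi)=E_\mu^\pi\Big(\sum_{n=1}^\infty\beta^{n-1}r_i(s_n,a_n)\Big)=E_\mu^\pi\Big(\sum_{n=1}^\infty\beta^{n-1}r_i^+(s_n,a_n)\Big)+E_\mu^\pi\Big(\sum_{n=1}^\infty\beta^{n-1}r_i^-(s_n,a_n)\Big),\qquad 0\le i\le m,$$ with $r_i^+=\max\{r_i,0\}$ and $r_i^-=\min\{r_i,0\}$. For fixed real numbers $d_1,\dots,d_m$ consider the problem $$\text{(CP)}\qquad\text{maximize } J_0(\pi)\ \text{ over } \pi\in\Pi\ \text{ subject to } J_i(\pi)\ge d_i,\quad i=1,\dots,m,$$ and suppose that some $\pi\in\Pi$ satisfies the constraints and has $J_0(\pi)>-\infty$. Assume that there is a Borel measurable function $w:S\to[1,\infty)$ with $r_i(s,a)\le w(s)$ for all $(s,a)\in\mathbb K$ and $0\le i\le m$, such that $$\lim_{n\to\infty}\sup_{\pi\in\Pi}E_\mu^\pi\Big(\sum_{k=n}^\infty\beta^{k-1}w(s_k)\Big)=0\qquad\text{and}\qquad \lim_{l\to\infty}\sup_{\pi\in\Pi}E_\mu^\pi\big(w(s_n)1_{\{w(s_n)\ge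 l\}}\big)=0\quad\text{for every } n\ge1.$$ Assume moreover that every $A(s)$ is compact and that (at least) one of the following holds: (W) the set $\{s\in S: A(s)\cap B\ne\emptyset\}$ is closed for every closed $B\subset A$; the function $(s,a)\mapsto\int_S v(t)\,p(dt|s,a)$ is continuous on $\mathbb K$ for every bounded continuous $v:S\to\mathbb R$; and $r_0,\dots,r_m$ are upper semicontinuous on $\mathbb K$; (S) for every $s\in S$, the function $p(D|s,\cdot)$ is continuous on $A(s)$ for every $D\in\mathcal B(S)$, and $r_0(s,\cdot),\dots,r_m(s,\cdot)$ are upper semicontinuous on $A(s)$. Theorem 2. There exists a stationary policy $\phi$ that solves (CP) and is chattering with $m+1$ components: there are Borel measurable functions $\gamma_j:S\to[0,1]$ and deterministic stationary policies $f_j$, $j=1,\dots,m+1$, such that for all $s\in S$ and $D\in\mathcal B(A)$ $$\sum_{j=1}^{m+1}\gamma_j(s)=1\qquad\text{and}\qquad\phi(D|s)=\sum_{j=1}^{m+1}\gamma_j(s)\,\delta_{f_j(s)}(D).$$ -/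

import Mathlib

open MeasureTheory ProbabilityTheory Filter Topology
open scoped ENNReal

universe u v

/-- A (topological) Borel space: a non-empty space which is homeomorphic to a Borel subset of a
complete separable metric space. -/
structure IsBorelSpace (Y : Type u) [TopologicalSpace Y] : Prop where
  nonempty : Nonempty Y
  exists_embedding : ∃ (X : Type u) (_ : TopologicalSpace X) (_ : PolishSpace X) (e : Y → X),
    IsEmbedding e ∧ MeasurableSet[borel X] (Set.range e)

/-- A constrained Markov decision process with `m` constraints, with state space `S` and action
space `A`. The stage reward is `r 0` and the sources of constraints are `r 1, …, r m`.
Measurability always refers to the Borel σ-algebras. -/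
structure CMDP (S : Type u) (A : Type v) [MeasurableSpace S] [MeasurableSpace A] (m : ℕ) where
  /-- the set `A(s)` of actions available in the state `s` -/
  actions : S → Set A
  actions_nonempty : ∀ s, (actions s).Nonempty
  /-- the graph `𝕂` of feasible state-action pairs is Borel -/
  measurableSet_graph : MeasurableSet {x : S × A | x.2 ∈ actions x.1}
  /-- the transition probability from `𝕂` to `S` -/
  p : Kernel {x : S × A // x.2 ∈ actions x.1} S
  isMarkovKernel_p : IsMarkovKernel p
  /-- the initial distribution -/
  μ : Measure S
  isProbabilityMeasure_μ : IsProbabilityMeasure μ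
  /-- the rewards, with values in `ℝ ∪ {-∞}` -/
  r : Fin (m + 1) → {x : S × A // x.2 ∈ actions x.1} → EReal
  r_ne_top : ∀ i x, r i x ≠ ⊤
  measurable_r : ∀ i, Measurable (r i)
  /-- the discount factor -/
  β : ℝ
  β_pos : 0 < β
  β_lt_one : β < 1

namespace CMDP

variable {S : Type u} {A : Type v} [MeasurableSpace S] [MeasurableSpace A] {m : ℕ}

/-- The set `𝕂` of feasible state-action pairs, as a type (with the subspace structures
inherited from `S × A`). -/
abbrev K (M : CMDP S A m) : Type (max u v) := {x : S × A // x.2 ∈ M.actions x.1}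

attribute [instance] CMDP.isMarkovKernel_p CMDP.isProbabilityMeasure_μ

/-- A (randomized, history-dependent) policy. Time is indexed from `0`: at time `n` the history
consists of the `n` previous feasible state-action pairs and of the current state, and `kernel n`
is the transition probability from the histories to the actions. -/
structure Policy (M : CMDP S A m) where
  kernel : (n : ℕ) → Kernel ((Fin n → M.K) × S) A
  isMarkovKernel_kernel : ∀ n, IsMarkovKernel (kernel n)
  feasible : ∀ n h, kernel n h (M.actions h.2) = 1

/-- A (randomized) stationary policy. -/
structure StationaryPolicy (M : CMDP S A m) where
  kernel : Kernel S A
  isMarkovKernel_kernel : IsMarkovKernel kernel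
  feasible : ∀ s, kernel s (M.actions s) = 1

/-- A deterministic stationary policy: a Borel selector of `s ↦ A(s)`. -/
structure DetStationaryPolicy (M : CMDP S A m) where
  toFun : S → A
  measurable_toFun : Measurable toFun
  feasible : ∀ s, toFun s ∈ M.actions s

attribute [instance] Policy.isMarkovKernel_kernel StationaryPolicy.isMarkovKernel_kernel

/-- A stationary policy, regarded as a policy. -/
noncomputable def StationaryPolicy.toPolicy {M : CMDP S A m} (φ : M.StationaryPolicy) :
    M.Policy where
  kernel n := φ.kernel.comap Prod.snd measurable_snd
  isMarkovKernel_kernel n := inferInstance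
  feasible n h := by
    rw [Kernel.comap_apply]
    exact φ.feasible h.2

/-- A stationary policy `φ` is chattering (with `N` components) if
`φ(·|s) = ∑ j, γ j s • δ_{f j s}` for all `s`, for Borel weights `γ j : S → [0, 1]` with
`∑ j, γ j s = 1` and deterministic stationary policies `f j`. -/
def StationaryPolicy.IsChattering {M : CMDP S A m} (φ : M.StationaryPolicy) (N : ℕ) : Prop :=
  ∃ (γ : Fin N → S → ℝ) (f : Fin N → M.DetStationaryPolicy),
    (∀ j, Measurable (γ j)) ∧
    (∀ j s, γ j s ∈ Set.Icc (0 : ℝ) 1) ∧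
    (∀ s, ∑ j, γ j s = 1) ∧
    ∀ s, φ.kernel s = ∑ j, ENNReal.ofReal (γ j s) • Measure.dirac ((f j).toFun s)

section StrategicMeasure

variable (M : CMDP S A m) (π : M.Policy)

theorem measurableEmbedding_K : MeasurableEmbedding (Subtype.val : M.K → S × A) :=
  MeasurableEmbedding.subtype_coe M.measurableSet_graph

theorem measurableSet_actions (s : S) : MeasurableSet (M.actions s) :=
  measurable_prodMk_left (x := s) M.measurableSet_graph

/-- The history of the process at time `n + 1`, from the list of the state-action pairs at times
`0, …, n` and the state at time `n + 1`. -/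
def nextHistory (n : ℕ) (y : ((i : Finset.Iic n) → M.K) × S) : (Fin (n + 1) → M.K) × S :=
  (fun i => y.1 ⟨i.1, Finset.mem_Iic.2 (Nat.lt_succ_iff.1 i.2)⟩, y.2)

theorem measurable_nextHistory (n : ℕ) : Measurable (M.nextHistory n) := by
  unfold nextHistory
  fun_prop

/-- The law of the initial state-action pair: `s ∼ μ`, then `a ∼ π_0(·|s)`, as a law on `S × A`. -/
noncomputable def initLawProd : Measure (S × A) :=
  M.μ ⊗ₘ (π.kernel 0).comap (fun s => (Fin.elim0, s)) (by fun_prop)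

/-- The law of the initial state-action pair, on `𝕂`. -/
noncomputable def initLaw : Measure M.K := (M.initLawProd π).comap Subtype.val

/-- The conditional law of the state-action pair at time `n + 1` given the previous pairs:
`s' ∼ p(·|s_n, a_n)`, then `a' ∼ π_{n+1}(·|h, s')`, as a law on `S × A`. -/
noncomputable def stepKernelProd (n : ℕ) : Kernel ((i : Finset.Iic n) → M.K) (S × A) :=
  (M.p.comap (fun x => x ⟨n, Finset.mem_Iic.2 le_rfl⟩) (measurable_pi_apply _)) ⊗ₖ
    (π.kernel (n + 1)).comap (M.nextHistory n) (M.measurable_nextHistory n)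

/-- The conditional law of the state-action pair at time `n + 1` given the previous pairs,
on `𝕂`. -/
noncomputable def stepKernel (n : ℕ) : Kernel ((i : Finset.Iic n) → M.K) M.K :=
  (M.stepKernelProd π n).comapRight M.measurableEmbedding_K

theorem prodMk_preimage_graph (s : S) :
    Prod.mk s ⁻¹' Set.range (Subtype.val : M.K → S × A) = M.actions s := by
  ext a
  simp

instance isProbabilityMeasure_initLaw : IsProbabilityMeasure (M.initLaw π) := by
  have hK : MeasurableSet (Set.range (Subtype.val : M.K → S × A)) :=
    M.measurableEmbedding_K.measurableSet_range
  constructor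
  rw [initLaw, M.measurableEmbedding_K.comap_apply, Set.image_univ, initLawProd,
    Measure.compProd_apply hK]
  simp [-Subtype.range_coe_subtype, prodMk_preimage_graph, π.feasible]

instance isMarkovKernel_stepKernel (n : ℕ) : IsMarkovKernel (M.stepKernel π n) := by
  have hK : MeasurableSet (Set.range (Subtype.val : M.K → S × A)) :=
    M.measurableEmbedding_K.measurableSet_range
  refine Kernel.IsMarkovKernel.comapRight _ _ fun x => ?_
  have h : ∀ s, (π.kernel (n + 1)) (M.nextHistory n (x, s)) (M.actions s) = 1 :=
    fun s => π.feasible (n + 1) (M.nextHistory n (x, s))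
  rw [stepKernelProd, Kernel.compProd_apply hK]
  simp [-Subtype.range_coe_subtype, prodMk_preimage_graph, h]

/-- The strategic measure `P_μ^π` of the policy `π` (Ionescu-Tulcea), as the law of the
trajectory `(s_0, a_0), (s_1, a_1), …` of feasible state-action pairs. -/
noncomputable def strategicMeasure : Measure (ℕ → M.K) :=
  Kernel.trajMeasure (X := fun _ => M.K) (M.initLaw π) (M.stepKernel π)

/-- The expected discounted total of the positive part of `r i`. -/
noncomputable def JPos (i : Fin (m + 1)) : ℝ≥0∞ :=
  ∫⁻ ω, ∑' n, ENNReal.ofReal (M.β ^ n) * (M.r i (ω n)).toENNReal ∂(M.strategicMeasure π)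

/-- The expected discounted total of the absolute value of the negative part of `r i`. -/
noncomputable def JNeg (i : Fin (m + 1)) : ℝ≥0∞ :=
  ∫⁻ ω, ∑' n, ENNReal.ofReal (M.β ^ n) * (-(M.r i (ω n))).toENNReal ∂(M.strategicMeasure π)

/-- The expected discounted reward `J_i(π)`, with values in `[-∞, ∞)` when `JPos` is finite. -/
noncomputable def J (i : Fin (m + 1)) : EReal := (M.JPos π i : EReal) - (M.JNeg π i : EReal)

end StrategicMeasure

section Problem

variable (M : CMDP S A m) (d : Fin m → ℝ)

/-- The policy `π` satisfies the constraints `J_i(π) ≥ d_i`, `i = 1, …, m`. -/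
def IsFeasible (π : M.Policy) : Prop := ∀ i : Fin m, ((d i : ℝ) : EReal) ≤ M.J π i.succ

/-- The policy `π` maximizes `J_0` among the policies which satisfy the constraints. -/
def Solves (π : M.Policy) : Prop :=
  M.IsFeasible d π ∧ ∀ π' : M.Policy, M.IsFeasible d π' → M.J π' 0 ≤ M.J π 0

/-- The constrained problem has a feasible policy with `J_0 > -∞`. -/
def Nontrivial : Prop := ∃ π : M.Policy, M.IsFeasible d π ∧ ⊥ < M.J π 0

end Problem

section Assumptions

variable (M : CMDP S A m)

/-- All the rewards are bounded above by the Borel function `w ≥ 1`. -/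
structure IsUpperBoundFunction (w : S → ℝ) : Prop where
  measurable : Measurable w
  one_le : ∀ s, 1 ≤ w s
  r_le : ∀ i (x : M.K), M.r i x ≤ ((w x.1.1 : ℝ) : EReal)

/-- The tails of the discounted sum of `w(s_k)` vanish uniformly in the policy, and every
`w(s_n)` is uniformly integrable over the policies. -/
structure IsUniformlyIntegrable (w : S → ℝ) : Prop where
  tail : Tendsto (fun n : ℕ => ⨆ π : M.Policy,
      ∫⁻ ω, ∑' k : ℕ, ENNReal.ofReal (M.β ^ (n + k) * w (ω (n + k)).1.1) ∂(M.strategicMeasure π))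
    atTop (𝓝 0)
  unifIntegrable : ∀ n : ℕ, Tendsto (fun l : ℕ => ⨆ π : M.Policy,
      ∫⁻ ω, {s : S | (l : ℝ) ≤ w s}.indicator (fun s => ENNReal.ofReal (w s)) (ω n).1.1
        ∂(M.strategicMeasure π))
    atTop (𝓝 0)

variable [TopologicalSpace S] [TopologicalSpace A]

/-- The compactness and continuity conditions for weakly continuous transitions. -/
structure WeaklyContinuous : Prop where
  isCompact_actions : ∀ s, IsCompact (M.actions s)
  isClosed_hit : ∀ B : Set A, IsClosed B → IsClosed {s | (M.actions s ∩ B).Nonempty}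
  continuous_p : ∀ v : BoundedContinuousFunction S ℝ,
    Continuous fun x : M.K => ∫ t, v t ∂(M.p x)
  upperSemicontinuous_r : ∀ i, UpperSemicontinuous (M.r i)

/-- The compactness and continuity conditions for setwise continuous transitions. -/
structure SetwiseContinuous : Prop where
  isCompact_actions : ∀ s, IsCompact (M.actions s)
  continuous_p : ∀ (s : S) (D : Set S), MeasurableSet D →
    Continuous fun a : M.actions s => M.p ⟨(s, a), a.2⟩ D
  upperSemicontinuous_r : ∀ i (s : S),
    UpperSemicontinuous fun a : M.actions s => M.r i ⟨(s, a), a.2⟩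

end Assumptions

end CMDP

/-! The problem is linear in the discounted occupation measure `Q` on the feasible pairs. For every
policy `Q` solves the balance equation `stateLaw Q = μ + β • (p ∘ₘ Q)`, and conversely each finite
solution is the occupation measure of the stationary policy that disintegrates it
(`IsOcc.exists_stationary`), because the discounted potential is the only finite solution of its
equation. Each `J i` is the integral of `r i` against `Q`, so history dependence is irrelevant.

Existence of a maximizer is a compactness argument, carried out on the whole sequence of
one-dimensional laws (a flow) instead of on `Q`: the state law at time 0 is `μ` for all policies,
and convergence can then be propagated from one time to the next. Embedded in the Hilbert cube, the
laws have limit points; compactness of the action sets prevents mass from escaping from the feasible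
pairs, and continuity of `p` makes the limit a flow again. Both continuity conditions are reduced to
one interface, `ConvergenceFrame`, where convergence means `ν G ≤ liminf νs G` for a class of sets
`G`: open sets under the weak condition, measurable sets with open sections under the setwise one
(`le_liminf_of_isOpen_sections`). Uniform integrability of `w` makes the rewards upper
semicontinuous (`le_reward_of_liminf`).

The optimal occupation measures form a compact set, which has an extreme point `Q`. Suppose its
policy charges `m + 2` disjoint action sets on a non-null set of states. Then `Q` contains `m + 2`
parts with a common source, which can be reweighted without destroying the balance. Preserving the
total weight and the `m` constraint values imposes `m + 1` linear conditions on `m + 2` weights, so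
some nonzero perturbation is possible in both directions; optimality forces `J 0` to stay constant,
and extremality is violated (`IsOcc.exists_midpoint`). Hence almost every `φ(·|s)` has at most `m +
1` atoms. These are enumerated measurably as points of the line (`Kernel.exists_eq_sum_dirac`), and
the exceptional null set of states is repaired by a measurable selector of the action sets. -/

/-! ### Lower semicontinuity of integrals -/

/-- If the superlevel sets of `f` satisfy the liminf inequality, then so does the integral
of `f`. -/
theorem lintegral_le_liminf_of_superlevel {Ω : Type*} [MeasurableSpace Ω] {ν : Measure Ω}
    {νs : ℕ → Measure Ω} {f : Ω → ℝ≥0∞} (hf : Measurable f)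
    (h : ∀ t : ℝ≥0∞, ν {x | t < f x} ≤ liminf (fun k => νs k {x | t < f x}) atTop) :
    ∫⁻ x, f x ∂ν ≤ liminf (fun k => ∫⁻ x, f x ∂(νs k)) atTop := by
  -- Truncation makes the function finite, so that the layer-cake formula applies; Fatou's lemma in
  -- the level variable then gives the inequality.
  have key : ∀ j : ℕ, ∫⁻ x, min (f x) j ∂ν ≤ liminf (fun k => ∫⁻ x, f x ∂(νs k)) atTop := by
    intro j
    have hfin : ∀ x, min (f x) j ≠ ∞ := fun x => ((min_le_right _ _).trans_lt (by simp)).ne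
    have hm : Measurable fun x => min (f x) (j : ℝ≥0∞) := hf.min measurable_const
    have e : ∀ ρ : Measure Ω, ∫⁻ x, min (f x) j ∂ρ =
        ∫⁻ t in Set.Ioi (0 : ℝ), ρ {x | t < (min (f x) j).toReal} := by
      intro ρ
      rw [← lintegral_eq_lintegral_meas_lt ρ (Eventually.of_forall fun x => ENNReal.toReal_nonneg)
        hm.ennreal_toReal.aemeasurable]
      simp_rw [ENNReal.ofReal_toReal (hfin _)]
    have hset : ∀ t ∈ Set.Ioi (0 : ℝ), ν {x | t < (min (f x) j).toReal} ≤
        liminf (fun k => νs k {x | t < (min (f x) j).toReal}) atTop := by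
      intro t ht
      have : {x | t < (min (f x) j).toReal} = {x | ENNReal.ofReal t < min (f x) j} := by
        ext x
        exact (ENNReal.ofReal_lt_iff_lt_toReal (le_of_lt ht) (hfin x)).symm
      rw [this]
      by_cases htj : ENNReal.ofReal t < j
      · have : {x | ENNReal.ofReal t < min (f x) j} = {x | ENNReal.ofReal t < f x} := by
          ext x; simp [htj]
        rw [this]
        exact h _
      · have : {x | ENNReal.ofReal t < min (f x) j} = ∅ := by
          ext x; simp [htj]
        rw [this]
        simp
    calc ∫⁻ x, min (f x) j ∂ν
        = ∫⁻ t in Set.Ioi (0 : ℝ), ν {x | t < (min (f x) j).toReal} := e ν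
      _ ≤ ∫⁻ t in Set.Ioi (0 : ℝ), liminf (fun k => νs k {x | t < (min (f x) j).toReal}) atTop :=
          setLIntegral_mono' measurableSet_Ioi hset
      _ ≤ liminf (fun k => ∫⁻ t in Set.Ioi (0 : ℝ), νs k {x | t < (min (f x) j).toReal}) atTop :=
          lintegral_liminf_le (fun n => Antitone.measurable (fun s t hst =>
            measure_mono (fun ω hω => lt_of_le_of_lt hst hω)))
      _ ≤ liminf (fun k => ∫⁻ x, f x ∂(νs k)) atTop := by
          simp_rw [← e]
          exact liminf_le_liminf (Eventually.of_forall fun k =>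
            lintegral_mono fun x => min_le_left _ _)
  have hsup : ∀ x, f x = ⨆ j : ℕ, min (f x) j := by
    intro x
    rw [← inf_iSup_eq, ENNReal.iSup_natCast, inf_top_eq]
  calc ∫⁻ x, f x ∂ν = ∫⁻ x, ⨆ j : ℕ, min (f x) j ∂ν := by simp_rw [← hsup]
    _ = ⨆ j : ℕ, ∫⁻ x, min (f x) j ∂ν := by
        refine lintegral_iSup (fun j => hf.min measurable_const) ?_
        intro i j hij x
        exact min_le_min le_rfl (by exact_mod_cast hij)
    _ ≤ _ := iSup_le key

/-! ### Inner approximation by sets with closed sections -/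

/-- A Borel set is approximated from inside, uniformly in the first variable, by a Borel set with
closed sections. -/
theorem ProbabilityTheory.Kernel.exists_subset_isClosed_sections {S Y : Type*} [MeasurableSpace S]
    [TopologicalSpace Y] [TopologicalSpace.PseudoMetrizableSpace Y] [MeasurableSpace Y]
    [BorelSpace Y] (κ : Kernel S Y) [IsFiniteKernel κ] {D : Set (S × Y)} (hD : MeasurableSet D)
    {ε : ℝ≥0∞} (hε : ε ≠ 0) :
    ∃ C ⊆ D, MeasurableSet C ∧ (∀ s, IsClosed (Prod.mk s ⁻¹' C)) ∧
      ∀ s, κ s (Prod.mk s ⁻¹' (D \ C)) ≤ ε := by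
  let P : Set (S × Y) → Prop := fun D => ∀ ε : ℝ≥0∞, ε ≠ 0 →
    ∃ C ⊆ D, MeasurableSet C ∧ (∀ s, IsClosed (Prod.mk s ⁻¹' C)) ∧
      ∀ s, κ s (Prod.mk s ⁻¹' (D \ C)) ≤ ε
  have P_of_closed : ∀ D : Set (S × Y), MeasurableSet D → (∀ s, IsClosed (Prod.mk s ⁻¹' D)) →
      P D := fun D hD h ε _ => ⟨D, le_rfl, hD, h, by simp⟩
  have P_iInter : ∀ D : ℕ → Set (S × Y), (∀ n, P (D n)) → P (⋂ n, D n) := by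
    intro D h ε hε
    obtain ⟨δ, hδ, hδε⟩ := ENNReal.exists_pos_sum_of_countable' hε ℕ
    choose C hCD hC hcl hle using fun n => h n (δ n) (hδ n).ne'
    refine ⟨⋂ n, C n, Set.iInter_mono hCD, .iInter hC, fun s => ?_, fun s => ?_⟩
    · rw [Set.preimage_iInter]
      exact isClosed_iInter fun n => hcl n s
    · calc κ s (Prod.mk s ⁻¹' ((⋂ n, D n) \ ⋂ n, C n))
          ≤ κ s (⋃ n, Prod.mk s ⁻¹' (D n \ C n)) := by
            refine measure_mono ?_
            rintro y ⟨h1, h2⟩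
            simp only [Set.mem_iInter, not_forall] at h1 h2
            obtain ⟨n, hn⟩ := h2
            exact Set.mem_iUnion.2 ⟨n, h1 n, hn⟩
        _ ≤ ∑' n, κ s (Prod.mk s ⁻¹' (D n \ C n)) := measure_iUnion_le _
        _ ≤ ∑' n, δ n := ENNReal.tsum_le_tsum fun n => hle n s
        _ ≤ ε := hδε.le
  have P_iUnion : ∀ D : ℕ → Set (S × Y), (∀ n, P (D n)) → P (⋃ n, D n) := by
    intro D h ε hε
    have hε2 : ε / 2 ≠ 0 := by simp [hε]
    obtain ⟨δ, hδ, hδε⟩ := ENNReal.exists_pos_sum_of_countable' hε2 ℕ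
    choose C hCD hC hcl hle using fun n => h n (δ n) (hδ n).ne'
    let E : ℕ → Set (S × Y) := fun n => (⋃ i, C i) \ ⋃ i < n, C i
    have hE : ∀ n, MeasurableSet (E n) := fun n =>
      (MeasurableSet.iUnion hC).diff (.biUnion (Set.to_countable _) fun i _ => hC i)
    have hEanti : ∀ s, Antitone fun n => Prod.mk s ⁻¹' (E n) := fun s i j hij =>
      Set.preimage_mono (Set.sdiff_subset_sdiff_right
        (Set.biUnion_subset_biUnion_left fun k (hk : k < i) => hk.trans_le hij))
    have hElim : ∀ s, ∃ n, κ s (Prod.mk s ⁻¹' (E n)) ≤ ε / 2 := by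
      intro s
      have ht : Tendsto (fun n => κ s (Prod.mk s ⁻¹' (E n))) atTop (𝓝 0) := by
        have hem : ⋂ n, Prod.mk s ⁻¹' (E n) = ∅ := by
          rw [Set.eq_empty_iff_forall_notMem]
          intro y hy
          rw [Set.mem_iInter] at hy
          obtain ⟨i, hi⟩ := Set.mem_iUnion.1 (hy 0).1
          exact (hy (i + 1)).2 (Set.mem_biUnion (Nat.lt_succ_self i) hi)
        have := tendsto_measure_iInter_atTop (μ := κ s)
          (fun n => (measurable_prodMk_left (hE n)).nullMeasurableSet) (hEanti s)
          ⟨0, measure_ne_top _ _⟩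
        rwa [hem, measure_empty] at this
      exact ((ht.eventually_lt_const (pos_iff_ne_zero.2 hε2)).mono fun n hn => hn.le).exists
    -- A countable union of closed sets need not be closed, and the number of pieces that suffice
    -- depends on `s`. The piece `C n` is therefore kept only over those `s` for which the previous
    -- pieces leave more than `ε / 2` uncovered: this condition is measurable and holds for finitely
    -- many `n` at each `s`.
    refine ⟨⋃ n, C n ∩ Prod.fst ⁻¹' {s | ε / 2 < κ s (Prod.mk s ⁻¹' (E n))}, ?_, ?_, ?_, ?_⟩
    · exact Set.iUnion_mono fun n => Set.inter_subset_left.trans (hCD n)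
    · exact .iUnion fun n => (hC n).inter (measurable_fst
        (measurableSet_lt measurable_const (Kernel.measurable_kernel_prodMk_left (hE n))))
    · intro s
      obtain ⟨N, hN⟩ := hElim s
      have : Prod.mk s ⁻¹' (⋃ n, C n ∩ Prod.fst ⁻¹' {s | ε / 2 < κ s (Prod.mk s ⁻¹' (E n))}) =
          ⋃ n ∈ {n | n < N ∧ ε / 2 < κ s (Prod.mk s ⁻¹' (E n))}, Prod.mk s ⁻¹' (C n) := by
        ext y
        simp only [Set.mem_preimage, Set.mem_iUnion, Set.mem_inter_iff, Set.mem_ofPred_eq,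
          exists_prop]
        refine ⟨fun ⟨n, h1, h2⟩ => ⟨n, ⟨?_, h2⟩, h1⟩, fun ⟨n, h1, h2⟩ => ⟨n, h2, h1.2⟩⟩
        by_contra hn
        exact absurd h2 (not_lt.2 ((measure_mono (hEanti s (not_lt.1 hn))).trans hN))
      rw [this]
      exact ((Set.finite_lt_nat N).subset fun n hn => hn.1).isClosed_biUnion fun n _ => hcl n s
    · intro s
      classical
      have hN := Nat.find_spec (hElim s)
      set N := Nat.find (hElim s)
      have hmin : ∀ n < N, ε / 2 < κ s (Prod.mk s ⁻¹' (E n)) := fun n hn =>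
        not_le.1 (Nat.find_min (hElim s) hn)
      calc κ s (Prod.mk s ⁻¹' ((⋃ n, D n) \
            ⋃ n, C n ∩ Prod.fst ⁻¹' {s | ε / 2 < κ s (Prod.mk s ⁻¹' (E n))}))
          ≤ κ s (Prod.mk s ⁻¹' (E N) ∪ ⋃ n, Prod.mk s ⁻¹' (D n \ C n)) := by
            refine measure_mono ?_
            rintro y ⟨h1, h2⟩
            obtain ⟨n, hn⟩ := Set.mem_iUnion.1 h1
            by_cases hy : ∃ n, (s, y) ∈ C n
            · left
              refine ⟨Set.mem_iUnion.2 hy, fun h3 => h2 ?_⟩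
              simp only [Set.mem_iUnion, exists_prop] at h3
              obtain ⟨i, hi, hi'⟩ := h3
              exact Set.mem_iUnion.2 ⟨i, hi', hmin i hi⟩
            · right
              exact Set.mem_iUnion.2 ⟨n, hn, fun h => hy ⟨n, h⟩⟩
        _ ≤ κ s (Prod.mk s ⁻¹' (E N)) + κ s (⋃ n, Prod.mk s ⁻¹' (D n \ C n)) :=
            measure_union_le _ _
        _ ≤ ε / 2 + ∑' n, δ n :=
            add_le_add hN ((measure_iUnion_le _).trans (ENNReal.tsum_le_tsum fun n => hle n s))
        _ ≤ ε / 2 + ε / 2 := by gcongr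
        _ = ε := ENNReal.add_halves ε
  -- The sets that are approximable together with their complements form a σ-algebra. It contains
  -- the generators of the product σ-algebra, since the open subsets of `Y` are countable unions of
  -- closed ones.
  let m' : MeasurableSpace (S × Y) :=
    { MeasurableSet' := fun D => P D ∧ P Dᶜ
      measurableSet_empty := ⟨P_of_closed _ .empty (by simp),
        P_of_closed _ (by simp) (by simp)⟩
      measurableSet_compl := fun D h => ⟨h.2, by rw [compl_compl]; exact h.1⟩
      measurableSet_iUnion := fun D h => ⟨P_iUnion D fun n => (h n).1, by
        rw [Set.compl_iUnion]; exact P_iInter _ fun n => (h n).2⟩ }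
  have hfst : Measurable[m'] (Prod.fst : S × Y → S) := by
    intro B hB
    have : ∀ B : Set S, MeasurableSet B → P (Prod.fst ⁻¹' B) := by
      intro B hB
      refine P_of_closed _ (measurable_fst hB) fun s => ?_
      by_cases h : s ∈ B <;> simp [Set.preimage_preimage, h]
    exact ⟨this B hB, this Bᶜ hB.compl⟩
  have hsnd : Measurable[m'] (Prod.snd : S × Y → Y) := by
    refine @measurable_of_isClosed _ _ _ _ _ m' _ fun F hF => ?_
    refine ⟨P_of_closed _ (measurable_snd hF.measurableSet) fun s => ?_, ?_⟩
    · simpa [Set.preimage_preimage] using hF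
    · let := TopologicalSpace.pseudoMetrizableSpacePseudoMetric Y
      obtain ⟨G, hG, -, hGU, -⟩ := hF.isOpen_compl.exists_iUnion_isClosed
      rw [← Set.preimage_compl, ← hGU, Set.preimage_iUnion]
      refine P_iUnion _ fun n => P_of_closed _ (measurable_snd (hG n).measurableSet) fun s => ?_
      simpa [Set.preimage_preimage] using hG n
  have hle : (Prod.instMeasurableSpace : MeasurableSpace (S × Y)) ≤ m' :=
    sup_le (measurable_iff_comap_le.1 hfst) (measurable_iff_comap_le.1 hsnd)
  exact (hle D hD).1 ε hε

/-! ### Atoms of a measure on the line -/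

/-- The infimum of the support of the restriction of `ρ` to `(c, ∞)`, truncated at `1`. -/
noncomputable def infSupport (ρ : Measure ℝ) (c : ℝ) : ℝ :=
  sInf {t | 1 ≤ t ∨ ρ (Set.Ioc c t) ≠ 0}

theorem infSupport_bddBelow (ρ : Measure ℝ) (c : ℝ) :
    min c 1 ∈ lowerBounds {t | 1 ≤ t ∨ ρ (Set.Ioc c t) ≠ 0} := by
  rintro t (ht | ht)
  · exact (min_le_right _ _).trans ht
  · by_contra h
    rw [not_le, lt_min_iff] at h
    exact ht (by rw [Set.Ioc_eq_empty (by linarith)]; simp)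

theorem min_le_infSupport (ρ : Measure ℝ) (c : ℝ) : min c 1 ≤ infSupport ρ c :=
  le_csInf ⟨1, Or.inl le_rfl⟩ (infSupport_bddBelow ρ c)

theorem infSupport_le_one (ρ : Measure ℝ) (c : ℝ) : infSupport ρ c ≤ 1 :=
  csInf_le ⟨_, infSupport_bddBelow ρ c⟩ (Or.inl le_rfl)

/-- Rational witnesses suffice, which is the source of the measurability of `infSupport` in the
measure and in `c`. -/
theorem infSupport_lt_iff (ρ : Measure ℝ) (c t : ℝ) :
    infSupport ρ c < t ↔ ∃ q : ℚ, (1 ≤ (q : ℝ) ∨ ρ (Set.Ioc c q) ≠ 0) ∧ (q : ℝ) < t := by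
  constructor
  · intro h
    rw [infSupport] at h
    obtain ⟨x, hx, hxt⟩ := exists_lt_of_csInf_lt ⟨(1 : ℝ), Or.inl le_rfl⟩ h
    obtain ⟨q, hq, hqt⟩ := exists_rat_btwn hxt
    refine ⟨q, hx.imp (fun h => h.trans hq.le) (fun h h' => h ?_), hqt⟩
    exact measure_mono_null (Set.Ioc_subset_Ioc_right hq.le) h'
  · rintro ⟨q, hq, hqt⟩
    exact (csInf_le ⟨_, infSupport_bddBelow ρ c⟩ hq).trans_lt hqt

theorem measure_Ioc_infSupport_lt (ρ : Measure ℝ) (c : ℝ) :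
    ρ (Set.Ioo c (infSupport ρ c)) = 0 := by
  have : Set.Ioo c (infSupport ρ c) ⊆
      ⋃ q ∈ {q : ℚ | (q : ℝ) < infSupport ρ c}, Set.Ioc c (q : ℝ) := by
    intro t ht
    obtain ⟨q, hq, hqt⟩ := exists_rat_btwn ht.2
    exact Set.mem_biUnion (show q ∈ {q : ℚ | (q : ℝ) < infSupport ρ c} from hqt) ⟨ht.1, hq.le⟩
  refine measure_mono_null this ((measure_biUnion_null_iff (Set.to_countable _)).2 fun q hq => ?_)
  by_contra h
  exact absurd (csInf_le ⟨_, infSupport_bddBelow ρ c⟩ (Or.inr h)) (not_le.2 hq)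

theorem measure_Ioc_ne_zero_of_infSupport_lt {ρ : Measure ℝ} {c t : ℝ} (h : infSupport ρ c < t)
    (ht : t < 1) : ρ (Set.Ioc c t) ≠ 0 := by
  obtain ⟨q, hq, hqt⟩ := (infSupport_lt_iff ρ c t).1 h
  refine fun h0 => hq.resolve_left (by linarith) (measure_mono_null ?_ h0)
  exact Set.Ioc_subset_Ioc_right hqt.le

theorem measurable_infSupport {S : Type*} [MeasurableSpace S] (κ : Kernel S ℝ) [IsSFiniteKernel κ]
    {c : S → ℝ} (hc : Measurable c) : Measurable fun s => infSupport (κ s) (c s) := by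
  refine measurable_of_Iio fun t => ?_
  have : (fun s => infSupport (κ s) (c s)) ⁻¹' Set.Iio t =
      ⋃ q ∈ {q : ℚ | (q : ℝ) < t}, {s | 1 ≤ (q : ℝ) ∨ κ s (Set.Ioc (c s) q) ≠ 0} := by
    ext s
    simp only [Set.mem_preimage, Set.mem_Iio, infSupport_lt_iff, Set.mem_iUnion, Set.mem_ofPred_eq,
      exists_prop]
    exact exists_congr fun q => and_comm
  rw [this]
  refine .biUnion (Set.to_countable _) fun q _ => ?_
  have hm : Measurable fun s => κ s (Set.Ioc (c s) q) := by
    have : MeasurableSet {x : S × ℝ | c x.1 < x.2 ∧ x.2 ≤ q} :=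
      (measurableSet_lt (hc.comp measurable_fst) measurable_snd).inter
        (measurableSet_le measurable_snd measurable_const)
    exact Kernel.measurable_kernel_prodMk_left this
  exact (MeasurableSet.const _).union (hm (measurableSet_singleton (0 : ℝ≥0∞))).compl

/-- `(c, ∞)` contains `N` successive disjoint intervals with positive measure, with rational right
end points. -/
def HasCells (ρ : Measure ℝ) : ℕ → ℝ → Prop
  | 0, _ => True
  | N + 1, c => ∃ q : ℚ, ρ (Set.Ioc c q) ≠ 0 ∧ HasCells ρ N q

theorem HasCells.exists_disjoint {ρ : Measure ℝ} {N : ℕ} {c : ℚ} (h : HasCells ρ N c) :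
    ∃ q : Fin N → ℚ × ℚ,
      (Pairwise fun i j => Disjoint (Set.Ioc ((q i).1 : ℝ) (q i).2) (Set.Ioc (q j).1 (q j).2)) ∧
      (∀ j, ρ (Set.Ioc (q j).1 (q j).2) ≠ 0) ∧ ∀ j, c ≤ (q j).1 := by
  induction N generalizing c with
  | zero => exact ⟨Fin.elim0, fun i => i.elim0, fun i => i.elim0, fun i => i.elim0⟩
  | succ N ih =>
    obtain ⟨r, hr, hN⟩ := h
    obtain ⟨q, hd, hp, hle⟩ := ih hN
    have hcr : c ≤ r := by
      by_contra hcr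
      refine hr ?_
      rw [Set.Ioc_eq_empty (by exact_mod_cast (fun h : c < r => hcr h.le))]
      simp
    refine ⟨Fin.cons (c, r) q, ?_, ?_, ?_⟩
    · have h0 : ∀ j, Disjoint (Set.Ioc (c : ℝ) r) (Set.Ioc (q j).1 (q j).2) := by
        intro j
        rw [Set.disjoint_left]
        intro x hx hx'
        have : (r : ℝ) ≤ (q j).1 := by exact_mod_cast hle j
        linarith [hx.2, hx'.1]
      intro i j hij
      refine Fin.cases (fun hij => ?_) (fun i hij => ?_) i hij
      · refine Fin.cases (fun h => absurd rfl h) (fun j _ => by simpa using h0 j) j hij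
      · refine Fin.cases (fun _ => by simpa using (h0 i).symm) (fun j hij => ?_) j hij
        simpa using hd (fun h => hij (by rw [h]))
    · exact Fin.cases (by simpa using hr) (fun j => by simpa using hp j)
    · exact Fin.cases (by simp) (fun j => by simpa using hcr.trans (hle j))

/-- The first cell beyond the infimum of the support still has positive mass when it is shortened to
start at a rational `r` strictly to the right of the infimum. Then `(c, r]` has positive mass by
definition of the infimum and is the additional cell; `r < 1` because there is no mass on `[1, ∞)`.
-/
theorem HasCells.of_infSupport {ρ : Measure ℝ} (h1 : ρ (Set.Ici 1) = 0) {N : ℕ} {c : ℝ}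
    (h : HasCells ρ (N + 1) (infSupport ρ c)) : HasCells ρ (N + 2) c := by
  obtain ⟨q, hq, hN⟩ := h
  have : Set.Ioc (infSupport ρ c) q ⊆
      ⋃ r ∈ {r : ℚ | infSupport ρ c < r}, Set.Ioc (r : ℝ) q := by
    intro t ht
    obtain ⟨r, hr, hrt⟩ := exists_rat_btwn ht.1
    exact Set.mem_biUnion (show r ∈ {r : ℚ | infSupport ρ c < r} from hr) ⟨hrt, ht.2⟩
  have hex : ∃ r : ℚ, infSupport ρ c < r ∧ ρ (Set.Ioc (r : ℝ) q) ≠ 0 := by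
    by_contra! hcon
    exact hq (measure_mono_null this
      ((measure_biUnion_null_iff (Set.to_countable _)).2 fun r hr => hcon r hr))
  obtain ⟨r, hr, hrq⟩ := hex
  refine ⟨r, measure_Ioc_ne_zero_of_infSupport_lt hr ?_, q, hrq, hN⟩
  by_contra! h
  exact hrq (measure_mono_null (fun x hx => h.trans hx.1.le) h1)

/-- The successive points of the support of `ρ` in `(0, 1)`. -/
noncomputable def supportPoint (ρ : Measure ℝ) (c : ℝ) : ℕ → ℝ
  | 0 => c
  | j + 1 => infSupport ρ (supportPoint ρ c j)

theorem supportPoint_succ' (ρ : Measure ℝ) (c : ℝ) (j : ℕ) :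
    supportPoint ρ c (j + 1) = supportPoint ρ (infSupport ρ c) j := by
  induction j with
  | zero => rfl
  | succ j ih => rw [supportPoint, ih, supportPoint]

/-- Induction on the number of cells. All the mass of `(c, infSupport ρ c]` sits at its right end
point, and by `HasCells.of_infSupport` one cell fewer is available beyond it. The hypothesis `c ≤ 1`
guarantees that truncation at `1` does not put the infimum to the left of `c`. -/
theorem restrict_Ioi_eq_sum_dirac {ρ : Measure ℝ} (h1 : ρ (Set.Ici 1) = 0) {N : ℕ}
    {c : ℝ} (hc : c ≤ 1) (h : ¬ HasCells ρ (N + 1) c) :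
    ρ.restrict (Set.Ioi c) = ∑ j ∈ Finset.range N,
      ρ (Set.Ioc (supportPoint ρ c j) (supportPoint ρ c (j + 1))) •
        Measure.dirac (supportPoint ρ c (j + 1)) := by
  induction N generalizing c with
  | zero =>
    rw [Finset.range_zero, Finset.sum_empty, Measure.restrict_eq_zero]
    have : Set.Ioi c ⊆ ⋃ q : ℚ, Set.Ioc c (q : ℝ) := by
      intro t ht
      obtain ⟨q, hq⟩ := exists_rat_gt t
      exact Set.mem_iUnion.2 ⟨q, ht, hq.le⟩
    refine measure_mono_null this (measure_iUnion_null fun q => ?_)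
    by_contra hq
    exact h ⟨q, hq, trivial⟩
  | succ N ih =>
    have hle : c ≤ infSupport ρ c := (le_min le_rfl hc).trans (min_le_infSupport ρ c)
    have ih' := ih (infSupport_le_one ρ c) (fun h' => h (h'.of_infSupport h1))
    rw [Finset.sum_range_succ']
    simp_rw [supportPoint_succ' ρ c, ← ih']
    have hsplit : Set.Ioi c = Set.Ioi (infSupport ρ c) ∪ Set.Ioc c (infSupport ρ c) := by
      rw [Set.union_comm, Set.Ioc_union_Ioi_eq_Ioi hle]
    rw [hsplit, Measure.restrict_union _ measurableSet_Ioc]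
    · congr 1
      change ρ.restrict (Set.Ioc c (infSupport ρ c)) = ρ (Set.Ioc c (infSupport ρ c)) •
        Measure.dirac (infSupport ρ c)
      rcases hle.eq_or_lt with heq | hlt
      · rw [← heq]; simp
      · have hz := measure_Ioc_infSupport_lt ρ c
        rw [← Set.Ioo_union_right hlt]
        rw [Measure.restrict_union (by simp) (measurableSet_singleton _),
          Measure.restrict_eq_zero.2 hz, zero_add, Measure.restrict_singleton]
        congr 1
        refine le_antisymm (measure_mono Set.subset_union_right) ?_
        exact (measure_union_le _ _).trans (by rw [hz, zero_add])
    · rw [Set.disjoint_left]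
      intro x hx hx'
      exact absurd hx.out (not_lt.2 hx'.2)

/-- A standard Borel space is measurably embedded in the open unit interval. -/
theorem exists_measurableEmbedding_Ioo (Y : Type*) [MeasurableSpace Y] [StandardBorelSpace Y] :
    ∃ e : Y → ℝ, MeasurableEmbedding e ∧ ∀ y, e y ∈ Set.Ioo (0 : ℝ) 1 := by
  have hs : MeasurableEmbedding Real.sigmoid :=
    (continuous_sigmoid).measurableEmbedding Real.sigmoid_strictMono.injective
  exact ⟨Real.sigmoid ∘ embeddingReal Y, hs.comp (measurableEmbedding_embeddingReal Y),
    fun y => ⟨Real.sigmoid_pos _, Real.sigmoid_lt_one _⟩⟩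

/-- A kernel is a mixture of at most `N` Dirac masses, which depend measurably on the parameter,
at each parameter at which no member of some countable family of `(N + 1)`-tuples of disjoint
sets consists of sets with positive measure. -/
theorem ProbabilityTheory.Kernel.exists_eq_sum_dirac {S Y : Type*} [MeasurableSpace S]
    [MeasurableSpace Y] [StandardBorelSpace Y] [Nonempty Y] (κ : Kernel S Y) [IsFiniteKernel κ]
    (N : ℕ) :
    ∃ (ι : Type) (_ : Countable ι) (B : ι → Fin (N + 1) → Set Y),
      (∀ i j, MeasurableSet (B i j)) ∧ (∀ i, Pairwise fun j k => Disjoint (B i j) (B i k)) ∧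
      ∃ (γ : Fin N → S → ℝ≥0∞) (c : Fin N → S → Y), (∀ j, Measurable (γ j)) ∧
        (∀ j, Measurable (c j)) ∧
        ∀ s, (∀ i, ∃ j, κ s (B i j) = 0) → κ s = ∑ j, γ j s • Measure.dirac (c j s) := by
  obtain ⟨e, he, h01⟩ := exists_measurableEmbedding_Ioo Y
  obtain ⟨g, hg, hge⟩ := he.exists_measurable_extend (g := id) measurable_id (fun _ => ‹_›)
  have hpt : ∀ j, Measurable fun s => supportPoint (κ.map e s) 0 j := by
    intro j
    induction j with
    | zero => exact measurable_const
    | succ j ih => exact measurable_infSupport (κ.map e) ih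
  -- The countable family consists of the preimages of tuples of disjoint rational intervals. The
  -- atoms are the successive support points of the image measure, brought back by the left inverse
  -- `g`, and each weight is the mass between consecutive support points.
  refine ⟨{q : Fin (N + 1) → ℚ × ℚ // Pairwise fun i j =>
      Disjoint (Set.Ioc ((q i).1 : ℝ) (q i).2) (Set.Ioc (q j).1 (q j).2)}, inferInstance,
    fun q j => e ⁻¹' Set.Ioc (q.1 j).1 (q.1 j).2, fun q j => he.measurable measurableSet_Ioc,
    fun q j k hjk => (q.2 hjk).preimage e,
    fun j s => κ.map e s (Set.Ioc (supportPoint (κ.map e s) 0 j)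
      (supportPoint (κ.map e s) 0 (j + 1))),
    fun j s => g (supportPoint (κ.map e s) 0 (j + 1)), fun j => ?_,
    fun j => hg.comp (hpt _), fun s hs => ?_⟩
  · have : MeasurableSet {x : S × ℝ | supportPoint (κ.map e x.1) 0 j < x.2 ∧
        x.2 ≤ supportPoint (κ.map e x.1) 0 (j + 1)} :=
      (measurableSet_lt ((hpt j).comp measurable_fst) measurable_snd).inter
        (measurableSet_le measurable_snd ((hpt (j + 1)).comp measurable_fst))
    exact Kernel.measurable_kernel_prodMk_left this
  · have hap : ∀ B, MeasurableSet B → κ.map e s B = κ s (e ⁻¹' B) := fun B hB => by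
      rw [Kernel.map_apply' _ he.measurable _ hB]
    have hcells : ¬ HasCells (κ.map e s) (N + 1) (0 : ℝ) := by
      intro h
      obtain ⟨q, hd, hp, -⟩ := HasCells.exists_disjoint (c := 0) (by simpa using h)
      obtain ⟨j, hj⟩ := hs ⟨q, hd⟩
      exact hp j (by rw [hap _ measurableSet_Ioc]; exact hj)
    have h1 : κ.map e s (Set.Ici 1) = 0 := by
      rw [hap _ measurableSet_Ici]
      convert measure_empty (μ := κ s)
      ext y
      simpa using (h01 y).2
    have h0 : (κ.map e s).restrict (Set.Ioi 0) = κ.map e s := by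
      refine Measure.restrict_eq_self_of_ae_mem ?_
      rw [Kernel.map_apply _ he.measurable, he.ae_map_iff]
      exact Eventually.of_forall fun y => (h01 y).1
    have hsum := restrict_Ioi_eq_sum_dirac h1 zero_le_one hcells
    rw [h0] at hsum
    have hback : (κ.map e s).map g = κ s := by
      rw [Kernel.map_apply _ he.measurable, Measure.map_map hg he.measurable, hge, Measure.map_id]
    rw [← hback]
    conv_lhs => rw [hsum]
    rw [Finset.sum_range fun j => κ.map e s (Set.Ioc (supportPoint (κ.map e s) 0 j)
      (supportPoint (κ.map e s) 0 (j + 1))) • Measure.dirac (supportPoint (κ.map e s) 0 (j + 1))]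
    rw [← Measure.mapₗ_apply_of_measurable hg, map_sum]
    refine Finset.sum_congr rfl fun j _ => ?_
    rw [map_smul, Measure.mapₗ_apply_of_measurable hg, Measure.map_dirac' hg]

/-- **Selection theorem of Blackwell and Ryll-Nardzewski**: if the sections of a Borel set have
full measure for a Markov kernel, then they have a measurable selector. -/
theorem ProbabilityTheory.Kernel.exists_measurable_selector {S Y : Type*} [MeasurableSpace S]
    [MeasurableSpace Y] [StandardBorelSpace Y] [Nonempty Y] (κ : Kernel S Y) [IsMarkovKernel κ]
    {D : Set (S × Y)} (hD : MeasurableSet D) (h : ∀ s, κ s (Prod.mk s ⁻¹' D) = 1) :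
    ∃ f : S → Y, Measurable f ∧ ∀ s, (s, f s) ∈ D := by
  obtain ⟨e, he, h01⟩ := exists_measurableEmbedding_Ioo Y
  obtain ⟨g, hg, hge⟩ := he.exists_measurable_extend (g := id) measurable_id (fun _ => ‹_›)
  have hgey : ∀ y, g (e y) = y := fun y => congrFun hge y
  have hD' : MeasurableSet (Prod.map id e '' D) :=
    ((MeasurableEmbedding.id.prodMap he).measurableSet_image).2 hD
  have : IsMarkovKernel (κ.map e) := IsMarkovKernel.map κ he.measurable
  -- Any bound below `1` would do: since `D` has full mass in each section, `C` has nonzero mass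
  -- there.
  obtain ⟨C, hCD, hC, hcl, hle⟩ := (κ.map e).exists_subset_isClosed_sections hD'
    (ε := 1 / 2) (by simp)
  have hCm : Measurable (Function.uncurry fun (s : S) (y : ℝ) =>
      C.indicator (1 : S × ℝ → ℝ≥0∞) (s, y)) := measurable_one.indicator hC
  let κ' : Kernel S ℝ := (κ.map e).withDensity fun s y => C.indicator 1 (s, y)
  have hκ' : ∀ s, κ' s = (κ.map e s).restrict (Prod.mk s ⁻¹' C) := by
    intro s
    rw [Kernel.withDensity_apply _ hCm]
    rw [← withDensity_indicator_one (measurable_prodMk_left hC)]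
    rfl
  have : IsFiniteKernel κ' := Kernel.isFiniteKernel_withDensity_of_bounded _
    ENNReal.one_ne_top fun s y => Set.indicator_le_self' (fun _ _ => zero_le) _
  have hpos : ∀ s, κ.map e s (Prod.mk s ⁻¹' C) ≠ 0 := by
    intro s h0
    have h1 : κ.map e s (Prod.mk s ⁻¹' (Prod.map id e '' D)) = 1 := by
      rw [Kernel.map_apply' _ he.measurable _ (measurable_prodMk_left hD'), ← h s]
      congr 1
      ext y
      simp [he.injective.eq_iff]
    have h2 : κ.map e s (Prod.mk s ⁻¹' (Prod.map id e '' D)) ≤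
        κ.map e s (Prod.mk s ⁻¹' C) + κ.map e s (Prod.mk s ⁻¹' (Prod.map id e '' D \ C)) := by
      refine (measure_mono ?_).trans (measure_union_le _ _)
      intro y hy
      by_cases hyC : (s, y) ∈ C
      · exact Or.inl hyC
      · exact Or.inr ⟨hy, hyC⟩
    rw [h0, h1, zero_add] at h2
    have := h2.trans (hle s)
    norm_num at this
  -- The selected point is the leftmost support point of the measure restricted to `C`; it belongs
  -- to the section of `C` because this section is closed.
  let f : S → ℝ := fun s => infSupport (κ' s) 0
  have hf : Measurable f := measurable_infSupport κ' measurable_const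
  have hCy : ∀ {s t}, (s, t) ∈ C → ∃ y, e y = t ∧ (s, y) ∈ D := by
    intro s t hst
    obtain ⟨⟨s', y⟩, h1, h2⟩ := hCD hst
    simp only [Prod.map_apply, id_eq, Prod.mk.injEq] at h2
    exact ⟨y, h2.2, by rw [← h2.1]; exact h1⟩
  have hfC : ∀ s, (s, f s) ∈ C := by
    intro s
    have hsec : ∀ t ∈ Prod.mk s ⁻¹' C, t ∈ Set.Ioo (0 : ℝ) 1 := by
      intro t ht
      obtain ⟨y, rfl, -⟩ := hCy ht
      exact h01 y
    have hrest : ∀ B, MeasurableSet B → κ' s B = κ.map e s (B ∩ Prod.mk s ⁻¹' C) := fun B hB => by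
      rw [hκ', Measure.restrict_apply hB]
    have hlt1 : f s < 1 := by
      by_contra! hge1
      have hz : κ' s (Set.Ioo 0 1) = 0 :=
        measure_mono_null (Set.Ioo_subset_Ioo_right hge1) (measure_Ioc_infSupport_lt (κ' s) 0)
      rw [hrest _ measurableSet_Ioo, Set.inter_eq_right.2 hsec] at hz
      exact hpos s hz
    have hf0 : 0 ≤ f s := by
      have := min_le_infSupport (κ' s) 0
      simpa using this
    have hmem : f s ∈ closure (Prod.mk s ⁻¹' C) := by
      rw [Metric.mem_closure_iff]
      intro ε hε
      obtain ⟨t, ht1, ht2⟩ := exists_between (lt_min hlt1 (lt_add_of_pos_right (f s) hε))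
      rw [lt_min_iff] at ht2
      have hne : κ' s (Set.Ioc 0 t) ≠ 0 := measure_Ioc_ne_zero_of_infSupport_lt ht1 ht2.1
      have hne2 : (Set.Icc (f s) t ∩ Prod.mk s ⁻¹' C).Nonempty := by
        rw [Set.nonempty_iff_ne_empty]
        intro hem
        refine hne (measure_mono_null (t := Set.Ioo 0 (f s) ∪ Set.Icc (f s) t) ?_ ?_)
        · intro x hx
          rcases lt_or_ge x (f s) with h | h
          · exact Or.inl ⟨hx.1, h⟩
          · exact Or.inr ⟨h, hx.2⟩
        · rw [measure_union_null_iff]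
          refine ⟨measure_Ioc_infSupport_lt _ _, ?_⟩
          rw [hrest _ measurableSet_Icc, hem, measure_empty]
      obtain ⟨x, hx, hxC⟩ := hne2
      refine ⟨x, hxC, ?_⟩
      rw [Real.dist_eq, abs_sub_comm, abs_of_nonneg (by linarith [hx.1])]
      linarith [hx.2]
    rwa [(hcl s).closure_eq] at hmem
  refine ⟨fun s => g (f s), hg.comp hf, fun s => ?_⟩
  obtain ⟨y, hy, hyD⟩ := hCy (hfC s)
  simp only [← hy, hgey]
  exact hyD

/-! ### Discounted potentials of a kernel -/

section Potential

variable {X : Type*} [MeasurableSpace X]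

/-- The discounted potential `∑ n, b ^ n • a κ ^ n` of the measure `a`. -/
noncomputable def potential (κ : Kernel X X) (b : ℝ≥0∞) (a : Measure X) : Measure X :=
  Measure.sum fun n => b ^ n • (fun ν : Measure X => κ ∘ₘ ν)^[n] a

theorem sum_comp_measure {Y ι : Type*} [MeasurableSpace Y] (κ : Kernel X Y) (a : ι → Measure X) :
    κ ∘ₘ (Measure.sum a) = Measure.sum fun i => κ ∘ₘ a i :=
  Measure.bind_sum _ _ κ.aemeasurable

theorem comp_measure_mono {Y : Type*} [MeasurableSpace Y] (κ : Kernel X Y) {a b : Measure X}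
    (h : a ≤ b) : κ ∘ₘ a ≤ κ ∘ₘ b := by
  refine Measure.le_iff.2 fun s hs => ?_
  rw [Measure.bind_apply hs κ.aemeasurable, Measure.bind_apply hs κ.aemeasurable]
  exact lintegral_mono' h le_rfl

theorem sum_smul_measure {ι : Type*} (c : ℝ≥0∞) (a : ι → Measure X) :
    Measure.sum (fun i => c • a i) = c • Measure.sum a := by
  ext s hs
  simp [Measure.sum_apply _ hs, ENNReal.tsum_mul_left]

theorem sum_nat_succ (a : ℕ → Measure X) :
    Measure.sum a = a 0 + Measure.sum fun n => a (n + 1) := by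
  ext s hs
  rw [Measure.add_apply, Measure.sum_apply _ hs, Measure.sum_apply _ hs,
    tsum_eq_zero_add' ENNReal.summable]

theorem potential_eq (κ : Kernel X X) (b : ℝ≥0∞) (a : Measure X) :
    potential κ b a = a + b • (κ ∘ₘ potential κ b a) := by
  conv_lhs => rw [potential, sum_nat_succ]
  rw [potential, sum_comp_measure, ← sum_smul_measure]
  simp only [pow_zero, one_smul, Function.iterate_zero, id_eq, Function.iterate_succ_apply',
    pow_succ', mul_smul, Measure.comp_smul]

theorem iterate_comp_smul (κ : Kernel X X) (c : ℝ≥0∞) (a : Measure X) (n : ℕ) :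
    (fun ν : Measure X => κ ∘ₘ ν)^[n] (c • a) = c • (fun ν : Measure X => κ ∘ₘ ν)^[n] a := by
  induction n with
  | zero => rfl
  | succ n ih => rw [Function.iterate_succ_apply', Function.iterate_succ_apply', ih,
      Measure.comp_smul]

theorem iterate_comp_mono (κ : Kernel X X) {a a' : Measure X} (h : a ≤ a') (n : ℕ) :
    (fun ν : Measure X => κ ∘ₘ ν)^[n] a ≤ (fun ν : Measure X => κ ∘ₘ ν)^[n] a' := by
  induction n with
  | zero => exact h
  | succ n ih =>
    rw [Function.iterate_succ_apply', Function.iterate_succ_apply']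
    exact comp_measure_mono κ ih

theorem potential_mono (κ : Kernel X X) (b : ℝ≥0∞) {a a' : Measure X} (h : a ≤ a') :
    potential κ b a ≤ potential κ b a' := by
  refine Measure.le_iff.2 fun s hs => ?_
  rw [potential, potential, Measure.sum_apply _ hs, Measure.sum_apply _ hs]
  refine ENNReal.tsum_le_tsum fun n => ?_
  simp only [Measure.smul_apply, smul_eq_mul]
  gcongr
  exact iterate_comp_mono κ h n

theorem potential_add (κ : Kernel X X) (b : ℝ≥0∞) (a a' : Measure X) :
    potential κ b (a + a') = potential κ b a + potential κ b a' := by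
  have h : ∀ n, (fun ν : Measure X => κ ∘ₘ ν)^[n] (a + a') =
      (fun ν : Measure X => κ ∘ₘ ν)^[n] a + (fun ν : Measure X => κ ∘ₘ ν)^[n] a' := by
    intro n
    induction n with
    | zero => rfl
    | succ n ih => simp only [Function.iterate_succ_apply', ih, Measure.comp_add]
  simp only [potential, h, smul_add, ← Measure.sum_add_sum]

theorem potential_zero (κ : Kernel X X) (b : ℝ≥0∞) : potential κ b 0 = 0 := by
  have h : ∀ n, (fun ν : Measure X => κ ∘ₘ ν)^[n] 0 = 0 := by
    intro n
    induction n with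
    | zero => rfl
    | succ n ih => simp only [Function.iterate_succ_apply', ih, Measure.bind_zero_left]
  simp only [potential, h, smul_zero, Measure.sum_zero]

theorem potential_finset_sum {ι : Type*} (κ : Kernel X X) (b : ℝ≥0∞) (s : Finset ι)
    (a : ι → Measure X) : potential κ b (∑ i ∈ s, a i) = ∑ i ∈ s, potential κ b (a i) := by
  classical
  induction s using Finset.induction_on with
  | empty => simp [potential_zero]
  | insert i s hi ih => rw [Finset.sum_insert hi, Finset.sum_insert hi, potential_add, ih]

/-- The left side is the tail of the defining series from index `k` on. -/
theorem potential_iterate_le (κ : Kernel X X) (b : ℝ≥0∞) (a : Measure X) (k : ℕ) :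
    potential κ b (b ^ k • (fun ν : Measure X => κ ∘ₘ ν)^[k] a) ≤ potential κ b a := by
  refine Measure.le_iff.2 fun s hs => ?_
  rw [potential, potential, Measure.sum_apply _ hs, Measure.sum_apply _ hs]
  simp_rw [iterate_comp_smul, ← Function.iterate_add_apply, ← mul_smul, ← pow_add]
  exact ENNReal.tsum_comp_le_tsum_of_injective (add_left_injective k)
    (fun n => (b ^ n • (fun ν : Measure X => κ ∘ₘ ν)^[n] a) s)

/-- The potential is the smallest solution of its equation. -/
theorem potential_le (κ : Kernel X X) (b : ℝ≥0∞) {a Q : Measure X}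
    (h : Q = a + b • (κ ∘ₘ Q)) : potential κ b a ≤ Q := by
  -- Iterating the equation from `0 ≤ Q` produces the partial sums of the series.
  have key : ∀ N, ∑ n ∈ Finset.range N, b ^ n • (fun ν : Measure X => κ ∘ₘ ν)^[n] a ≤ Q := by
    intro N
    induction N with
    | zero => exact Measure.zero_le Q
    | succ N ih =>
      rw [Finset.sum_range_succ', h, add_comm a]
      refine add_le_add ?_ (by simp)
      have : ∑ n ∈ Finset.range N, b ^ (n + 1) • (fun ν : Measure X => κ ∘ₘ ν)^[n + 1] a =
          b • (κ ∘ₘ ∑ n ∈ Finset.range N, b ^ n • (fun ν : Measure X => κ ∘ₘ ν)^[n] a) := by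
        have e : ∀ (s : Finset ℕ) (g : ℕ → Measure X), κ ∘ₘ ∑ n ∈ s, g n = ∑ n ∈ s, κ ∘ₘ g n := by
          intro s g
          induction s using Finset.induction_on with
          | empty => simp
          | insert i s hi ih => rw [Finset.sum_insert hi, Finset.sum_insert hi, Measure.comp_add, ih]
        rw [e, Finset.smul_sum]
        refine Finset.sum_congr rfl fun n _ => ?_
        rw [Function.iterate_succ_apply', pow_succ', mul_smul, Measure.comp_smul]
      rw [this]
      refine Measure.le_iff.2 fun s hs => ?_
      simp only [Measure.smul_apply, smul_eq_mul]
      gcongr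
      exact comp_measure_mono κ ih
  refine Measure.le_iff.2 fun s hs => ?_
  rw [potential, Measure.sum_apply _ hs, ENNReal.tsum_eq_iSup_nat]
  refine iSup_le fun N => ?_
  have := Measure.le_iff'.1 (key N) s
  rwa [Measure.finsetSum_apply] at this

theorem comp_measure_univ {Y : Type*} [MeasurableSpace Y] (κ : Kernel X Y) [IsMarkovKernel κ]
    (a : Measure X) : (κ ∘ₘ a) Set.univ = a Set.univ := by
  rw [Measure.bind_apply .univ κ.aemeasurable]
  simp

/-- By minimality `Q` dominates the potential. A Markov kernel preserves mass, so the equation alone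
determines the total mass of a finite solution when `b < 1`; two ordered finite measures with the
same mass coincide. -/
theorem eq_potential_of_eq (κ : Kernel X X) [IsMarkovKernel κ] {b : ℝ≥0∞} (hb : b < 1)
    {a Q : Measure X} [IsFiniteMeasure Q] (h : Q = a + b • (κ ∘ₘ Q)) : Q = potential κ b a := by
  have hle := potential_le κ b h
  have : IsFiniteMeasure (potential κ b a) := isFiniteMeasure_of_le Q hle
  refine (Measure.eq_of_le_of_measure_univ_eq hle ?_).symm
  have mass : ∀ R : Measure X, IsFiniteMeasure R → R = a + b • (κ ∘ₘ R) →
      (R Set.univ).toReal * (1 - b.toReal) = (a Set.univ).toReal := by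
    intro R hR hRe
    have h1 : R Set.univ = a Set.univ + b * R Set.univ := by
      conv_lhs => rw [hRe]
      simp
    have ha : a Set.univ ≠ ∞ := by
      intro ha
      rw [ha] at h1
      exact measure_ne_top R Set.univ (by rw [h1]; simp)
    have h2 := congrArg ENNReal.toReal h1
    rw [ENNReal.toReal_add ha (ENNReal.mul_ne_top (hb.trans ENNReal.one_lt_top).ne
      (measure_ne_top _ _)), ENNReal.toReal_mul] at h2
    linarith
  have hb' : b.toReal < 1 := by
    rw [← ENNReal.toReal_one]
    exact ENNReal.toReal_strict_mono ENNReal.one_ne_top hb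
  have h1 := mass Q inferInstance h
  have h2 := mass _ this (potential_eq κ b a)
  rw [← ENNReal.toReal_eq_toReal_iff' (measure_ne_top _ _) (measure_ne_top _ _)]
  have : (1 - b.toReal) ≠ 0 := by linarith
  exact mul_right_cancel₀ this (h2.trans h1.symm)

end Potential

namespace CMDP

variable {S : Type u} {A : Type v} [MeasurableSpace S] [MeasurableSpace A] {m : ℕ}
variable (M : CMDP S A m)

/-! ### State-action laws and occupation measures -/

/-- The law of the state under a measure on the feasible state-action pairs. -/
noncomputable def stateLaw (Q : Measure M.K) : Measure S := Q.map fun x => x.1.1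

theorem measurable_state : Measurable fun x : M.K => x.1.1 :=
  measurable_fst.comp measurable_subtype_coe

/-- The discount factor, as an extended nonnegative real number. -/
noncomputable def disc : ℝ≥0∞ := ENNReal.ofReal M.β

theorem disc_lt_one : M.disc < 1 := by
  rw [disc, ENNReal.ofReal_lt_one]
  exact M.β_lt_one

theorem disc_ne_zero : M.disc ≠ 0 := by
  rw [disc, Ne, ENNReal.ofReal_eq_zero, not_le]
  exact M.β_pos

theorem disc_pow (n : ℕ) : M.disc ^ n = ENNReal.ofReal (M.β ^ n) :=
  (ENNReal.ofReal_pow M.β_pos.le n).symm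

theorem disc_ne_top : M.disc ≠ ∞ := ENNReal.ofReal_ne_top

theorem stateLaw_apply (Q : Measure M.K) {B : Set S} (hB : MeasurableSet B) :
    M.stateLaw Q B = Q ((fun x => x.1.1) ⁻¹' B) := Measure.map_apply M.measurable_state hB

theorem stateLaw_univ (Q : Measure M.K) : M.stateLaw Q Set.univ = Q Set.univ :=
  M.stateLaw_apply Q .univ

theorem stateLaw_add (Q R : Measure M.K) : M.stateLaw (Q + R) = M.stateLaw Q + M.stateLaw R :=
  Measure.map_add _ _ M.measurable_state

theorem stateLaw_smul (c : ℝ≥0∞) (Q : Measure M.K) : M.stateLaw (c • Q) = c • M.stateLaw Q :=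
  Measure.map_smul _ _ _

/-- A sequence of one-dimensional laws of the state-action process. -/
structure IsFlow (F : ℕ → Measure M.K) : Prop where
  zero : M.stateLaw (F 0) = M.μ
  succ : ∀ n, M.stateLaw (F (n + 1)) = M.p ∘ₘ F n

/-- The discounted occupation measure of a sequence of laws. -/
noncomputable def occ (F : ℕ → Measure M.K) : Measure M.K := Measure.sum fun n => M.disc ^ n • F n

/-- The balance equation of discounted occupation measures. -/
structure IsOcc (Q : Measure M.K) : Prop where
  finite : IsFiniteMeasure Q
  balance : M.stateLaw Q = M.μ + M.disc • (M.p ∘ₘ Q)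

variable {M}

theorem IsFlow.isProbabilityMeasure {F : ℕ → Measure M.K} (hF : M.IsFlow F) (n : ℕ) :
    IsProbabilityMeasure (F n) := by
  induction n with
  | zero => exact ⟨by rw [← stateLaw_univ, hF.zero, measure_univ]⟩
  | succ n ih => exact ⟨by rw [← stateLaw_univ, hF.succ, comp_measure_univ, measure_univ]⟩

theorem IsFlow.isOcc {F : ℕ → Measure M.K} (hF : M.IsFlow F) : M.IsOcc (M.occ F) where
  finite := by
    constructor
    rw [occ, Measure.sum_apply _ .univ]
    have : ∀ n, (M.disc ^ n • F n) Set.univ = M.disc ^ n := fun n => by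
      have := hF.isProbabilityMeasure n
      simp
    simp_rw [this]
    rw [ENNReal.tsum_geometric]
    exact ENNReal.inv_lt_top.2 (tsub_pos_of_lt M.disc_lt_one)
  balance := by
    conv_lhs => rw [occ, stateLaw, Measure.map_sum M.measurable_state.aemeasurable, sum_nat_succ]
    have h : ∀ n, (M.disc ^ n • F n).map (fun x : M.K => x.1.1) = M.disc ^ n • M.stateLaw (F n) :=
      fun n => M.stateLaw_smul _ _
    simp_rw [h, hF.zero, hF.succ]
    rw [occ, sum_comp_measure, ← sum_smul_measure]
    simp only [pow_zero, one_smul, pow_succ', mul_smul, Measure.comp_smul]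

/-- All occupation measures have the same mass, so adding a constant to a reward shifts all
integrals equally; this permits working with the nonnegative shortfalls `l - r i`. -/
theorem IsOcc.measure_univ {Q : Measure M.K} (hQ : M.IsOcc Q) :
    Q Set.univ = ENNReal.ofReal (1 - M.β)⁻¹ := by
  have := hQ.finite
  have h1 : Q Set.univ = 1 + M.disc * Q Set.univ := by
    conv_lhs => rw [← stateLaw_univ, hQ.balance]
    simp
  have h2 := congrArg ENNReal.toReal h1
  rw [ENNReal.toReal_add ENNReal.one_ne_top (ENNReal.mul_ne_top M.disc_ne_top
    (measure_ne_top _ _)), ENNReal.toReal_mul, disc, ENNReal.toReal_ofReal M.β_pos.le,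
    ENNReal.toReal_one] at h2
  have h3 : (1 - M.β) ≠ 0 := by linarith [M.β_lt_one]
  rw [← ENNReal.ofReal_toReal (measure_ne_top Q Set.univ)]
  congr 1
  field_simp
  linarith

/-! ### Stationary policies -/

theorem map_comap_val {ν : Measure (S × A)} (h : ∀ᵐ x ∂ν, x.2 ∈ M.actions x.1) :
    (ν.comap (Subtype.val : M.K → S × A)).map Subtype.val = ν := by
  rw [M.measurableEmbedding_K.map_comap]
  refine Measure.restrict_eq_self_of_ae_mem ?_
  filter_upwards [h] with x hx
  exact ⟨⟨x, hx⟩, rfl⟩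

/-- The law of the state-action pair from a state under a stationary policy. -/
noncomputable def StationaryPolicy.lift (φ : M.StationaryPolicy) : Kernel S M.K :=
  (Kernel.id ×ₖ φ.kernel).comapRight M.measurableEmbedding_K

theorem StationaryPolicy.lift_apply' (φ : M.StationaryPolicy) (s : S) {B : Set (S × A)}
    (hB : MeasurableSet B) : φ.lift s (Subtype.val ⁻¹' B) = φ.kernel s (Prod.mk s ⁻¹' B) := by
  have hK : MeasurableSet (Set.range (Subtype.val : M.K → S × A)) :=
    M.measurableEmbedding_K.measurableSet_range
  rw [lift, Kernel.comapRight_apply' _ _ _ (measurable_subtype_coe hB),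
    Set.image_preimage_eq_inter_range, Kernel.prod_apply' _ _ _ (hB.inter hK), Kernel.id_apply,
    lintegral_dirac' _ (measurable_measure_prodMk_left (hB.inter hK)), Set.preimage_inter,
    M.prodMk_preimage_graph]
  have : ∀ᵐ a ∂φ.kernel s, a ∈ M.actions s :=
    (mem_ae_iff_prob_eq_one (M.measurableSet_actions s)).2 (φ.feasible s)
  exact measure_congr (by filter_upwards [this] with a ha; exact propext (and_iff_left ha))

instance (φ : M.StationaryPolicy) : IsMarkovKernel φ.lift where
  isProbabilityMeasure s := ⟨by
    have := φ.lift_apply' s MeasurableSet.univ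
    simpa using this⟩

theorem StationaryPolicy.lift_state (φ : M.StationaryPolicy) (s : S) {B : Set S}
    (hB : MeasurableSet B) : φ.lift s ((fun x => x.1.1) ⁻¹' B) = B.indicator 1 s := by
  have h := φ.lift_apply' s (measurable_fst hB)
  change φ.lift s (Subtype.val ⁻¹' (Prod.fst ⁻¹' B)) = _
  rw [h]
  by_cases hs : s ∈ B <;> simp [hs, Set.preimage_preimage]

theorem StationaryPolicy.stateLaw_lift (φ : M.StationaryPolicy) (ν : Measure S) :
    M.stateLaw (φ.lift ∘ₘ ν) = ν := by
  ext B hB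
  rw [M.stateLaw_apply _ hB, Measure.bind_apply (M.measurable_state hB) φ.lift.aemeasurable]
  simp_rw [φ.lift_state _ hB]
  rw [lintegral_indicator_one hB]

/-- The transition kernel of the state-action process under a stationary policy. -/
noncomputable def StationaryPolicy.step (φ : M.StationaryPolicy) : Kernel M.K M.K :=
  φ.lift ∘ₖ M.p

noncomputable instance (φ : M.StationaryPolicy) : IsMarkovKernel φ.step := by
  unfold StationaryPolicy.step
  infer_instance

theorem StationaryPolicy.step_comp (φ : M.StationaryPolicy) (Q : Measure M.K) :
    φ.step ∘ₘ Q = φ.lift ∘ₘ (M.p ∘ₘ Q) := Measure.comp_assoc.symm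

theorem StationaryPolicy.stateLaw_step (φ : M.StationaryPolicy) (Q : Measure M.K) :
    M.stateLaw (φ.step ∘ₘ Q) = M.p ∘ₘ Q := by
  rw [φ.step_comp, φ.stateLaw_lift]

/-- An occupation measure whose disintegration is a stationary policy is the potential of this
policy. -/
theorem IsOcc.eq_potential {Q : Measure M.K} (hQ : M.IsOcc Q) {φ : M.StationaryPolicy}
    (hφ : φ.lift ∘ₘ M.stateLaw Q = Q) : Q = potential φ.step M.disc (φ.lift ∘ₘ M.μ) := by
  have := hQ.finite
  refine eq_potential_of_eq φ.step M.disc_lt_one ?_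
  conv_lhs => rw [← hφ, hQ.balance]
  rw [Measure.comp_add, Measure.comp_smul, φ.step_comp]

/-- Every measure on the feasible pairs is disintegrated by a stationary policy. -/
theorem exists_lift_comp_stateLaw [StandardBorelSpace A] [Nonempty A] (φ₀ : M.StationaryPolicy)
    (Q : Measure M.K) [IsFiniteMeasure Q] :
    ∃ φ : M.StationaryPolicy, φ.lift ∘ₘ M.stateLaw Q = Q := by
  classical
  let ρ : Measure (S × A) := Q.map Subtype.val
  have hRfst : ρ.fst = M.stateLaw Q := by
    rw [Measure.fst, Measure.map_map measurable_fst measurable_subtype_coe]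
    rfl
  -- The conditional kernel is feasible only for almost every state; on the remaining measurable set
  -- of states it is replaced by `φ₀`.
  let G : Set S := {s | ρ.condKernel s (M.actions s) = 1}
  have hG : MeasurableSet G :=
    (Kernel.measurable_kernel_prodMk_left (κ := ρ.condKernel) M.measurableSet_graph)
      (measurableSet_singleton 1)
  have hGae : ∀ᵐ s ∂ρ.fst, s ∈ G := by
    have h1 : ∀ᵐ x ∂(ρ.fst ⊗ₘ ρ.condKernel), x.2 ∈ M.actions x.1 := by
      rw [ρ.disintegrate, M.measurableEmbedding_K.ae_map_iff]
      exact Eventually.of_forall fun x => x.2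
    filter_upwards [Measure.ae_ae_of_ae_compProd h1] with s hs
    exact (mem_ae_iff_prob_eq_one (M.measurableSet_actions s)).1 hs
  let φ : M.StationaryPolicy :=
    { kernel := Kernel.piecewise hG ρ.condKernel φ₀.kernel
      isMarkovKernel_kernel := inferInstance
      feasible := fun s => by
        rw [Kernel.piecewise_apply]
        split_ifs with h
        · exact h
        · exact φ₀.feasible s }
  refine ⟨φ, ?_⟩
  have hmap : (φ.lift ∘ₘ M.stateLaw Q).map Subtype.val = Q.map Subtype.val := by
    ext B hB
    rw [Measure.map_apply measurable_subtype_coe hB,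
      Measure.bind_apply (measurable_subtype_coe hB) φ.lift.aemeasurable]
    simp_rw [φ.lift_apply' _ hB]
    rw [← hRfst]
    change _ = ρ B
    conv_rhs => rw [← ρ.disintegrate ρ.condKernel, Measure.compProd_apply hB]
    refine lintegral_congr_ae ?_
    filter_upwards [hGae] with s hs
    rw [Kernel.piecewise_apply, if_pos hs]
  ext B hB
  have h := congrArg (fun ν : Measure (S × A) => ν (Subtype.val '' B)) hmap
  simp only [M.measurableEmbedding_K.map_apply,
    Set.preimage_image_eq B Subtype.val_injective] at h
  exact h

/-! ### Laws of the process under a policy -/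

instance (π : M.Policy) : IsProbabilityMeasure (M.strategicMeasure π) := by
  unfold strategicMeasure
  infer_instance

/-- The law of the state-action pair at time `n`. -/
noncomputable def Policy.law (π : M.Policy) (n : ℕ) : Measure M.K :=
  (M.strategicMeasure π).map fun ω => ω n

theorem Policy.law_zero (π : M.Policy) : π.law 0 = M.initLaw π := by
  have h1 : (Kernel.traj (X := fun _ => M.K) (M.stepKernel π) 0).map (fun ω => ω 0) =
      Kernel.deterministic (fun x : (i : Finset.Iic 0) → M.K => x ⟨0, by simp⟩)
        (measurable_pi_apply _) := by
    have h2 := Kernel.traj_map_frestrictLe (X := fun _ => M.K) (κ := M.stepKernel π) 0 0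
    rw [Kernel.partialTraj_self] at h2
    have h3 : (fun ω : ℕ → M.K => ω 0) = (fun x : (i : Finset.Iic 0) → M.K => x ⟨0, by simp⟩) ∘
      (Preorder.frestrictLe (π := fun _ => M.K) 0) := rfl
    rw [h3, Kernel.map_comp_right _ (Preorder.measurable_frestrictLe _) (by fun_prop), h2, Kernel.id_map (by fun_prop)]
  rw [Policy.law, strategicMeasure, Kernel.trajMeasure, Measure.map_comp _ _ (by fun_prop), h1,
    Measure.deterministic_comp_eq_map, Measure.map_map (by fun_prop) (by fun_prop)]
  exact Measure.map_id

theorem Policy.law_succ (π : M.Policy) (n : ℕ) : π.law (n + 1) =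
    M.stepKernel π n ∘ₘ (M.strategicMeasure π).map (Preorder.frestrictLe (π := fun _ => M.K) n) := by
  have : IsProbabilityMeasure ((M.strategicMeasure π).map
      (Preorder.frestrictLe (π := fun _ => M.K) n)) :=
    Measure.isProbabilityMeasure_map (by fun_prop)
  rw [← Measure.snd_compProd, strategicMeasure,
    Kernel.map_frestrictLe_trajMeasure_compProd_eq_map_trajMeasure, Measure.snd,
    Measure.map_map (by fun_prop) (by fun_prop)]
  rfl

theorem Policy.comp_map_frestrictLe (π : M.Policy) (n : ℕ) {Y : Type*} [MeasurableSpace Y]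
    (κ : Kernel M.K Y) :
    κ.comap (fun x : (i : Finset.Iic n) → M.K => x ⟨n, Finset.mem_Iic.2 le_rfl⟩)
      (measurable_pi_apply _) ∘ₘ
      (M.strategicMeasure π).map (Preorder.frestrictLe (π := fun _ => M.K) n) = κ ∘ₘ π.law n := by
  have h : π.law n = ((M.strategicMeasure π).map
      (Preorder.frestrictLe (π := fun _ => M.K) n)).map
        (fun x : (i : Finset.Iic n) → M.K => x ⟨n, Finset.mem_Iic.2 le_rfl⟩) := by
    rw [Measure.map_map (by fun_prop) (by fun_prop)]
    rfl
  rw [h, ← Measure.deterministic_comp_eq_map (measurable_pi_apply _), Measure.comp_assoc,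
    Kernel.comp_deterministic_eq_comap]

/-- The policy only governs the choice of the action, which `stateLaw` discards; the next state
depends on the history through the last pair alone. -/
theorem Policy.isFlow (π : M.Policy) : M.IsFlow π.law where
  zero := by
    rw [π.law_zero, initLaw, stateLaw]
    have h1 : (fun x : M.K => x.1.1) = Prod.fst ∘ Subtype.val := rfl
    rw [h1, ← Measure.map_map measurable_fst measurable_subtype_coe, map_comap_val]
    · change (M.initLawProd π).fst = _
      rw [initLawProd, Measure.fst_compProd]
    · rw [initLawProd]
      refine Measure.ae_compProd_of_ae_ae M.measurableSet_graph (Eventually.of_forall fun s => ?_)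
      exact (mem_ae_iff_prob_eq_one (M.measurableSet_actions s)).2 (π.feasible 0 (Fin.elim0, s))
  succ n := by
    rw [π.law_succ, stateLaw, Measure.map_comp _ _ M.measurable_state, ← π.comp_map_frestrictLe]
    congr 1
    ext x B hB
    have hK : MeasurableSet (Set.range (Subtype.val : M.K → S × A)) :=
      M.measurableEmbedding_K.measurableSet_range
    have him : (Subtype.val : M.K → S × A) '' ((fun x : M.K => x.1.1) ⁻¹' B) =
        (Prod.fst ⁻¹' B) ∩ Set.range (Subtype.val : M.K → S × A) := by
      rw [← Set.image_preimage_eq_inter_range]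
      rfl
    rw [Kernel.map_apply' _ M.measurable_state _ hB, stepKernel,
      Kernel.comapRight_apply' _ _ _ (M.measurable_state hB), him, stepKernelProd,
      Kernel.compProd_apply ((measurable_fst hB).inter hK)]
    have h : ∀ s, ((π.kernel (n + 1)).comap (M.nextHistory n) (M.measurable_nextHistory n)) (x, s)
        (Prod.mk s ⁻¹' ((Prod.fst ⁻¹' B) ∩ Set.range (Subtype.val : M.K → S × A))) =
        B.indicator 1 s := by
      intro s
      rw [Set.preimage_inter, M.prodMk_preimage_graph, Kernel.comap_apply]
      by_cases hs : s ∈ B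
      · simp only [Set.preimage_preimage, hs, Set.preimage_const_of_mem, Set.univ_inter,
          Set.indicator_of_mem, Pi.one_apply]
        exact π.feasible (n + 1) (M.nextHistory n (x, s))
      · simp [Set.preimage_preimage, hs]
    simp_rw [h]
    rw [lintegral_indicator_one hB]

theorem StationaryPolicy.law_zero (φ : M.StationaryPolicy) :
    φ.toPolicy.law 0 = φ.lift ∘ₘ M.μ := by
  rw [Policy.law_zero, initLaw, initLawProd]
  ext B hB
  have hB' := M.measurableEmbedding_K.measurableSet_image.2 hB
  rw [M.measurableEmbedding_K.comap_apply, Measure.compProd_apply hB',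
    Measure.bind_apply hB φ.lift.aemeasurable]
  refine lintegral_congr fun s => ?_
  rw [← Set.preimage_image_eq B Subtype.val_injective, φ.lift_apply' s hB',
    Set.preimage_image_eq B Subtype.val_injective]
  rfl

theorem StationaryPolicy.law_succ (φ : M.StationaryPolicy) (n : ℕ) :
    φ.toPolicy.law (n + 1) = φ.step ∘ₘ φ.toPolicy.law n := by
  rw [Policy.law_succ, ← Policy.comp_map_frestrictLe]
  congr 1
  ext x B hB
  have hB' := M.measurableEmbedding_K.measurableSet_image.2 hB
  rw [stepKernel, Kernel.comapRight_apply' _ _ _ hB, stepKernelProd, Kernel.compProd_apply hB',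
    Kernel.comap_apply, Kernel.comap_apply, step, Kernel.comp_apply' _ _ _ hB]
  refine lintegral_congr fun s => ?_
  conv_rhs => rw [← Set.preimage_image_eq B Subtype.val_injective, φ.lift_apply' s hB']
  rfl

theorem StationaryPolicy.law_eq_iterate (φ : M.StationaryPolicy) (n : ℕ) :
    φ.toPolicy.law n = (fun ν : Measure M.K => φ.step ∘ₘ ν)^[n] (φ.lift ∘ₘ M.μ) := by
  induction n with
  | zero => exact φ.law_zero
  | succ n ih => rw [φ.law_succ, ih, Function.iterate_succ_apply']

theorem StationaryPolicy.occ_law (φ : M.StationaryPolicy) :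
    M.occ φ.toPolicy.law = potential φ.step M.disc (φ.lift ∘ₘ M.μ) := by
  simp_rw [occ, potential, ← φ.law_eq_iterate]

/-- Every solution of the balance equation is the occupation measure of a stationary policy. -/
theorem IsOcc.exists_stationary [StandardBorelSpace A] [Nonempty A] (φ₀ : M.StationaryPolicy)
    {Q : Measure M.K} (hQ : M.IsOcc Q) :
    ∃ φ : M.StationaryPolicy, φ.lift ∘ₘ M.stateLaw Q = Q ∧ M.occ φ.toPolicy.law = Q := by
  have := hQ.finite
  obtain ⟨φ, hφ⟩ := exists_lift_comp_stateLaw φ₀ Q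
  exact ⟨φ, hφ, by rw [φ.occ_law, ← hQ.eq_potential hφ]⟩

/-- The first decision rule of a policy, as a stationary policy. -/
noncomputable def Policy.initial (π : M.Policy) : M.StationaryPolicy where
  kernel := (π.kernel 0).comap (fun s => (Fin.elim0, s)) (by fun_prop)
  isMarkovKernel_kernel := inferInstance
  feasible s := by
    rw [Kernel.comap_apply]
    exact π.feasible 0 (Fin.elim0, s)

/-! ### Rewards as integrals with respect to occupation measures -/

variable (M) in
/-- The integral of `r i` with respect to `Q`, in the extended sense. -/
noncomputable def reward (i : Fin (m + 1)) (Q : Measure M.K) : EReal :=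
  ((∫⁻ x, (M.r i x).toENNReal ∂Q : ℝ≥0∞) : EReal) - ((∫⁻ x, (-M.r i x).toENNReal ∂Q : ℝ≥0∞) : EReal)

theorem lintegral_occ_law (π : M.Policy) {f : M.K → ℝ≥0∞} (hf : Measurable f) :
    ∫⁻ x, f x ∂(M.occ π.law) =
      ∫⁻ ω, ∑' n, ENNReal.ofReal (M.β ^ n) * f (ω n) ∂(M.strategicMeasure π) := by
  have hm : ∀ n, Measurable fun ω : ℕ → M.K => ENNReal.ofReal (M.β ^ n) * f (ω n) :=
    fun n => (hf.comp (measurable_pi_apply n)).const_mul _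
  rw [occ, lintegral_sum_measure, lintegral_tsum fun n => (hm n).aemeasurable]
  refine tsum_congr fun n => ?_
  rw [lintegral_smul_measure, Policy.law, lintegral_map hf (measurable_pi_apply n),
    lintegral_const_mul (f := fun ω : ℕ → M.K => f (ω n)) _ (hf.comp (measurable_pi_apply n)),
    disc_pow, smul_eq_mul]

theorem measurable_pos_r (i : Fin (m + 1)) : Measurable fun x : M.K => (M.r i x).toENNReal :=
  (M.measurable_r i).ereal_toENNReal

theorem measurable_neg_r (i : Fin (m + 1)) : Measurable fun x : M.K => (-M.r i x).toENNReal :=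
  (M.measurable_r i).neg.ereal_toENNReal

/-- This turns the control problem into an optimization over occupation measures. -/
theorem J_eq_reward (π : M.Policy) (i : Fin (m + 1)) : M.J π i = M.reward i (M.occ π.law) := by
  rw [J, JPos, JNeg, reward, lintegral_occ_law π (measurable_pos_r i),
    lintegral_occ_law π (measurable_neg_r i)]

end CMDP

namespace CMDP

variable {S : Type u} {A : Type v} [MeasurableSpace S] [MeasurableSpace A] {m : ℕ}
variable {M : CMDP S A m}

/-! ### Uniform integrability and closedness of the constraints -/

variable (M) in
/-- The part of the bound `w` above the level `l`. -/
noncomputable def excess (w : S → ℝ) (l : ℕ) (x : M.K) : ℝ≥0∞ :=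
  {s : S | (l : ℝ) ≤ w s}.indicator (fun s => ENNReal.ofReal (w s)) x.1.1

variable (M) in
/-- The shortfall of `r i` below the level `l`. -/
noncomputable def shortfall (i : Fin (m + 1)) (l : ℕ) (x : M.K) : ℝ≥0∞ :=
  (((l : ℝ) : EReal) - M.r i x).toENNReal

theorem measurable_excess {w : S → ℝ} (hw : Measurable w) (l : ℕ) :
    Measurable (M.excess w l) :=
  ((ENNReal.measurable_ofReal.comp hw).indicator
    (measurableSet_le measurable_const hw)).comp M.measurable_state

theorem measurable_shortfall (i : Fin (m + 1)) (l : ℕ) : Measurable (M.shortfall i l) := by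
  have : M.shortfall i l = fun x => (((l : ℝ) : EReal) + -(M.r i x)).toENNReal := rfl
  rw [this]
  exact (measurable_const.add (M.measurable_r i).neg).ereal_toENNReal

/-- Before time `n₀` the discount factors are bounded by `1`; from `n₀` on the excess is bounded by
`w` itself. The two sums correspond to the two conditions on `w`. -/
theorem excess_le_occ {w : S → ℝ} (hw : M.IsUpperBoundFunction w) (l n₀ : ℕ) (π : M.Policy) :
    ∫⁻ x, M.excess w l x ∂(M.occ π.law) ≤
      (∑ n ∈ Finset.range n₀, ∫⁻ ω, {s : S | (l : ℝ) ≤ w s}.indicator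
        (fun s => ENNReal.ofReal (w s)) (ω n).1.1 ∂(M.strategicMeasure π)) +
      ∫⁻ ω, ∑' k : ℕ, ENNReal.ofReal (M.β ^ (n₀ + k) * w (ω (n₀ + k)).1.1)
        ∂(M.strategicMeasure π) := by
  have hm := measurable_excess (M := M) hw.measurable l
  have hmn : ∀ n, Measurable fun ω : ℕ → M.K => M.excess w l (ω n) := fun n =>
    hm.comp (measurable_pi_apply n)
  rw [lintegral_occ_law π hm]
  calc ∫⁻ ω, ∑' n, ENNReal.ofReal (M.β ^ n) * M.excess w l (ω n) ∂(M.strategicMeasure π)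
      ≤ ∫⁻ ω, (∑ n ∈ Finset.range n₀, M.excess w l (ω n)) +
          ∑' k : ℕ, ENNReal.ofReal (M.β ^ (n₀ + k) * w (ω (n₀ + k)).1.1)
          ∂(M.strategicMeasure π) := by
        refine lintegral_mono fun ω => ?_
        rw [← ENNReal.summable.sum_add_tsum_nat_add' (k := n₀)]
        refine add_le_add (Finset.sum_le_sum fun n _ => ?_) (ENNReal.tsum_le_tsum fun k => ?_)
        · refine mul_le_of_le_one_left' ?_
          rw [ENNReal.ofReal_le_one]
          exact pow_le_one₀ M.β_pos.le M.β_lt_one.le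
        · rw [add_comm k n₀, ENNReal.ofReal_mul (pow_nonneg M.β_pos.le _)]
          gcongr
          exact Set.indicator_le_self _ _ _
    _ = _ := by
        rw [lintegral_add_left (Finset.measurable_sum _ fun n _ => hmn n),
          lintegral_finsetSum _ fun n _ => hmn n]
        rfl

theorem exists_excess_le {w : S → ℝ} (hw : M.IsUpperBoundFunction w)
    (hw' : M.IsUniformlyIntegrable w) {ε : ℝ≥0∞} (hε : ε ≠ 0) :
    ∃ l : ℕ, ∀ π : M.Policy, ∫⁻ x, M.excess w l x ∂(M.occ π.law) ≤ ε := by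
  have hε2 : (0 : ℝ≥0∞) < ε / 2 := ENNReal.half_pos hε
  obtain ⟨n₀, hn₀⟩ := (hw'.tail.eventually_lt_const hε2).exists
  have h := tendsto_finsetSum (Finset.range n₀) fun n _ => hw'.unifIntegrable n
  rw [Finset.sum_const_zero] at h
  obtain ⟨l, hl⟩ := (h.eventually_lt_const hε2).exists
  refine ⟨l, fun π => (excess_le_occ hw l n₀ π).trans ?_⟩
  rw [← ENNReal.add_halves ε]
  refine add_le_add (le_trans (Finset.sum_le_sum fun n _ => ?_) hl.le) (le_trans ?_ hn₀.le)
  · exact le_iSup (fun π : M.Policy => ∫⁻ ω, {s : S | (l : ℝ) ≤ w s}.indicator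
      (fun s => ENNReal.ofReal (w s)) (ω n).1.1 ∂(M.strategicMeasure π)) π
  · exact le_iSup (fun π : M.Policy => ∫⁻ ω, ∑' k : ℕ,
      ENNReal.ofReal (M.β ^ (n₀ + k) * w (ω (n₀ + k)).1.1) ∂(M.strategicMeasure π)) π

variable (M) in
/-- Uniform integrability of `w` with respect to all the occupation measures. -/
def OccUniformlyIntegrable (w : S → ℝ) : Prop :=
  ∀ ε : ℝ≥0∞, ε ≠ 0 → ∃ l : ℕ, ∀ Q, M.IsOcc Q → ∫⁻ x, M.excess w l x ∂Q ≤ ε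

/-- The bounds hold uniformly over policies, and each solution of the balance equation comes from a
stationary policy. -/
theorem IsUniformlyIntegrable.occ [StandardBorelSpace A] [Nonempty A] (φ₀ : M.StationaryPolicy)
    {w : S → ℝ} (hw : M.IsUpperBoundFunction w) (hw' : M.IsUniformlyIntegrable w) :
    M.OccUniformlyIntegrable w := by
  intro ε hε
  obtain ⟨l, hl⟩ := exists_excess_le hw hw' hε
  refine ⟨l, fun Q hQ => ?_⟩
  obtain ⟨φ, -, hφ⟩ := hQ.exists_stationary φ₀
  rw [← hφ]
  exact hl _

/-- This is `l - r ≤ (l - r)⁺`, rearranged so as to avoid subtraction of infinite quantities. -/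
theorem add_neg_le_shortfall_add (i : Fin (m + 1)) (l : ℕ) (x : M.K) :
    (l : ℝ≥0∞) + (-M.r i x).toENNReal ≤ M.shortfall i l x + (M.r i x).toENNReal := by
  rw [shortfall]
  have htop := M.r_ne_top i x
  generalize M.r i x = r at htop ⊢
  induction r using EReal.rec with
  | bot => simp [-EReal.coe_natCast]
  | top => exact absurd rfl htop
  | coe y =>
    rw [← EReal.coe_neg, ← EReal.coe_sub, EReal.real_coe_toENNReal, EReal.real_coe_toENNReal,
      EReal.real_coe_toENNReal, ← ENNReal.ofReal_natCast]
    rcases le_total y 0 with hy | hy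
    · rw [← ENNReal.ofReal_add (by positivity) (by linarith), ENNReal.ofReal_of_nonpos hy, add_zero]
      exact le_of_eq (by congr 1)
    · rw [ENNReal.ofReal_of_nonpos (p := -y) (by linarith), add_zero]
      refine le_trans (ENNReal.ofReal_le_ofReal (by linarith : (l : ℝ) ≤ ((l : ℝ) - y) + y)) ?_
      exact ENNReal.ofReal_add_le

/-- This is `(l - r)⁺ = (l - r) + (r - l)⁺`, where the last term is nonzero only if `w > l` and is
then at most `w`. -/
theorem shortfall_add_le {w : S → ℝ} (hw : M.IsUpperBoundFunction w) (i : Fin (m + 1)) (l : ℕ)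
    (x : M.K) : M.shortfall i l x + (M.r i x).toENNReal ≤
      (l : ℝ≥0∞) + (-M.r i x).toENNReal + M.excess w l x := by
  have hx := hw.r_le i x
  have hex : ∀ y : ℝ, (l : ℝ) ≤ y → y ≤ w x.1.1 → ENNReal.ofReal y ≤ M.excess w l x := by
    intro y hy1 hy2
    rw [excess, Set.indicator_of_mem (by exact hy1.trans hy2)]
    exact ENNReal.ofReal_le_ofReal hy2
  rw [shortfall]
  generalize M.r i x = r at hx ⊢
  induction r using EReal.rec with
  | bot => simp
  | top => exact absurd hx (by simp)
  | coe y =>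
    rw [EReal.coe_le_coe_iff] at hx
    rw [← EReal.coe_neg, ← EReal.coe_sub, EReal.real_coe_toENNReal, EReal.real_coe_toENNReal,
      EReal.real_coe_toENNReal, ← ENNReal.ofReal_natCast]
    rcases le_total (l : ℝ) y with hy | hy
    · rw [ENNReal.ofReal_of_nonpos (p := (l : ℝ) - y) (by linarith), zero_add]
      exact (hex y hy hx).trans le_add_self
    · refine le_trans ?_ le_self_add
      rcases le_total y 0 with hy0 | hy0
      · rw [ENNReal.ofReal_of_nonpos hy0, add_zero,
          ← ENNReal.ofReal_add (q := -y) (by positivity) (by linarith)]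
        exact le_of_eq (by congr 1)
      · rw [← ENNReal.ofReal_add (by linarith) hy0]
        refine le_trans (ENNReal.ofReal_le_ofReal (by linarith)) le_self_add

theorem pos_r_le {w : S → ℝ} (hw : M.IsUpperBoundFunction w) (i : Fin (m + 1)) (l : ℕ)
    (x : M.K) : (M.r i x).toENNReal ≤ (l : ℝ≥0∞) + M.excess w l x := by
  refine (EReal.toENNReal_le_toENNReal (hw.r_le i x)).trans ?_
  rw [EReal.real_coe_toENNReal]
  rcases le_or_gt (l : ℝ) (w x.1.1) with h | h
  · rw [excess, Set.indicator_of_mem (by exact h)]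
    exact le_add_self
  · refine le_trans ?_ le_self_add
    rw [← ENNReal.ofReal_natCast]
    exact ENNReal.ofReal_le_ofReal h.le

theorem lintegral_pos_r_ne_top {w : S → ℝ} (hw : M.IsUpperBoundFunction w)
    (hui : M.OccUniformlyIntegrable w) (i : Fin (m + 1)) {Q : Measure M.K} (hQ : M.IsOcc Q) :
    ∫⁻ x, (M.r i x).toENNReal ∂Q ≠ ∞ := by
  have := hQ.finite
  obtain ⟨l, hl⟩ := hui 1 one_ne_zero
  have h1 : ∫⁻ x, (M.r i x).toENNReal ∂Q ≤ l * Q Set.univ + 1 := by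
    refine (lintegral_mono fun x => pos_r_le hw i l x).trans ?_
    rw [lintegral_add_left measurable_const, lintegral_const]
    gcongr
    exact hl Q hQ
  refine ne_top_of_le_ne_top ?_ h1
  simp [ENNReal.mul_eq_top]

theorem ereal_le_sub_iff {P N : ℝ≥0∞} (hP : P ≠ ∞) (d : ℝ) :
    (d : EReal) ≤ (P : EReal) - (N : EReal) ↔ N ≠ ∞ ∧ d + N.toReal ≤ P.toReal := by
  lift P to NNReal using hP
  induction N using ENNReal.recTopCoe with
  | top => simp
  | coe N =>
    have h1 : ((N : ℝ≥0∞) : EReal) = ((N : ℝ) : EReal) := rfl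
    have h2 : ((P : ℝ≥0∞) : EReal) = ((P : ℝ) : EReal) := rfl
    rw [h1, h2, ← EReal.coe_sub, EReal.coe_le_coe_iff]
    simp [le_sub_iff_add_le]

/-- The superlevel sets `{d ≤ reward i}` are closed under any convergence of occupation measures
for which the integrals of the shortfalls are lower semicontinuous. -/
theorem le_reward_of_liminf {w : S → ℝ} (hw : M.IsUpperBoundFunction w)
    (hui : M.OccUniformlyIntegrable w) (i : Fin (m + 1)) {d : ℝ} {Q : Measure M.K}
    {Qs : ℕ → Measure M.K} (hQ : M.IsOcc Q) (hQs : ∀ k, M.IsOcc (Qs k))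
    (hlim : ∀ l, ∫⁻ x, M.shortfall i l x ∂Q ≤
      liminf (fun k => ∫⁻ x, M.shortfall i l x ∂(Qs k)) atTop)
    (hd : ∀ k, (d : EReal) ≤ M.reward i (Qs k)) : (d : EReal) ≤ M.reward i Q := by
  have hP := lintegral_pos_r_ne_top hw hui i hQ
  have hc : ∀ R, M.IsOcc R → R Set.univ = ENNReal.ofReal (1 - M.β)⁻¹ := fun R hR =>
    hR.measure_univ
  have hc0 : 0 ≤ (1 - M.β)⁻¹ := inv_nonneg.2 (by linarith [M.β_lt_one])
  set c := (1 - M.β)⁻¹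
  rw [reward, ereal_le_sub_iff hP]
  -- With `c` the common mass, `∫ (l - r)⁺ ∂(Qs k) ≤ l * c - d + ε` for large enough `l`, uniformly
  -- in `k`. The liminf inequality transfers this bound to `Q`, and `r ≥ l - (l - r)⁺` turns it into
  -- `d - ε ≤ ∫ r ∂Q`.
  have key : ∀ ε : ℝ, 0 < ε → ∫⁻ x, (-M.r i x).toENNReal ∂Q ≠ ∞ ∧
      d + (∫⁻ x, (-M.r i x).toENNReal ∂Q).toReal ≤ (∫⁻ x, (M.r i x).toENNReal ∂Q).toReal + ε := by
    intro ε hε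
    obtain ⟨l, hl⟩ := hui (ENNReal.ofReal ε) (by simpa using hε)
    have hbound : ∀ k, 0 ≤ l * c + ε - d ∧
        ∫⁻ x, M.shortfall i l x ∂(Qs k) ≤ ENNReal.ofReal (l * c + ε - d) := by
      intro k
      have hPk := lintegral_pos_r_ne_top hw hui i (hQs k)
      have hdk := hd k
      rw [reward, ereal_le_sub_iff hPk] at hdk
      have h1 : ∫⁻ x, M.shortfall i l x ∂(Qs k) + ∫⁻ x, (M.r i x).toENNReal ∂(Qs k) ≤
          ENNReal.ofReal (l * c) + ∫⁻ x, (-M.r i x).toENNReal ∂(Qs k) + ENNReal.ofReal ε := by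
        rw [← lintegral_add_right _ (measurable_pos_r i)]
        refine (lintegral_mono fun x => shortfall_add_le hw i l x).trans ?_
        rw [lintegral_add_right _ (measurable_excess hw.measurable l),
          lintegral_add_left measurable_const, lintegral_const, hc _ (hQs k),
          ← ENNReal.ofReal_natCast, ← ENNReal.ofReal_mul (by positivity)]
        gcongr
        exact hl _ (hQs k)
      have hfin : ENNReal.ofReal (l * c) + ∫⁻ x, (-M.r i x).toENNReal ∂(Qs k) +
          ENNReal.ofReal ε ≠ ∞ :=
        ENNReal.add_ne_top.2 ⟨ENNReal.add_ne_top.2 ⟨ENNReal.ofReal_ne_top, hdk.1⟩,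
          ENNReal.ofReal_ne_top⟩
      have hG : ∫⁻ x, M.shortfall i l x ∂(Qs k) ≠ ∞ :=
        ne_top_of_le_ne_top hfin (le_self_add.trans h1)
      have h2 := ENNReal.toReal_mono hfin h1
      rw [ENNReal.toReal_add hG hPk, ENNReal.toReal_add
        (ENNReal.add_ne_top.2 ⟨ENNReal.ofReal_ne_top, hdk.1⟩) ENNReal.ofReal_ne_top,
        ENNReal.toReal_add ENNReal.ofReal_ne_top hdk.1, ENNReal.toReal_ofReal (by positivity),
        ENNReal.toReal_ofReal hε.le] at h2
      have h3 : (∫⁻ x, M.shortfall i l x ∂(Qs k)).toReal ≤ l * c + ε - d := by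
        linarith [hdk.2]
      refine ⟨ENNReal.toReal_nonneg.trans h3, ?_⟩
      rw [← ENNReal.ofReal_toReal hG]
      exact ENNReal.ofReal_le_ofReal h3
    have hG : ∫⁻ x, M.shortfall i l x ∂Q ≤ ENNReal.ofReal (l * c + ε - d) := by
      refine (hlim l).trans ?_
      refine liminf_le_of_frequently_le' (Frequently.of_forall fun k => (hbound k).2)
    have h1 : ENNReal.ofReal (l * c) + ∫⁻ x, (-M.r i x).toENNReal ∂Q ≤
        ENNReal.ofReal (l * c + ε - d) + ∫⁻ x, (M.r i x).toENNReal ∂Q := by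
      calc ENNReal.ofReal (l * c) + ∫⁻ x, (-M.r i x).toENNReal ∂Q
          = ∫⁻ x, ((l : ℝ≥0∞) + (-M.r i x).toENNReal) ∂Q := by
            rw [lintegral_add_left measurable_const, lintegral_const, hc _ hQ,
              ← ENNReal.ofReal_natCast, ← ENNReal.ofReal_mul (by positivity)]
        _ ≤ ∫⁻ x, (M.shortfall i l x + (M.r i x).toENNReal) ∂Q :=
            lintegral_mono fun x => add_neg_le_shortfall_add i l x
        _ ≤ _ := by
            rw [lintegral_add_right _ (measurable_pos_r i)]
            gcongr
    have hfin : ENNReal.ofReal (l * c + ε - d) + ∫⁻ x, (M.r i x).toENNReal ∂Q ≠ ∞ := by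
      simp [hP]
    have hN : ∫⁻ x, (-M.r i x).toENNReal ∂Q ≠ ∞ :=
      ne_top_of_le_ne_top hfin (le_add_self.trans h1)
    have h2 := ENNReal.toReal_mono hfin h1
    rw [ENNReal.toReal_add ENNReal.ofReal_ne_top hN, ENNReal.toReal_add ENNReal.ofReal_ne_top hP,
      ENNReal.toReal_ofReal (by positivity), ENNReal.toReal_ofReal (hbound 0).1] at h2
    exact ⟨hN, by linarith⟩
  refine ⟨(key 1 one_pos).1, le_of_forall_pos_le_add fun ε hε => (key ε hε).2⟩

/-! ### Perturbation of occupation measures -/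

theorem lintegral_ne_top_of_le {X : Type*} [MeasurableSpace X] {a b : Measure X} {f : X → ℝ≥0∞}
    (h : a ≤ b) (hb : ∫⁻ x, f x ∂b ≠ ∞) : ∫⁻ x, f x ∂a ≠ ∞ :=
  ne_top_of_le_ne_top hb (lintegral_mono' h le_rfl)

variable (M) in
/-- `reward i`, as a real number. -/
noncomputable def rewardReal (i : Fin (m + 1)) (Q : Measure M.K) : ℝ :=
  (∫⁻ x, (M.r i x).toENNReal ∂Q).toReal - (∫⁻ x, (-M.r i x).toENNReal ∂Q).toReal

variable (M) in
/-- `r i` is integrable with respect to `Q`. -/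
def RewardFinite (i : Fin (m + 1)) (Q : Measure M.K) : Prop :=
  ∫⁻ x, (M.r i x).toENNReal ∂Q ≠ ∞ ∧ ∫⁻ x, (-M.r i x).toENNReal ∂Q ≠ ∞

theorem RewardFinite.reward_eq {i : Fin (m + 1)} {Q : Measure M.K} (h : M.RewardFinite i Q) :
    M.reward i Q = (M.rewardReal i Q : EReal) := by
  rw [reward, rewardReal, EReal.coe_sub, EReal.coe_ennreal_toReal h.1,
    EReal.coe_ennreal_toReal h.2]

theorem RewardFinite.mono {i : Fin (m + 1)} {Q R : Measure M.K} (h : M.RewardFinite i Q)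
    (hR : R ≤ Q) : M.RewardFinite i R :=
  ⟨lintegral_ne_top_of_le hR h.1, lintegral_ne_top_of_le hR h.2⟩

theorem RewardFinite.add_sum {i : Fin (m + 1)} {Q : Measure M.K} {ι : Type*} [Fintype ι]
    {τ : ι → Measure M.K} (hQ : M.RewardFinite i Q) (hτ : ∀ j, M.RewardFinite i (τ j))
    {t : ι → ℝ} (ht : ∀ j, 0 ≤ t j) :
    M.RewardFinite i (Q + ∑ j, ENNReal.ofReal (t j) • τ j) ∧
    M.rewardReal i (Q + ∑ j, ENNReal.ofReal (t j) • τ j) =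
      M.rewardReal i Q + ∑ j, t j * M.rewardReal i (τ j) := by
  have e : ∀ f : M.K → ℝ≥0∞, ∫⁻ x, f x ∂(Q + ∑ j, ENNReal.ofReal (t j) • τ j) =
      ∫⁻ x, f x ∂Q + ∑ j, ENNReal.ofReal (t j) * ∫⁻ x, f x ∂(τ j) := by
    intro f
    rw [lintegral_add_measure, lintegral_finsetSum_measure]
    simp
  have f : ∀ f : M.K → ℝ≥0∞, ∫⁻ x, f x ∂Q ≠ ∞ → (∀ j, ∫⁻ x, f x ∂(τ j) ≠ ∞) →
      ∫⁻ x, f x ∂(Q + ∑ j, ENNReal.ofReal (t j) • τ j) ≠ ∞ ∧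
      (∫⁻ x, f x ∂(Q + ∑ j, ENNReal.ofReal (t j) • τ j)).toReal =
        (∫⁻ x, f x ∂Q).toReal + ∑ j, t j * (∫⁻ x, f x ∂(τ j)).toReal := by
    intro f h1 h2
    have h3 : ∀ j, ENNReal.ofReal (t j) * ∫⁻ x, f x ∂(τ j) ≠ ∞ := fun j =>
      ENNReal.mul_ne_top ENNReal.ofReal_ne_top (h2 j)
    have h4 : ∑ j, ENNReal.ofReal (t j) * ∫⁻ x, f x ∂(τ j) ≠ ∞ :=
      ENNReal.sum_ne_top.2 fun j _ => h3 j
    rw [e]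
    refine ⟨ENNReal.add_ne_top.2 ⟨h1, h4⟩, ?_⟩
    rw [ENNReal.toReal_add h1 h4, ENNReal.toReal_sum fun j _ => h3 j]
    simp [ENNReal.toReal_mul, ENNReal.toReal_ofReal (ht _)]
  obtain ⟨a1, a2⟩ := f _ hQ.1 fun j => (hτ j).1
  obtain ⟨b1, b2⟩ := f _ hQ.2 fun j => (hτ j).2
  refine ⟨⟨a1, b1⟩, ?_⟩
  rw [rewardReal, a2, b2, rewardReal]
  simp only [rewardReal, mul_sub, Finset.sum_sub_distrib]
  ring

theorem measure_add_right_cancel {X : Type*} [MeasurableSpace X] {a b c : Measure X}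
    [IsFiniteMeasure c] (h : a + c = b + c) : a = b := by
  ext s _
  have := congrArg (fun ν : Measure X => ν s) h
  simpa [ENNReal.add_left_inj (measure_ne_top c s)] using this

theorem comp_finset_sum {X Y ι : Type*} [MeasurableSpace X] [MeasurableSpace Y] (κ : Kernel X Y)
    (s : Finset ι) (g : ι → Measure X) : κ ∘ₘ ∑ n ∈ s, g n = ∑ n ∈ s, κ ∘ₘ g n := by
  classical
  induction s using Finset.induction_on with
  | empty => simp
  | insert i s hi ih => rw [Finset.sum_insert hi, Finset.sum_insert hi, Measure.comp_add, ih]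

theorem stateLaw_finset_sum {ι : Type*} (s : Finset ι) (g : ι → Measure M.K) :
    M.stateLaw (∑ n ∈ s, g n) = ∑ n ∈ s, M.stateLaw (g n) := by
  classical
  induction s using Finset.induction_on with
  | empty => simp [stateLaw]
  | insert i s hi ih => rw [Finset.sum_insert hi, Finset.sum_insert hi, stateLaw_add, ih]

/-- Reweighting parts of an occupation measure with the same sources keeps the balance. -/
theorem IsOcc.reweight {Q Q₀ : Measure M.K} (hQ : M.IsOcc Q) {ι : Type*} [Fintype ι]
    {τ : ι → Measure M.K} (hQ₀ : Q₀ + ∑ j, τ j = Q) {σ : Measure S} [IsFiniteMeasure σ]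
    (hτ : ∀ j, M.stateLaw (τ j) = σ + M.disc • (M.p ∘ₘ τ j)) {t : ι → ℝ} (ht : ∀ j, 0 ≤ t j)
    (hsum : ∑ j, t j = Fintype.card ι) : M.IsOcc (Q₀ + ∑ j, ENNReal.ofReal (t j) • τ j) := by
  have := hQ.finite
  have hQ₀le : Q₀ ≤ Q := by rw [← hQ₀]; exact Measure.le_add_right le_rfl
  have hsumle : ∑ j, τ j ≤ Q := by rw [← hQ₀]; exact Measure.le_add_left le_rfl
  have hfin0 : IsFiniteMeasure Q₀ := isFiniteMeasure_of_le Q hQ₀le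
  have hfinsum : IsFiniteMeasure (∑ j, τ j) := isFiniteMeasure_of_le Q hsumle
  have hfin : ∀ j, IsFiniteMeasure (τ j) := fun j => by
    refine isFiniteMeasure_of_le (∑ j, τ j) (Measure.le_iff.2 fun s _ => ?_)
    rw [Measure.finsetSum_apply]
    exact Finset.single_le_sum (f := fun j => τ j s) (fun _ _ => zero_le) (Finset.mem_univ j)
  have hfin' : ∀ j, IsFiniteMeasure (ENNReal.ofReal (t j) • τ j) := fun j =>
    Measure.smul_finite _ ENNReal.ofReal_ne_top
  -- Removing the parts leaves a balance equation with source `μ - card ι • σ`, written without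
  -- subtraction. The reweighted parts have total source `(∑ j, t j) • σ`, which is the same amount.
  have hbal : M.stateLaw Q₀ + (Fintype.card ι : ℝ≥0∞) • σ = M.μ + M.disc • (M.p ∘ₘ Q₀) := by
    have h := hQ.balance
    rw [← hQ₀, stateLaw_add, stateLaw_finset_sum, Measure.comp_add, comp_finset_sum] at h
    simp_rw [hτ] at h
    rw [Finset.sum_add_distrib, Finset.sum_const, Finset.card_univ, ← Finset.smul_sum, smul_add,
      ← add_assoc, ← add_assoc, ← comp_finset_sum] at h
    have hf : IsFiniteMeasure (M.disc • (M.p ∘ₘ ∑ j, τ j)) :=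
      Measure.smul_finite _ M.disc_ne_top
    have h' := measure_add_right_cancel h
    rwa [← Nat.cast_smul_eq_nsmul ℝ≥0∞] at h'
  refine ⟨inferInstance, ?_⟩
  rw [stateLaw_add, stateLaw_finset_sum, Measure.comp_add, comp_finset_sum]
  simp_rw [stateLaw_smul, hτ, Measure.comp_smul, smul_add]
  rw [Finset.sum_add_distrib, ← Finset.sum_smul, ← ENNReal.ofReal_sum_of_nonneg fun j _ => ht j,
    hsum, ENNReal.ofReal_natCast, ← add_assoc, hbal, add_assoc, Finset.smul_sum]
  simp_rw [smul_comm M.disc]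

end CMDP

/-! ### Splitting and perturbing an occupation measure -/

namespace CMDP

variable {S : Type u} {A : Type v} [MeasurableSpace S] [MeasurableSpace A] {m : ℕ}
variable {M : CMDP S A m}

theorem StationaryPolicy.lintegral_lift (φ : M.StationaryPolicy) (s : S) {f : S × A → ℝ≥0∞}
    (hf : Measurable f) : ∫⁻ x, f x.1 ∂(φ.lift s) = ∫⁻ a, f (s, a) ∂(φ.kernel s) := by
  have h : (φ.lift s).map Subtype.val = (φ.kernel s).map (Prod.mk s) := by
    ext B hB
    rw [Measure.map_apply measurable_subtype_coe hB, Measure.map_apply measurable_prodMk_left hB,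
      φ.lift_apply' s hB]
  rw [← lintegral_map hf measurable_subtype_coe, h, lintegral_map hf measurable_prodMk_left]

/-- The density which concentrates the actions on one of the sets `B j`, and which makes the law of
the states independent of `j`. -/
noncomputable def cellDensity (φ : M.StationaryPolicy) {ι : Type*} (B : ι → Set A) (j : ι)
    (x : S × A) : ℝ≥0∞ :=
  (⨅ k, φ.kernel x.1 (B k)) * (φ.kernel x.1 (B j))⁻¹ * (B j).indicator 1 x.2

theorem measurable_cellDensity (φ : M.StationaryPolicy) {ι : Type*} [Countable ι] {B : ι → Set A}
    (hB : ∀ j, MeasurableSet (B j)) (j : ι) : Measurable (cellDensity φ B j) := by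
  have h : ∀ j, Measurable fun x : S × A => φ.kernel x.1 (B j) := fun j =>
    (Kernel.measurable_coe φ.kernel (hB j)).comp measurable_fst
  exact ((Measurable.iInf h).mul (h j).inv).mul ((measurable_one.indicator (hB j)).comp
    measurable_snd)

theorem cellDensity_le (φ : M.StationaryPolicy) {ι : Type*} (B : ι → Set A) (j : ι) (x : S × A) :
    cellDensity φ B j x ≤ (B j).indicator 1 x.2 := by
  refine mul_le_of_le_one_left' ?_
  rw [← div_eq_mul_inv]
  exact ENNReal.div_le_of_le_mul (by rw [one_mul]; exact iInf_le _ j)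

theorem sum_cellDensity_le (φ : M.StationaryPolicy) {ι : Type*} [Fintype ι] {B : ι → Set A}
    (hd : Pairwise fun j k => Disjoint (B j) (B k)) (x : S × A) :
    ∑ j, cellDensity φ B j x ≤ 1 := by
  refine (Finset.sum_le_sum fun j _ => cellDensity_le φ B j x).trans ?_
  by_cases h : ∃ j, x.2 ∈ B j
  · obtain ⟨j, hj⟩ := h
    rw [Finset.sum_eq_single j]
    · simp [hj]
    · intro k _ hk
      exact Set.indicator_of_notMem (fun hk' => Set.disjoint_left.1 (hd hk) hk' hj) _
    · simp
  · push Not at h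
    simp [h]

/-- The inverse factor cancels the mass of `B j`, so that the smallest of the masses remains,
whatever `j` is. This is what gives all the parts the same source. -/
theorem lintegral_cellDensity (φ : M.StationaryPolicy) {ι : Type*} [Countable ι] {B : ι → Set A}
    (hB : ∀ j, MeasurableSet (B j)) (j : ι) (s : S) :
    ∫⁻ x, cellDensity φ B j x.1 ∂(φ.lift s) = ⨅ k, φ.kernel s (B k) := by
  rw [φ.lintegral_lift s (measurable_cellDensity φ hB j)]
  simp only [cellDensity]
  rw [lintegral_const_mul _ (measurable_one.indicator (hB j)), lintegral_indicator_one (hB j),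
    mul_assoc]
  -- If the cell is null, so is the smallest mass, and the convention `∞ * 0 = 0` gives the right
  -- value.
  by_cases h : φ.kernel s (B j) = 0
  · rw [h, mul_zero, mul_zero]
    exact (le_antisymm ((iInf_le _ j).trans_eq h) zero_le).symm
  · rw [ENNReal.inv_mul_cancel h (measure_ne_top _ _), mul_one]

/-- The law of the states under `φ.lift ∘ₘ ν` weighted by a density. -/
theorem stateLaw_withDensity (φ : M.StationaryPolicy) (ν : Measure S) {h' : M.K → ℝ≥0∞}
    (hh : Measurable h') :
    M.stateLaw ((φ.lift ∘ₘ ν).withDensity h') = ν.withDensity fun s => ∫⁻ x, h' x ∂(φ.lift s) := by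
  ext E hE
  have hE' : MeasurableSet ((fun x : M.K => x.1.1) ⁻¹' E) := M.measurable_state hE
  rw [M.stateLaw_apply _ hE, withDensity_apply _ hE', withDensity_apply _ hE,
    ← lintegral_indicator hE', Measure.lintegral_bind φ.lift.aemeasurable
      (hh.indicator hE').aemeasurable, ← lintegral_indicator hE]
  refine lintegral_congr fun s => ?_
  -- `φ.lift s` does not move the state, so the indicator of `E` is almost surely constant under it.
  have hs : ∀ᵐ x ∂(φ.lift s), (x.1.1 ∈ E ↔ s ∈ E) := by
    by_cases h : s ∈ E
    · have := φ.lift_state s hE.compl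
      rw [Set.indicator_of_notMem (by simpa using h)] at this
      filter_upwards [measure_eq_zero_iff_ae_notMem.1 this] with x hx
      simp only [Set.mem_preimage, Set.mem_compl_iff, not_not] at hx
      simp [h, hx]
    · have := φ.lift_state s hE
      rw [Set.indicator_of_notMem h] at this
      filter_upwards [measure_eq_zero_iff_ae_notMem.1 this] with x hx
      simp only [Set.mem_preimage] at hx
      simp [h, hx]
  by_cases h : s ∈ E
  · rw [Set.indicator_of_mem h]
    refine lintegral_congr_ae ?_
    filter_upwards [hs] with x hx
    exact Set.indicator_of_mem (show x ∈ (fun x : M.K => x.1.1) ⁻¹' E from hx.2 h) h'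
  · rw [Set.indicator_of_notMem h, ← lintegral_zero (μ := φ.lift s)]
    refine lintegral_congr_ae ?_
    filter_upwards [hs] with x hx
    exact Set.indicator_of_notMem
      (show x ∉ (fun x : M.K => x.1.1) ⁻¹' E from fun hE => h (hx.1 hE)) h'

/-- Disjoint action sets, which all have positive probability in a set of states with positive
measure, split off parts of the occupation measure that have a common source. -/
theorem IsOcc.exists_parts {Q : Measure M.K} (hQ : M.IsOcc Q) {φ : M.StationaryPolicy}
    (hφ : φ.lift ∘ₘ M.stateLaw Q = Q) {ι : Type*} [Fintype ι] [Nonempty ι] {B : ι → Set A}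
    (hB : ∀ j, MeasurableSet (B j)) (hd : Pairwise fun j k => Disjoint (B j) (B k))
    (hpos : M.stateLaw Q {s | ∀ j, φ.kernel s (B j) ≠ 0} ≠ 0) :
    ∃ (ρ τ : ι → Measure M.K) (σ : Measure S), IsFiniteMeasure σ ∧ σ ≠ 0 ∧
      (∀ j, M.stateLaw (ρ j) = σ) ∧ (∀ j, ρ j ((fun x => x.1.2) ⁻¹' (B j))ᶜ = 0) ∧
      (∀ j, τ j = ρ j + M.disc • (φ.step ∘ₘ τ j)) ∧ ∑ j, τ j ≤ Q := by
  have hQfin := hQ.finite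
  have hQpot := hQ.eq_potential hφ
  set D : Set S := {s | ∀ j, φ.kernel s (B j) ≠ 0} with hDdef
  have hD : MeasurableSet D := by
    rw [hDdef, Set.ofPred_forall]
    exact .iInter fun j => ((Kernel.measurable_coe φ.kernel (hB j))
      (measurableSet_singleton 0)).compl
  -- The splitting is done at one time `k` that charges `D`, not on `Q` as a whole: the potential of
  -- the law at time `k` is a tail of the series for `Q` and hence at most `Q`, whereas the
  -- potential of `Q` would exceed `Q` in general.
  obtain ⟨k, hk⟩ : ∃ k : ℕ, M.stateLaw (M.disc ^ k • φ.toPolicy.law k) D ≠ 0 := by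
    by_contra! hcon
    refine hpos ?_
    rw [hQpot, ← φ.occ_law, occ, M.stateLaw_apply _ hD, Measure.sum_apply _ (M.measurable_state hD)]
    simp only [ENNReal.tsum_eq_zero]
    intro k
    rw [← M.stateLaw_apply _ hD]
    exact hcon k
  set lam : Measure M.K := M.disc ^ k • φ.toPolicy.law k with hlam
  set ν : Measure S := M.stateLaw lam with hν
  have hlift : φ.lift ∘ₘ ν = lam := by
    rw [hν, hlam, stateLaw_smul, Measure.comp_smul]
    congr 1
    cases k with
    | zero => rw [φ.law_zero, φ.stateLaw_lift]
    | succ k => rw [φ.law_succ, φ.stateLaw_step, φ.step_comp]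
  have hpotle : potential φ.step M.disc lam ≤ Q := by
    rw [hlam, hQpot, φ.law_eq_iterate]
    exact potential_iterate_le _ _ _ _
  have hlamle : lam ≤ Q := by
    refine le_trans ?_ hpotle
    rw [potential_eq]
    exact Measure.le_add_right le_rfl
  have hlamfin : IsFiniteMeasure lam := isFiniteMeasure_of_le Q hlamle
  have hνfin : IsFiniteMeasure ν := by
    rw [hν, stateLaw]
    infer_instance
  have hm : ∀ j, Measurable fun x : M.K => cellDensity φ B j x.1 := fun j =>
    (measurable_cellDensity φ hB j).comp measurable_subtype_coe
  have hmc : Measurable fun s => ⨅ k, φ.kernel s (B k) :=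
    Measurable.iInf fun j => Kernel.measurable_coe φ.kernel (hB j)
  -- `ρ j` is the portion of the time-`k` law with actions in `B j`, thinned so as to have the
  -- common state law `σ`; `τ j` adds its whole discounted future under `φ`.
  refine ⟨fun j => lam.withDensity fun x => cellDensity φ B j x.1,
    fun j => potential φ.step M.disc (lam.withDensity fun x => cellDensity φ B j x.1),
    ν.withDensity fun s => ⨅ k, φ.kernel s (B k), ?_, ?_, ?_, ?_, ?_, ?_⟩
  · refine isFiniteMeasure_withDensity (ne_top_of_le_ne_top (measure_ne_top ν Set.univ) ?_)
    rw [← lintegral_one]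
    refine lintegral_mono fun s => ?_
    exact (iInf_le _ (Classical.arbitrary ι)).trans prob_le_one
  · intro h0
    refine hk (measure_mono_null ?_ (withDensity_eq_zero hmc.aemeasurable h0 : _))
    intro s hs
    simp only [Set.mem_compl_iff, Set.mem_ofPred_eq]
    change ¬ ((⨅ k, φ.kernel s (B k)) = 0)
    obtain ⟨j, hj⟩ := exists_eq_ciInf_of_finite (f := fun k => φ.kernel s (B k))
    rw [← hj]
    exact hs j
  · intro j
    rw [← hlift, stateLaw_withDensity φ ν (hm j)]
    simp_rw [lintegral_cellDensity φ hB j]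
  · intro j
    have hBj : MeasurableSet ((fun x : M.K => x.1.2) ⁻¹' (B j))ᶜ :=
      ((measurable_snd.comp measurable_subtype_coe) (hB j)).compl
    rw [withDensity_apply _ hBj]
    rw [← lintegral_indicator hBj, ← lintegral_zero (μ := lam)]
    refine lintegral_congr fun x => ?_
    by_cases hx : x.1.2 ∈ B j
    · exact Set.indicator_of_notMem (by simpa using hx) _
    · rw [Set.indicator_of_mem (by simpa using hx)]
      refine le_antisymm ((cellDensity_le φ B j x.1).trans ?_) zero_le
      rw [Set.indicator_of_notMem hx]
  · intro j
    exact potential_eq _ _ _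
  · rw [← potential_finset_sum]
    refine (potential_mono _ _ ?_).trans hpotle
    refine Measure.le_iff.2 fun s hs => ?_
    rw [Measure.finsetSum_apply]
    simp_rw [withDensity_apply _ hs]
    rw [← lintegral_finsetSum _ fun j _ => hm j]
    calc ∫⁻ x in s, ∑ j, cellDensity φ B j x.1 ∂lam ≤ ∫⁻ _ in s, 1 ∂lam :=
          lintegral_mono fun x => sum_cellDensity_le φ hd x.1
      _ = lam s := by simp

/-- If the decision rule charges `m + 2` disjoint sets of actions in a set of states with positive
measure, then the occupation measure is the midpoint of two other ones, with the same rewards of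
the constraints. -/
theorem IsOcc.exists_midpoint {Q : Measure M.K} (hQ : M.IsOcc Q) {φ : M.StationaryPolicy}
    (hφ : φ.lift ∘ₘ M.stateLaw Q = Q) (hrew : ∀ i, M.RewardFinite i Q) {B : Fin (m + 2) → Set A}
    (hB : ∀ j, MeasurableSet (B j)) (hd : Pairwise fun j k => Disjoint (B j) (B k))
    (hpos : M.stateLaw Q {s | ∀ j, φ.kernel s (B j) ≠ 0} ≠ 0) :
    ∃ (Q₁ Q₂ : Measure M.K) (δ : ℝ), M.IsOcc Q₁ ∧ M.IsOcc Q₂ ∧ Q₁ ≠ Q ∧ Q₁ + Q₂ = Q + Q ∧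
      (∀ i : Fin m, M.reward i.succ Q₁ = M.reward i.succ Q ∧
        M.reward i.succ Q₂ = M.reward i.succ Q) ∧
      M.reward 0 Q₁ = ((M.rewardReal 0 Q + δ : ℝ) : EReal) ∧
      M.reward 0 Q₂ = ((M.rewardReal 0 Q - δ : ℝ) : EReal) := by
  have hQfin := hQ.finite
  obtain ⟨ρ, τ, σ, hσfin, hσ, hρσ, hρB, hτ, hle⟩ := hQ.exists_parts hφ hB hd hpos
  have hsumfin : IsFiniteMeasure (∑ j, τ j) := isFiniteMeasure_of_le Q hle
  have hτle : ∀ j, τ j ≤ ∑ j, τ j := fun j => Measure.le_iff.2 fun s _ => by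
    rw [Measure.finsetSum_apply]
    exact Finset.single_le_sum (f := fun j => τ j s) (fun _ _ => zero_le) (Finset.mem_univ j)
  have hτfin : ∀ j, IsFiniteMeasure (τ j) := fun j => isFiniteMeasure_of_le _ (hτle j)
  set Q₀ : Measure M.K := Q - ∑ j, τ j
  have hQ₀ : Q₀ + ∑ j, τ j = Q := Measure.sub_add_cancel_of_le hle
  have hQ₀le : Q₀ ≤ Q := Measure.sub_le
  have hQ₀fin : IsFiniteMeasure Q₀ := isFiniteMeasure_of_le Q hQ₀le
  have hτstate : ∀ j, M.stateLaw (τ j) = σ + M.disc • (M.p ∘ₘ τ j) := fun j => by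
    conv_lhs => rw [hτ j]
    rw [stateLaw_add, stateLaw_smul, φ.stateLaw_step, hρσ]
  -- Coordinate `0` preserves the total weight of the sources, the others preserve the `m`
  -- constraint values. The objective is not included: optimality will control it.
  let L : (Fin (m + 2) → ℝ) →ₗ[ℝ] (Fin (m + 1) → ℝ) := LinearMap.pi (Fin.cons
    (∑ j, LinearMap.proj j)
    (fun i : Fin m => ∑ j, M.rewardReal i.succ (τ j) • LinearMap.proj j))
  have hker : LinearMap.ker L ≠ ⊥ := LinearMap.ker_ne_bot_of_finrank_lt (by simp)
  obtain ⟨x, hx, hx0⟩ := (Submodule.ne_bot_iff _).1 hker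
  rw [LinearMap.mem_ker] at hx
  -- The normalization `|y j| ≤ 1` makes both weights `1 + y j` and `1 - y j` nonnegative.
  obtain ⟨y, hy0, hy1, hysum, hyr⟩ : ∃ y : Fin (m + 2) → ℝ, y ≠ 0 ∧ (∀ j, |y j| ≤ 1) ∧
      ∑ j, y j = 0 ∧ ∀ i : Fin m, ∑ j, y j * M.rewardReal i.succ (τ j) = 0 := by
    have hn : ‖x‖ ≠ 0 := norm_ne_zero_iff.2 hx0
    have h0 : ∑ j, x j = 0 := by simpa [L] using congrFun hx 0
    have h1 : ∀ i : Fin m, ∑ j, M.rewardReal i.succ (τ j) * x j = 0 := fun i => by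
      simpa [L] using congrFun hx i.succ
    refine ⟨‖x‖⁻¹ • x, smul_ne_zero (inv_ne_zero hn) hx0, fun j => ?_, ?_, fun i => ?_⟩
    · have : |x j| ≤ ‖x‖ := norm_le_pi_norm x j
      rw [Pi.smul_apply, smul_eq_mul, abs_mul, abs_of_nonneg (inv_nonneg.2 (norm_nonneg x))]
      rw [inv_mul_le_iff₀ (by positivity), mul_one]
      exact this
    · simp only [Pi.smul_apply, smul_eq_mul, ← Finset.mul_sum, h0, mul_zero]
    · simp only [Pi.smul_apply, smul_eq_mul, mul_assoc, ← Finset.mul_sum]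
      rw [Finset.sum_congr rfl fun j _ => mul_comm (x j) _, h1, mul_zero]
  have hadd : ∀ j, 0 ≤ 1 + y j := fun j => by linarith [(abs_le.1 (hy1 j)).1]
  have hsub : ∀ j, 0 ≤ 1 - y j := fun j => by linarith [(abs_le.1 (hy1 j)).2]
  have hrτ : ∀ i j, M.RewardFinite i (τ j) := fun i j => (hrew i).mono ((hτle j).trans hle)
  have hr₀ : ∀ i, M.RewardFinite i Q₀ := fun i => (hrew i).mono hQ₀le
  have hone : Q₀ + ∑ j, ENNReal.ofReal ((fun _ => 1 : Fin (m + 2) → ℝ) j) • τ j = Q := by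
    simpa using hQ₀
  have hQr : ∀ i, M.rewardReal i Q = M.rewardReal i Q₀ + ∑ j, M.rewardReal i (τ j) := fun i => by
    have := ((hr₀ i).add_sum (hrτ i) (t := fun _ => 1) fun _ => zero_le_one).2
    rw [hone] at this
    simpa using this
  have hQ1r : ∀ i, M.rewardReal i (Q₀ + ∑ j, ENNReal.ofReal (1 + y j) • τ j) =
      M.rewardReal i Q + ∑ j, y j * M.rewardReal i (τ j) := fun i => by
    rw [((hr₀ i).add_sum (hrτ i) hadd).2, hQr i]
    simp only [add_mul, one_mul, Finset.sum_add_distrib]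
    ring
  have hQ2r : ∀ i, M.rewardReal i (Q₀ + ∑ j, ENNReal.ofReal (1 - y j) • τ j) =
      M.rewardReal i Q - ∑ j, y j * M.rewardReal i (τ j) := fun i => by
    rw [((hr₀ i).add_sum (hrτ i) hsub).2, hQr i]
    simp only [sub_mul, one_mul, Finset.sum_sub_distrib]
    ring
  refine ⟨Q₀ + ∑ j, ENNReal.ofReal (1 + y j) • τ j, Q₀ + ∑ j, ENNReal.ofReal (1 - y j) • τ j,
    ∑ j, y j * M.rewardReal 0 (τ j), ?_, ?_, ?_, ?_, ?_, ?_, ?_⟩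
  · exact hQ.reweight hQ₀ hτstate hadd (by simp [Finset.sum_add_distrib, hysum])
  · exact hQ.reweight hQ₀ hτstate hsub (by simp [Finset.sum_sub_distrib, hysum])
  -- Equality of the sums of the `τ j` passes, through the potential equation, to the sums of the `ρ
  -- j`. These live on disjoint action sets and have the same nonzero mass, so evaluation on `B j`
  -- forces `y j = 0`.
  · intro heq
    have h1 : ∑ j, ENNReal.ofReal (1 + y j) • τ j = ∑ j, τ j := by
      rw [← hQ₀, add_comm Q₀, add_comm Q₀] at heq
      exact measure_add_right_cancel heq
    have h2 : ∑ j, ENNReal.ofReal (1 + y j) • ρ j = ∑ j, ρ j := by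
      have e1 : ∑ j, ENNReal.ofReal (1 + y j) • τ j =
          ∑ j, ENNReal.ofReal (1 + y j) • ρ j + M.disc • (φ.step ∘ₘ ∑ j, τ j) := by
        rw [← h1, comp_finset_sum, Finset.smul_sum, ← Finset.sum_add_distrib]
        refine Finset.sum_congr rfl fun j _ => ?_
        conv_lhs => rw [hτ j]
        rw [smul_add, Measure.comp_smul, smul_comm]
      have e2 : ∑ j, τ j = ∑ j, ρ j + M.disc • (φ.step ∘ₘ ∑ j, τ j) := by
        conv_lhs => rw [Finset.sum_congr rfl fun j _ => hτ j]
        rw [Finset.sum_add_distrib, comp_finset_sum, Finset.smul_sum]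
      have hf : IsFiniteMeasure (M.disc • (φ.step ∘ₘ ∑ j, τ j)) :=
        Measure.smul_finite _ M.disc_ne_top
      refine measure_add_right_cancel (c := M.disc • (φ.step ∘ₘ ∑ j, τ j)) ?_
      rw [← e1, ← e2, h1]
    refine hy0 (funext fun j => ?_)
    have hBm : ∀ j, MeasurableSet ((fun x : M.K => x.1.2) ⁻¹' (B j)) := fun j =>
      (measurable_snd.comp measurable_subtype_coe) (hB j)
    have hoff : ∀ k, k ≠ j → ρ k ((fun x => x.1.2) ⁻¹' (B j)) = 0 := fun k hk => by
      refine measure_mono_null (fun x hx => ?_) (hρB k)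
      exact fun hx' => Set.disjoint_left.1 (hd hk) hx' hx
    have hon : ρ j ((fun x => x.1.2) ⁻¹' (B j)) = σ Set.univ := by
      rw [← hρσ j, stateLaw_univ, ← measure_add_measure_compl (hBm j), hρB j, add_zero]
    have h3 := congrArg (fun η : Measure M.K => η ((fun x => x.1.2) ⁻¹' (B j))) h2
    simp only [Measure.finsetSum_apply, Measure.smul_apply, smul_eq_mul] at h3
    rw [Finset.sum_eq_single j (fun k _ hk => by rw [hoff k hk, mul_zero]) (by simp),
      Finset.sum_eq_single j (fun k _ hk => hoff k hk) (by simp), hon] at h3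
    have h4 : ENNReal.ofReal (1 + y j) = 1 := by
      have hne : σ Set.univ ≠ 0 := fun h => hσ (Measure.measure_univ_eq_zero.1 h)
      exact (ENNReal.mul_left_inj hne (measure_ne_top σ _)).1 (by rw [h3, one_mul])
    rw [ENNReal.ofReal_eq_one] at h4
    rw [Pi.zero_apply]
    linarith
  · have : ∀ j, ENNReal.ofReal (1 + y j) • τ j + ENNReal.ofReal (1 - y j) • τ j = τ j + τ j := by
      intro j
      rw [← add_smul, ← ENNReal.ofReal_add (hadd j) (hsub j)]
      norm_num
      rw [two_smul]
    rw [add_add_add_comm, ← Finset.sum_add_distrib]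
    simp_rw [this]
    rw [Finset.sum_add_distrib, add_add_add_comm, hQ₀]
  · intro i
    rw [((hr₀ i.succ).add_sum (hrτ i.succ) hadd).1.reward_eq,
      ((hr₀ i.succ).add_sum (hrτ i.succ) hsub).1.reward_eq, (hrew i.succ).reward_eq,
      hQ1r, hQ2r, hyr, add_zero, sub_zero]
    exact ⟨rfl, rfl⟩
  · rw [((hr₀ 0).add_sum (hrτ 0) hadd).1.reward_eq, hQ1r]
  · rw [((hr₀ 0).add_sum (hrτ 0) hsub).1.reward_eq, hQ2r]

end CMDP

/-! ### Borel spaces -/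

namespace IsBorelSpace

variable {Y : Type u} [TopologicalSpace Y]

theorem secondCountableTopology (h : IsBorelSpace Y) : SecondCountableTopology Y := by
  obtain ⟨X, _, _, e, he, -⟩ := h.exists_embedding
  exact he.secondCountableTopology

theorem metrizableSpace (h : IsBorelSpace Y) : TopologicalSpace.MetrizableSpace Y := by
  obtain ⟨X, _, _, e, he, -⟩ := h.exists_embedding
  exact he.metrizableSpace

/-- The given topology need not be Polish. A Borel subset of a Polish space carries some Polish
topology with the same Borel sets, and this one is pulled back to `Y`. -/
theorem standardBorelSpace [MeasurableSpace Y] [BorelSpace Y] (h : IsBorelSpace Y) :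
    StandardBorelSpace Y := by
  obtain ⟨X, _, _, e, he, hr⟩ := h.exists_embedding
  borelize X
  have hm : MeasurableEmbedding e := he.measurableEmbedding hr
  obtain ⟨τ, hτ, hpol⟩ := (hr.standardBorel : StandardBorelSpace (Set.range e)).polish
  let f : Y ≃ᵐ Set.range e := hm.equivRange
  refine @StandardBorelSpace.mk Y _ ⟨τ.induced f, ?_, f.toEquiv.polishSpace_induced⟩
  refine @BorelSpace.mk Y (τ.induced f) _ ?_
  exact f.measurableEmbedding.comap_eq.symm.trans
    ((congrArg (MeasurableSpace.comap f) hτ.measurable_eq).trans borel_comap.symm)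

theorem exists_isEmbedding_cube (h : IsBorelSpace Y) :
    ∃ e : Y → ℕ → unitInterval, IsEmbedding e := by
  have := h.metrizableSpace
  have := h.secondCountableTopology
  let := TopologicalSpace.metrizableSpaceMetric Y
  exact Metric.PiNatEmbed.exists_embedding_to_hilbert_cube

end IsBorelSpace

/-! ### Convergence of measures on a class of sets -/

/-- The measures `νs` converge to `ν` from below on the sets of a class. -/
def ConvergesBelow {X : Type*} [MeasurableSpace X] (𝒪 : Set (Set X)) (ν : Measure X)
    (νs : ℕ → Measure X) : Prop := ∀ G ∈ 𝒪, ν G ≤ liminf (fun k => νs k G) atTop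

/-- Weak convergence together with setwise convergence of the first marginals imply the liminf
inequality for the measurable sets with open sections. -/
theorem le_liminf_of_isOpen_sections {S C : Type*} [TopologicalSpace S]
    [TopologicalSpace.PseudoMetrizableSpace S] [MeasurableSpace S] [BorelSpace S]
    [TopologicalSpace C] [SecondCountableTopology C] [MeasurableSpace C] [BorelSpace C]
    [StandardBorelSpace C] [Nonempty C] {ν : Measure (S × C)} [IsProbabilityMeasure ν]
    {νs : ℕ → Measure (S × C)} [∀ k, IsProbabilityMeasure (νs k)]
    (hopen : ∀ U, IsOpen U → ν U ≤ liminf (fun k => νs k U) atTop)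
    (hfst : ∀ D, MeasurableSet D → ν.fst D ≤ liminf (fun k => (νs k).fst D) atTop)
    {H : Set (S × C)} (hH : MeasurableSet H) (hsec : ∀ s, IsOpen (Prod.mk s ⁻¹' H)) :
    ν H ≤ liminf (fun k => νs k H) atTop := by
  obtain ⟨b, hbc, hbe, hb⟩ := TopologicalSpace.exists_countable_basis C
  have hbne : b.Nonempty := by
    rw [Set.nonempty_iff_ne_empty]
    rintro rfl
    obtain ⟨v, hv, -⟩ := hb.exists_subset_of_mem_open (Set.mem_univ (Classical.arbitrary C))
      isOpen_univ
    exact hv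
  obtain ⟨U, rfl⟩ := hbc.exists_eq_range hbne
  have hUo : ∀ n, IsOpen (U n) := fun n => hb.isOpen ⟨n, rfl⟩
  have hmeas : ∀ n, MeasurableSet (Hᶜ ∩ Prod.snd ⁻¹' (U n)) := fun n =>
    hH.compl.inter (measurable_snd (hUo n).measurableSet)
  -- The set of `s` with `U n` inside the section of `H` may fail to be Borel. Requiring the
  -- inclusion only up to null sets of the conditional kernels of all `νs k` gives a Borel set, at
  -- the cost of a set that is null for every `νs k`.
  let B : ℕ → Set S := fun n =>
    {s | ∀ k, (νs k).condKernel s (Prod.mk s ⁻¹' (Hᶜ ∩ Prod.snd ⁻¹' (U n))) = 0}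
  have hB : ∀ n, MeasurableSet (B n) := fun n => by
    have : B n = ⋂ k, {s | (νs k).condKernel s (Prod.mk s ⁻¹' (Hᶜ ∩ Prod.snd ⁻¹' (U n))) = 0} := by
      ext s; simp [B]
    rw [this]
    exact .iInter fun k =>
      (Kernel.measurable_kernel_prodMk_left (hmeas n)) (measurableSet_singleton 0)
  have hsub : H ⊆ ⋃ n, B n ×ˢ U n := by
    rintro ⟨s, c⟩ hsc
    obtain ⟨v, ⟨n, rfl⟩, hcv, hvH⟩ := hb.exists_subset_of_mem_open
      (show c ∈ Prod.mk s ⁻¹' H from hsc) (hsec s)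
    refine Set.mem_iUnion.2 ⟨n, fun k => ?_, hcv⟩
    convert measure_empty (μ := (νs k).condKernel s)
    rw [Set.eq_empty_iff_forall_notMem]
    rintro c' ⟨h1, h2⟩
    exact h1 (hvH h2)
  have hnull : ∀ k n, νs k (Hᶜ ∩ B n ×ˢ U n) = 0 := by
    intro k n
    have hm : MeasurableSet (Hᶜ ∩ B n ×ˢ U n) :=
      hH.compl.inter ((hB n).prod (hUo n).measurableSet)
    rw [← (νs k).disintegrate (νs k).condKernel, Measure.compProd_apply hm,
      lintegral_eq_zero_iff (Kernel.measurable_kernel_prodMk_left hm)]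
    refine Eventually.of_forall fun s => ?_
    by_cases hs : s ∈ B n
    · refine measure_mono_null ?_ (hs k)
      rintro c ⟨h1, h2⟩
      exact ⟨h1, h2.2⟩
    · refine measure_mono_null (t := ∅) ?_ measure_empty
      rintro c ⟨h1, h2⟩
      exact hs h2.1
  refine (measure_mono hsub).trans ?_
  rw [measure_iUnion_eq_iSup_accumulate]
  refine iSup_le fun N => ENNReal.le_of_forall_pos_le_add fun ε hε _ => ?_
  have hε' : ((ε : ℝ≥0∞) / 2) ≠ 0 := by simpa using hε.ne'
  obtain ⟨δ, hδ, hδε⟩ := ENNReal.exists_pos_sum_of_countable' hε' ℕ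
  -- Outer regularity replaces the Borel rectangles by open ones. The surplus lies over the Borel
  -- set `E` of states, whose mass is controlled along the sequence by the hypothesis on the first
  -- marginals.
  choose V hBV hVo _ hVδ using fun n =>
    (hB n).exists_isOpen_sdiff_lt (μ := ν.fst) (measure_ne_top _ _) (hδ n).ne'
  let E : Set S := ⋃ n, V n \ B n
  have hE : MeasurableSet E := .iUnion fun n => (hVo n).measurableSet.diff (hB n)
  have hνE : ν.fst E < ε := by
    calc ν.fst E ≤ ∑' n, ν.fst (V n \ B n) := measure_iUnion_le _
      _ ≤ ∑' n, δ n := ENNReal.tsum_le_tsum fun n => (hVδ n).le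
      _ < ε / 2 := hδε
      _ ≤ ε := ENNReal.half_le_self
  have hEev : ∀ᶠ k in atTop, (νs k).fst E < ε := by
    refine eventually_lt_of_limsup_lt (lt_of_le_of_lt ?_ hνE)
    exact limsup_measure_le_of_le_liminf_measure_compl hE (hfst _ hE.compl)
  let O : Set (S × C) := ⋃ n, V n ×ˢ U n
  have hO : IsOpen O := isOpen_iUnion fun n => (hVo n).prod (hUo n)
  have hOle : ∀ k, νs k O ≤ νs k H + (νs k).fst E := by
    intro k
    have : O ⊆ H ∪ (⋃ n, Hᶜ ∩ B n ×ˢ U n) ∪ Prod.fst ⁻¹' E := by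
      rintro ⟨s, c⟩ hsc
      obtain ⟨n, h1, h2⟩ := Set.mem_iUnion.1 hsc
      by_cases hs : s ∈ B n
      · by_cases hh : (s, c) ∈ H
        · exact Or.inl (Or.inl hh)
        · exact Or.inl (Or.inr (Set.mem_iUnion.2 ⟨n, hh, hs, h2⟩))
      · exact Or.inr (Set.mem_iUnion.2 ⟨n, h1, hs⟩)
    refine (measure_mono this).trans ((measure_union_le _ _).trans ?_)
    rw [Measure.fst_apply hE]
    refine add_le_add ((measure_union_le _ _).trans ?_) le_rfl
    rw [measure_iUnion_null (hnull k), add_zero]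
  have hacc : ν (Set.accumulate (fun n => B n ×ˢ U n) N) ≤ ν O := by
    refine measure_mono ?_
    rintro x hx
    obtain ⟨n, -, h1, h2⟩ := Set.mem_accumulate.1 hx
    exact Set.mem_iUnion.2 ⟨n, hBV n h1, h2⟩
  refine hacc.trans ((hopen O hO).trans ?_)
  refine le_of_forall_lt fun c hc => ?_
  obtain ⟨c', hcc', hc'⟩ := exists_between hc
  refine hcc'.trans_le (tsub_le_iff_right.1 (le_liminf_of_le (by isBoundedDefault) ?_))
  filter_upwards [eventually_lt_of_lt_liminf hc', hEev] with k h1 h2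
  rw [tsub_le_iff_right]
  exact h1.le.trans ((hOle k).trans (by gcongr))

/-- The Hilbert cube. -/
abbrev Cube : Type := ℕ → unitInterval

namespace CMDP

variable {S : Type u} {A : Type v} [MeasurableSpace S] [MeasurableSpace A] {m : ℕ}

/-- Two classes of sets of states and of feasible pairs, for which the laws of the process behave
like weakly convergent measures. The map `e` is a compactification of `𝕂`. -/
structure ConvergenceFrame (M : CMDP S A m) (e : M.K → Cube × Cube) (𝒪S : Set (Set S))
    (𝒪 : Set (Set M.K)) : Prop where
  measurableEmbedding : MeasurableEmbedding e
  measurableSet : ∀ G ∈ 𝒪S, MeasurableSet G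
  superlevel_p : ∀ G ∈ 𝒪S, ∀ t, {x | t < M.p x G} ∈ 𝒪
  sublevel_r : ∀ i t, {x | M.r i x < t} ∈ 𝒪
  limit : ∀ (ν : Measure S) [IsProbabilityMeasure ν] (Λs : ℕ → Measure M.K)
    [∀ k, IsProbabilityMeasure (Λs k)], ConvergesBelow 𝒪S ν (fun k => M.stateLaw (Λs k)) →
    ∀ (y : ProbabilityMeasure (Cube × Cube)) (ys : ℕ → ProbabilityMeasure (Cube × Cube)),
    (∀ k, (ys k : Measure (Cube × Cube)) = (Λs k).map e) → Tendsto ys atTop (𝓝 y) →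
    ∃ Λ : Measure M.K, Λ.map e = y ∧ M.stateLaw Λ = ν ∧ ConvergesBelow 𝒪 Λ Λs

/-! ### Compactification of the feasible pairs in the Hilbert cube -/

section Compactification

/-- The compactification of `𝕂` given by embeddings of `S` and `A` in the Hilbert cube. -/
def compactify (M : CMDP S A m) (eS : S → Cube) (eA : A → Cube) (x : M.K) : Cube × Cube :=
  (eS x.1.1, eA x.1.2)

variable {M : CMDP S A m}

theorem measurableEmbedding_compactify {eS : S → Cube} {eA : A → Cube}
    (heS : MeasurableEmbedding eS) (heA : MeasurableEmbedding eA) :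
    MeasurableEmbedding (M.compactify eS eA) :=
  (heS.prodMap heA).comp M.measurableEmbedding_K

/-- By the portmanteau theorem both sides are weak limits of the embedded state laws, and weak
limits are unique. -/
theorem fst_limit [TopologicalSpace S] [BorelSpace S] {eS : S → Cube} (heS : MeasurableEmbedding eS)
    {e : M.K → Cube × Cube} (hem : Measurable e) (he : ∀ x, (e x).1 = eS x.1.1)
    {ν : Measure S} [IsProbabilityMeasure ν] {Λs : ℕ → Measure M.K}
    [∀ k, IsProbabilityMeasure (Λs k)]
    (hconv : ∀ U, IsOpen U → ν (eS ⁻¹' U) ≤ liminf (fun k => M.stateLaw (Λs k) (eS ⁻¹' U)) atTop)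
    {y : ProbabilityMeasure (Cube × Cube)} {ys : ℕ → ProbabilityMeasure (Cube × Cube)}
    (hys : ∀ k, (ys k : Measure (Cube × Cube)) = (Λs k).map e) (hy : Tendsto ys atTop (𝓝 y)) :
    (y : Measure (Cube × Cube)).fst = ν.map eS := by
  have h1 := ProbabilityMeasure.tendsto_map_of_tendsto_of_continuous _ _ hy
    (continuous_fst (X := Cube) (Y := Cube))
  let νc : ProbabilityMeasure Cube := ⟨ν.map eS, Measure.isProbabilityMeasure_map
    heS.measurable.aemeasurable⟩
  have h2 : Tendsto (fun k => (ys k).map (continuous_fst (X := Cube) (Y := Cube)).aemeasurable)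
      atTop (𝓝 νc) := by
    refine tendsto_of_forall_isOpen_le_liminf_nat' fun U hU => ?_
    have h3 : ∀ k, (((ys k).map (continuous_fst (X := Cube) (Y := Cube)).aemeasurable :
        ProbabilityMeasure Cube) : Measure Cube) U = M.stateLaw (Λs k) (eS ⁻¹' U) := by
      intro k
      rw [ProbabilityMeasure.toMeasure_map, hys k, Measure.map_apply measurable_fst hU.measurableSet,
        Measure.map_apply hem (measurable_fst hU.measurableSet),
        M.stateLaw_apply _ (heS.measurable hU.measurableSet)]
      congr 1
      ext x
      simp [he]
    simp_rw [h3]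
    change (ν.map eS) U ≤ _
    rw [heS.map_apply]
    exact hconv U hU
  have h4 := tendsto_nhds_unique h1 h2
  have h5 := congrArg (fun η : ProbabilityMeasure Cube => (η : Measure Cube)) h4
  rw [Measure.fst, ← ProbabilityMeasure.toMeasure_map y continuous_fst.aemeasurable]
  exact h5

theorem stateLaw_comap {eS : S → Cube} (heS : MeasurableEmbedding eS)
    {e : M.K → Cube × Cube} (hem : MeasurableEmbedding e) (he : ∀ x, (e x).1 = eS x.1.1)
    {ν : Measure S} {Λ : Measure M.K} (hΛ : (Λ.map e).fst = ν.map eS) : M.stateLaw Λ = ν := by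
  have h : (M.stateLaw Λ).map eS = ν.map eS := by
    rw [← hΛ, stateLaw, Measure.fst, Measure.map_map heS.measurable M.measurable_state,
      Measure.map_map measurable_fst hem.measurable]
    congr 1
    ext x
    simp [he]
  rw [← heS.comap_map (M.stateLaw Λ), h, heS.comap_map]

theorem map_comap_of_compl_range {X Z : Type*} [MeasurableSpace X] [MeasurableSpace Z] {f : X → Z}
    (hf : MeasurableEmbedding f) {y : Measure Z} (h : y (Set.range f)ᶜ = 0) :
    (y.comap f).map f = y := by
  rw [hf.map_comap]
  exact Measure.restrict_eq_self_of_ae_mem (measure_eq_zero_iff_ae_notMem.1 h |>.mono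
    fun x hx => by simpa using hx)

end Compactification

/-! ### Convergence frames under the two continuity conditions -/

section Topological

variable [TopologicalSpace A]

/-- The measurable sets of feasible pairs whose sections are open. -/
def openSections (M : CMDP S A m) : Set (Set M.K) :=
  {G | MeasurableSet G ∧ ∀ s, IsOpen {a : M.actions s | (⟨(s, a), a.2⟩ : M.K) ∈ G}}

/-- The compactification of the actions only. -/
def compactifyActions (M : CMDP S A m) (eA : A → Cube) (x : M.K) : S × Cube := (x.1.1, eA x.1.2)

variable {M : CMDP S A m}

/-- The complement of a relatively open subset of the compact set `A(s)` is compact, so its image is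
closed in the cube. The open set obtained includes everything outside the image of `A(s)`; for `G =
∅` it is exactly this outside. -/
theorem SetwiseContinuous.isOpen_section (hM : M.SetwiseContinuous) {eA : A → Cube}
    (heA : IsEmbedding eA) {G : Set M.K} (hG : G ∈ M.openSections) (s : S) :
    IsOpen (Prod.mk s ⁻¹' (M.compactifyActions eA '' Gᶜ)ᶜ) := by
  have hcomp : CompactSpace (M.actions s) := isCompact_iff_compactSpace.1 (hM.isCompact_actions s)
  have hcl : IsCompact {a : M.actions s | (⟨(s, a), a.2⟩ : M.K) ∈ G}ᶜ :=
    (hG.2 s).isClosed_compl.isCompact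
  have him : Prod.mk s ⁻¹' (M.compactifyActions eA '' Gᶜ) =
      (fun a : M.actions s => eA a) '' {a : M.actions s | (⟨(s, a), a.2⟩ : M.K) ∈ G}ᶜ := by
    ext c
    constructor
    · rintro ⟨⟨⟨s', a⟩, ha⟩, hx, hxe⟩
      simp only [compactifyActions, Prod.mk.injEq] at hxe
      obtain ⟨rfl, rfl⟩ := hxe
      exact ⟨⟨a, ha⟩, hx, rfl⟩
    · rintro ⟨a, ha, rfl⟩
      exact ⟨⟨(s, a), a.2⟩, ha, rfl⟩
  rw [Set.preimage_compl, him]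
  exact (hcl.image (heA.continuous.comp continuous_subtype_val)).isClosed.isOpen_compl

variable [TopologicalSpace S]

theorem isEmbedding_compactify {eS : S → Cube} {eA : A → Cube} (heS : IsEmbedding eS)
    (heA : IsEmbedding eA) : IsEmbedding (M.compactify eS eA) :=
  (heS.prodMap heA).comp IsEmbedding.subtypeVal

/-- The graph of an upper semicontinuous compact-valued multifunction is closed even if the values
are compactified. -/
theorem WeaklyContinuous.mem_range_of_mem_closure [T2Space A] (hM : M.WeaklyContinuous)
    {eS : S → Cube} {eA : A → Cube} (heS : IsEmbedding eS) (heA : IsEmbedding eA) {z : Cube × Cube}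
    (hz : z ∈ closure (Set.range (M.compactify eS eA))) (hzS : z.1 ∈ Set.range eS) :
    z ∈ Set.range (M.compactify eS eA) := by
  obtain ⟨z1, c⟩ := z
  obtain ⟨s, rfl⟩ := hzS
  by_contra hcon
  have hc : c ∉ eA '' M.actions s := by
    rintro ⟨a, ha, rfl⟩
    exact hcon ⟨⟨(s, a), ha⟩, rfl⟩
  have hcomp : IsCompact (eA '' M.actions s) := (hM.isCompact_actions s).image heA.continuous
  obtain ⟨U, V, hU, hV, hcU, hsV, hUV⟩ :=
    SeparatedNhds.of_isCompact_isCompact (isCompact_singleton (x := c)) hcomp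
      (Set.disjoint_singleton_left.2 hc)
  -- The states whose actions all lie in `V` form a neighbourhood of `s`, and `U` is disjoint from
  -- `V`; hence no feasible pair is close to `(eS s, c)`.
  have hcl := hM.isClosed_hit (eA ⁻¹' Vᶜ) (hV.isClosed_compl.preimage heA.continuous)
  obtain ⟨W, hW, hWe⟩ := heS.isOpen_iff.1 hcl.isOpen_compl
  have hsW : eS s ∈ W := by
    change s ∈ eS ⁻¹' W
    rw [hWe]
    rintro ⟨a, ha, haV⟩
    exact haV (hsV ⟨a, ha, rfl⟩)
  obtain ⟨_, ⟨hxW, hxU⟩, ⟨x, rfl⟩⟩ := mem_closure_iff.1 hz (W ×ˢ U) (hW.prod hU)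
    ⟨hsW, hcU rfl⟩
  have hx : x.1.1 ∈ eS ⁻¹' W := hxW
  rw [hWe] at hx
  refine hx ⟨x.1.2, x.2, fun hxV => ?_⟩
  exact Set.disjoint_left.1 hUV hxU hxV

variable [BorelSpace S]

theorem WeaklyContinuous.convergenceFrame [SecondCountableTopology S] [SecondCountableTopology A]
    [TopologicalSpace.MetrizableSpace S] [T2Space A]
    (hM : M.WeaklyContinuous) {eS : S → Cube} {eA : A → Cube} (heS : IsEmbedding eS)
    (heA : IsEmbedding eA) (heS' : MeasurableEmbedding eS) (heA' : MeasurableEmbedding eA) :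
    M.ConvergenceFrame (M.compactify eS eA) {G | IsOpen G} {G | IsOpen G} where
  measurableEmbedding := measurableEmbedding_compactify heS' heA'
  measurableSet G hG := IsOpen.measurableSet hG
  superlevel_p G hG t := by
    let P : M.K → ProbabilityMeasure S := fun x => ⟨M.p x, inferInstance⟩
    have hP : Continuous P :=
      ProbabilityMeasure.continuous_iff_forall_continuous_integral.2 hM.continuous_p
    rw [Set.mem_ofPred_eq, isOpen_iff_mem_nhds]
    intro x hx
    exact eventually_lt_of_lt_liminf (lt_of_lt_of_le hx
      (ProbabilityMeasure.le_liminf_measure_open_of_tendsto (hP.tendsto x) hG))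
  sublevel_r i t := (hM.upperSemicontinuous_r i).isOpen_preimage t
  limit ν _ Λs _ hconv y ys hys hy := by
    have hem := measurableEmbedding_compactify (M := M) heS' heA'
    set e := M.compactify eS eA
    have hfst : (y : Measure (Cube × Cube)).fst = ν.map eS :=
      fst_limit heS' hem.measurable (fun _ => rfl)
        (fun U hU => hconv _ (hU.preimage heS.continuous)) hys hy
    have h1 : (y : Measure (Cube × Cube)) (closure (Set.range e))ᶜ = 0 := by
      have := ProbabilityMeasure.le_liminf_measure_open_of_tendsto hy
        (isClosed_closure (s := Set.range e)).isOpen_compl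
      have h0 : ∀ k, (ys k : Measure (Cube × Cube)) (closure (Set.range e))ᶜ = 0 := fun k => by
        rw [hys k, hem.map_apply]
        refine measure_mono_null (t := ∅) ?_ measure_empty
        intro x hx
        exact hx (subset_closure ⟨x, rfl⟩)
      simpa [h0] using this
    have h2 : (y : Measure (Cube × Cube)) (Prod.fst ⁻¹' (Set.range eS)ᶜ) = 0 := by
      rw [← Measure.fst_apply heS'.measurableSet_range.compl, hfst, heS'.map_apply]
      simp
    -- No mass is lost: `y` is carried by the closure of the feasible pairs, and its first marginal
    -- by the image of `S`, where this closure adds no points.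
    have h3 : (y : Measure (Cube × Cube)) (Set.range e)ᶜ = 0 := by
      refine measure_mono_null ?_ (measure_union_null h1 h2)
      intro z hz
      by_contra hcon
      simp only [Set.mem_union, Set.mem_compl_iff, Set.mem_preimage, not_or, not_not] at hcon
      exact hz (hM.mem_range_of_mem_closure heS heA hcon.1 hcon.2)
    have h4 := map_comap_of_compl_range hem h3
    refine ⟨(y : Measure (Cube × Cube)).comap e, h4,
      stateLaw_comap heS' hem (fun _ => rfl) (by rw [h4, hfst]), fun G hG => ?_⟩
    obtain ⟨U, hU, rfl⟩ := (isEmbedding_compactify heS heA).isOpen_iff.1 hG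
    have h5 := ProbabilityMeasure.le_liminf_measure_open_of_tendsto hy hU
    rw [← h4, hem.map_apply] at h5
    simp_rw [hys, hem.map_apply] at h5
    exact h5

theorem SetwiseContinuous.convergenceFrame [SecondCountableTopology S] [SecondCountableTopology A]
    [TopologicalSpace.MetrizableSpace S]
    (hM : M.SetwiseContinuous) {eS : S → Cube} {eA : A → Cube} (heS : IsEmbedding eS)
    (heA : IsEmbedding eA) (heS' : MeasurableEmbedding eS) (heA' : MeasurableEmbedding eA) :
    M.ConvergenceFrame (M.compactify eS eA) {G | MeasurableSet G} M.openSections where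
  measurableEmbedding := measurableEmbedding_compactify heS' heA'
  measurableSet G hG := hG
  superlevel_p G hG t := ⟨measurableSet_lt measurable_const (Kernel.measurable_coe M.p hG),
    fun s => isOpen_lt continuous_const (hM.continuous_p s G hG)⟩
  sublevel_r i t := ⟨measurableSet_lt (M.measurable_r i) measurable_const,
    fun s => (hM.upperSemicontinuous_r i s).isOpen_preimage t⟩
  limit ν _ Λs _ hconv y ys hys hy := by
    have hem := measurableEmbedding_compactify (M := M) heS' heA'
    set e := M.compactify eS eA with he
    let κ := M.compactifyActions eA
    have hκ : MeasurableEmbedding κ :=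
      (MeasurableEmbedding.id.prodMap heA').comp M.measurableEmbedding_K
    let j : S × Cube → Cube × Cube := Prod.map eS id
    have hj : MeasurableEmbedding j := heS'.prodMap MeasurableEmbedding.id
    have hjt : IsEmbedding j := heS.prodMap IsEmbedding.id
    have hjκ : j ∘ κ = e := rfl
    have hfst : (y : Measure (Cube × Cube)).fst = ν.map eS :=
      fst_limit heS' hem.measurable (fun _ => rfl)
        (fun U hU => hconv _ (heS.continuous.measurable hU.measurableSet)) hys hy
    have h2 : (y : Measure (Cube × Cube)) (Set.range j)ᶜ = 0 := by
      have : (Set.range j)ᶜ ⊆ Prod.fst ⁻¹' (Set.range eS)ᶜ := by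
        rintro ⟨z1, c⟩ hz ⟨s, rfl⟩
        exact hz ⟨(s, c), rfl⟩
      refine measure_mono_null this ?_
      rw [← Measure.fst_apply heS'.measurableSet_range.compl, hfst, heS'.map_apply]
      simp
    set y' : Measure (S × Cube) := (y : Measure (Cube × Cube)).comap j
    have hy' : y'.map j = y := map_comap_of_compl_range hj h2
    have hy'prob : IsProbabilityMeasure y' := by
      constructor
      have := congrArg (fun η : Measure (Cube × Cube) => η Set.univ) hy'
      simpa [hj.map_apply] using this
    have hΛprob : ∀ k, IsProbabilityMeasure ((Λs k).map κ) := fun k =>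
      Measure.isProbabilityMeasure_map hκ.measurable.aemeasurable
    have hΛj : ∀ k, ((Λs k).map κ).map j = ys k := fun k => by
      rw [Measure.map_map hj.measurable hκ.measurable, hjκ, hys k]
    have hΛfst : ∀ k, ((Λs k).map κ).fst = M.stateLaw (Λs k) := fun k => by
      rw [Measure.fst, Measure.map_map measurable_fst hκ.measurable]
      rfl
    have hy'fst : y'.fst = ν := by
      have : y'.fst.map eS = ν.map eS := by
        rw [← hfst, ← hy', Measure.fst, Measure.fst, Measure.map_map heS'.measurable measurable_fst,
          Measure.map_map measurable_fst hj.measurable]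
        rfl
      rw [← heS'.comap_map y'.fst, this, heS'.comap_map]
    -- The set `(κ '' Gᶜ)ᶜ` has open sections in the whole cube and pulls back to `G` along `κ`.
    have key : ∀ G ∈ M.openSections, y' (κ '' Gᶜ)ᶜ ≤ liminf (fun k => Λs k G) atTop := by
      intro G hG
      have hm : MeasurableSet (κ '' Gᶜ)ᶜ := (hκ.measurableSet_image.2 hG.1.compl).compl
      have := le_liminf_of_isOpen_sections (ν := y') (νs := fun k => (Λs k).map κ) (H := (κ '' Gᶜ)ᶜ)
        (fun U hU => ?_) (fun D hD => ?_) hm (hM.isOpen_section heA hG)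
      · refine this.trans_eq ?_
        congr 1
        ext k
        rw [hκ.map_apply, Set.preimage_compl, Set.preimage_image_eq _ hκ.injective, compl_compl]
      · obtain ⟨V, hV, rfl⟩ := hjt.isOpen_iff.1 hU
        have := ProbabilityMeasure.le_liminf_measure_open_of_tendsto hy hV
        rw [← hy', hj.map_apply] at this
        simp_rw [← hΛj, hj.map_apply] at this
        exact this
      · simp_rw [hΛfst, hy'fst]
        exact hconv D hD
    -- With `G = ∅` the inequality says that the limit gives no mass to infeasible pairs.
    have hempty : (∅ : Set M.K) ∈ M.openSections := ⟨.empty, fun s => by simp⟩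
    have hrange : y' (Set.range κ)ᶜ = 0 := by
      have := key ∅ hempty
      simpa using this
    have hΛκ : (y'.comap κ).map κ = y' := map_comap_of_compl_range hκ hrange
    have h4 : (y'.comap κ).map e = y := by
      rw [← hjκ, ← Measure.map_map hj.measurable hκ.measurable, hΛκ, hy']
    refine ⟨y'.comap κ, h4, stateLaw_comap heS' hem (fun _ => rfl) (by rw [h4, hfst]),
      fun G hG => le_trans ?_ (key G hG)⟩
    rw [← hΛκ, hκ.map_apply, Set.preimage_compl, Set.preimage_image_eq _ hκ.injective, compl_compl,
      hκ.comap_map]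

end Topological

end CMDP

/-! ### Optimal flows -/

theorem ConvergesBelow.lintegral_le {X : Type*} [MeasurableSpace X] {𝒪 : Set (Set X)}
    {ν : Measure X} {νs : ℕ → Measure X} (h : ConvergesBelow 𝒪 ν νs) {f : X → ℝ≥0∞}
    (hf : Measurable f) (hs : ∀ t, {x | t < f x} ∈ 𝒪) :
    ∫⁻ x, f x ∂ν ≤ liminf (fun k => ∫⁻ x, f x ∂(νs k)) atTop :=
  lintegral_le_liminf_of_superlevel hf fun t => h _ (hs t)

namespace CMDP

variable {S : Type u} {A : Type v} [MeasurableSpace S] [MeasurableSpace A] {m : ℕ}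
variable {M : CMDP S A m} {e : M.K → Cube × Cube} {𝒪S : Set (Set S)} {𝒪 : Set (Set M.K)}

/-- Induction on time. The state law at time 0 is `μ` throughout. Convergence of the state laws at
time `n` identifies the limit as a law on the feasible pairs and gives the liminf inequality on `𝒪`;
integrating `x ↦ M.p x G` then yields convergence of the state laws at time `n + 1`. -/
theorem ConvergenceFrame.exists_isFlow (hfr : M.ConvergenceFrame e 𝒪S 𝒪)
    {F : ℕ → ℕ → Measure M.K} (hF : ∀ k, M.IsFlow (F k))
    {y : ℕ → ProbabilityMeasure (Cube × Cube)} {ys : ℕ → ℕ → ProbabilityMeasure (Cube × Cube)}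
    (hys : ∀ k n, (ys k n : Measure (Cube × Cube)) = (F k n).map e)
    (hy : ∀ n, Tendsto (fun k => ys k n) atTop (𝓝 (y n))) :
    ∃ F' : ℕ → Measure M.K, M.IsFlow F' ∧ (∀ n, (y n : Measure (Cube × Cube)) = (F' n).map e) ∧
      ∀ n, ConvergesBelow 𝒪 (F' n) fun k => F k n := by
  have hprob : ∀ k n, IsProbabilityMeasure (F k n) := fun k n => (hF k).isProbabilityMeasure n
  have hem := hfr.measurableEmbedding
  let F' : ℕ → Measure M.K := fun n => (y n : Measure (Cube × Cube)).comap e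
  have step : ∀ n (ν : Measure S) [IsProbabilityMeasure ν],
      ConvergesBelow 𝒪S ν (fun k => M.stateLaw (F k n)) →
      (F' n).map e = y n ∧ M.stateLaw (F' n) = ν ∧ ConvergesBelow 𝒪 (F' n) fun k => F k n := by
    intro n ν _ hν
    obtain ⟨Λ, h1, h2, h3⟩ := hfr.limit ν (fun k => F k n) hν (y n) (fun k => ys k n)
      (fun k => hys k n) (hy n)
    have : Λ = F' n := by
      change Λ = (y n : Measure (Cube × Cube)).comap e
      rw [← h1, hem.comap_map]
    subst this
    exact ⟨h1, h2, h3⟩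
  have hnext : ∀ n, ConvergesBelow 𝒪 (F' n) (fun k => F k n) →
      ConvergesBelow 𝒪S (M.p ∘ₘ F' n) (fun k => M.stateLaw (F k (n + 1))) := by
    intro n hn G hG
    have hGm := hfr.measurableSet G hG
    have := hn.lintegral_le (Kernel.measurable_coe M.p hGm) (hfr.superlevel_p G hG)
    simp_rw [(hF _).succ, Measure.bind_apply hGm M.p.aemeasurable]
    exact this
  have h0 := step 0 M.μ fun G _ => by simp [(hF _).zero]
  have hall : ∀ n, IsProbabilityMeasure (F' n) ∧ (F' n).map e = y n ∧
      ConvergesBelow 𝒪 (F' n) fun k => F k n := by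
    intro n
    induction n with
    | zero => exact ⟨⟨by rw [← stateLaw_univ, h0.2.1, measure_univ]⟩, h0.1, h0.2.2⟩
    | succ n ih =>
      have := ih.1
      have hs := step (n + 1) (M.p ∘ₘ F' n) (hnext n ih.2.2)
      exact ⟨⟨by rw [← stateLaw_univ, hs.2.1, measure_univ]⟩, hs.1, hs.2.2⟩
  refine ⟨F', ⟨h0.2.1, fun n => ?_⟩, fun n => (hall n).2.1.symm, fun n => (hall n).2.2⟩
  have := (hall n).1
  exact (step (n + 1) (M.p ∘ₘ F' n) (hnext n (hall n).2.2)).2.1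

theorem toENNReal_le_iff (x : EReal) (t : ℝ≥0∞) : x.toENNReal ≤ t ↔ x ≤ (t : EReal) := by
  rw [← EReal.coe_ennreal_le_coe_ennreal_iff, EReal.coe_toENNReal_eq_max, max_le_iff,
    and_iff_right (EReal.coe_ennreal_nonneg t)]

theorem ConvergenceFrame.superlevel_shortfall (hfr : M.ConvergenceFrame e 𝒪S 𝒪) (i : Fin (m + 1))
    (l : ℕ) (t : ℝ≥0∞) : {x | t < M.shortfall i l x} ∈ 𝒪 := by
  -- For `t = ∞` the set is empty, and so is `{x | M.r i x < ⊥}`; otherwise `t < (l - r)⁺` means `r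
  -- < l - t`.
  by_cases ht : t = ∞
  · convert hfr.sublevel_r i ⊥ using 1
    ext x
    simp [ht]
  · convert hfr.sublevel_r i (((l : ℝ) : EReal) - t) using 1
    ext x
    have ht' : (t : EReal) ≠ ⊤ := EReal.coe_ennreal_eq_top_iff.not.2 ht
    rw [Set.mem_ofPred_eq, Set.mem_ofPred_eq, shortfall, ← not_le, toENNReal_le_iff, not_le,
      EReal.lt_sub_iff_add_lt (.inr ht') (.inl (M.r_ne_top i x)),
      EReal.lt_sub_iff_add_lt (.inl (EReal.coe_ennreal_ne_bot t)) (.inl ht'), add_comm]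

/-- Fatou's lemma for the counting measure. -/
theorem tsum_liminf_le (f : ℕ → ℕ → ℝ≥0∞) :
    ∑' n, liminf (fun k => f k n) atTop ≤ liminf (fun k => ∑' n, f k n) atTop := by
  simp_rw [← lintegral_count]
  exact lintegral_liminf_le fun k => measurable_of_countable _

theorem lintegral_occ (F : ℕ → Measure M.K) (f : M.K → ℝ≥0∞) :
    ∫⁻ x, f x ∂(M.occ F) = ∑' n, M.disc ^ n * ∫⁻ x, f x ∂(F n) := by
  simp [occ, lintegral_sum_measure]

theorem lintegral_occ_le_liminf {F : ℕ → ℕ → Measure M.K} {F' : ℕ → Measure M.K}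
    (h : ∀ n, ConvergesBelow 𝒪 (F' n) fun k => F k n) {f : M.K → ℝ≥0∞} (hf : Measurable f)
    (hs : ∀ t, {x | t < f x} ∈ 𝒪) :
    ∫⁻ x, f x ∂(M.occ F') ≤ liminf (fun k => ∫⁻ x, f x ∂(M.occ (F k))) atTop := by
  simp_rw [lintegral_occ]
  refine le_trans (ENNReal.tsum_le_tsum fun n => ?_) (tsum_liminf_le _)
  rw [ENNReal.liminf_const_mul_of_ne_zero_of_ne_top (pow_ne_zero _ M.disc_ne_zero)
    (ENNReal.pow_ne_top M.disc_ne_top)]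
  gcongr
  exact (h n).lintegral_le hf hs

/-- The compactified flows for which the rewards are at least `D`. -/
def flowSet (M : CMDP S A m) (e : M.K → Cube × Cube) (D : Fin (m + 1) → ℝ) :
    Set (ℕ → ProbabilityMeasure (Cube × Cube)) :=
  {y | ∃ F, M.IsFlow F ∧ (∀ n, (y n : Measure (Cube × Cube)) = (F n).map e) ∧
    ∀ i, (D i : EReal) ≤ M.reward i (M.occ F)}

theorem ConvergenceFrame.isClosed_flowSet (hfr : M.ConvergenceFrame e 𝒪S 𝒪) {w : S → ℝ}
    (hw : M.IsUpperBoundFunction w) (hui : M.OccUniformlyIntegrable w) (D : Fin (m + 1) → ℝ) :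
    IsClosed (M.flowSet e D) := by
  refine IsSeqClosed.isClosed fun ys y hys hy => ?_
  choose F hF hFy hFD using hys
  obtain ⟨F', hF', hF'y, hconv⟩ := hfr.exists_isFlow hF hFy (tendsto_pi_nhds.1 hy)
  refine ⟨F', hF', hF'y, fun i => ?_⟩
  exact le_reward_of_liminf hw hui i hF'.isOcc (fun k => (hF k).isOcc)
    (fun l => lintegral_occ_le_liminf hconv (measurable_shortfall i l)
      (hfr.superlevel_shortfall i l)) (fun k => hFD k i)

theorem flowSet_nonempty_iff (hem : MeasurableEmbedding e) (D : Fin (m + 1) → ℝ) :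
    (M.flowSet e D).Nonempty ↔ ∃ F, M.IsFlow F ∧ ∀ i, (D i : EReal) ≤ M.reward i (M.occ F) := by
  refine ⟨fun ⟨y, F, hF, _, h⟩ => ⟨F, hF, h⟩, fun ⟨F, hF, h⟩ => ?_⟩
  have hp : ∀ n, IsProbabilityMeasure ((F n).map e) := fun n =>
    have := hF.isProbabilityMeasure n
    Measure.isProbabilityMeasure_map hem.measurable.aemeasurable
  exact ⟨fun n => ⟨(F n).map e, hp n⟩, F, hF, fun n => rfl, h⟩

theorem eq_of_map_eq {X Z : Type*} [MeasurableSpace X] [MeasurableSpace Z] {f : X → Z}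
    (hf : MeasurableEmbedding f) {a b : Measure X} (h : a.map f = b.map f) : a = b := by
  rw [← hf.comap_map a, h, hf.comap_map]

/-- Nested sets of flows have a common element. -/
theorem ConvergenceFrame.exists_isFlow_forall_le (hfr : M.ConvergenceFrame e 𝒪S 𝒪) {w : S → ℝ}
    (hw : M.IsUpperBoundFunction w) (hui : M.OccUniformlyIntegrable w) {D : ℕ → Fin (m + 1) → ℝ}
    (hD : Monotone D)
    (hne : ∀ k, ∃ F, M.IsFlow F ∧ ∀ i, (D k i : EReal) ≤ M.reward i (M.occ F)) :
    ∃ F, M.IsFlow F ∧ ∀ k i, (D k i : EReal) ≤ M.reward i (M.occ F) := by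
  have hem := hfr.measurableEmbedding
  have hcl : ∀ k, IsClosed (M.flowSet e (D k)) := fun k => hfr.isClosed_flowSet hw hui (D k)
  obtain ⟨y, hy⟩ := IsCompact.nonempty_iInter_of_sequence_nonempty_isCompact_isClosed
    (fun k => M.flowSet e (D k))
    (fun k y ⟨F, hF, hFy, h⟩ => ⟨F, hF, hFy, fun i =>
      (EReal.coe_le_coe_iff.2 (hD (Nat.le_succ k) i)).trans (h i)⟩)
    (fun k => (flowSet_nonempty_iff hem _).2 (hne k)) (hcl 0).isCompact hcl
  rw [Set.mem_iInter] at hy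
  choose F hF hFy h using hy
  -- The compactified sequence `y` determines its flow, so the flows found for different `k` agree.
  have heq : ∀ k, F k = F 0 := fun k => funext fun n =>
    eq_of_map_eq hem ((hFy k n).symm.trans (hFy 0 n))
  exact ⟨F 0, hF 0, fun k i => heq k ▸ h k i⟩

theorem reward_lt_top {w : S → ℝ} (hw : M.IsUpperBoundFunction w)
    (hui : M.OccUniformlyIntegrable w) (i : Fin (m + 1)) {Q : Measure M.K} (hQ : M.IsOcc Q) :
    M.reward i Q < ⊤ := by
  have h := lintegral_pos_r_ne_top hw hui i hQ
  have h1 : M.reward i Q ≤ ((∫⁻ x, (M.r i x).toENNReal ∂Q : ℝ≥0∞) : EReal) :=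
    EReal.sub_le_of_le_add (le_add_of_nonneg_right (EReal.coe_ennreal_nonneg _))
  exact h1.trans_lt (lt_top_iff_ne_top.2 (by simpa using h))

/-- The maximal value of the reward is attained. -/
theorem ConvergenceFrame.exists_optimal (hfr : M.ConvergenceFrame e 𝒪S 𝒪) {w : S → ℝ}
    (hw : M.IsUpperBoundFunction w) (hui : M.OccUniformlyIntegrable w) {d : Fin m → ℝ}
    (hne : ∃ F, M.IsFlow F ∧ (∀ i : Fin m, (d i : EReal) ≤ M.reward i.succ (M.occ F)) ∧
      ⊥ < M.reward 0 (M.occ F)) :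
    ∃ v : ℝ, (M.flowSet e (Fin.cons v d)).Nonempty ∧ ∀ F, M.IsFlow F →
      (∀ i : Fin m, (d i : EReal) ≤ M.reward i.succ (M.occ F)) → M.reward 0 (M.occ F) ≤ v := by
  let V : Set ℝ := {v | ∃ F, M.IsFlow F ∧
    ∀ i, ((Fin.cons v d : Fin (m + 1) → ℝ) i : EReal) ≤ M.reward i (M.occ F)}
  have hV : ∀ v, v ∈ V ↔ ∃ F, M.IsFlow F ∧ (v : EReal) ≤ M.reward 0 (M.occ F) ∧
      ∀ i : Fin m, (d i : EReal) ≤ M.reward i.succ (M.occ F) := by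
    intro v
    simp [V, Fin.forall_fin_succ]
  have hmono : ∀ v : ℕ → ℝ, Monotone v → Monotone fun k => (Fin.cons (v k) d : Fin (m + 1) → ℝ) := by
    intro v hv k k' hk i
    refine Fin.cases ?_ (fun i => ?_) i
    · simpa using hv hk
    · simp
  have hlim : ∀ v : ℕ → ℝ, Monotone v → (∀ k, v k ∈ V) → ∃ F, M.IsFlow F ∧
      (∀ k, (v k : EReal) ≤ M.reward 0 (M.occ F)) ∧
      ∀ i : Fin m, (d i : EReal) ≤ M.reward i.succ (M.occ F) := by
    intro v hv h
    obtain ⟨F, hF, hFd⟩ := hfr.exists_isFlow_forall_le hw hui (hmono v hv) h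
    exact ⟨F, hF, fun k => by simpa using hFd k 0, fun i => by simpa using hFd 0 i.succ⟩
  have hdown : ∀ v v', v ≤ v' → v' ∈ V → v ∈ V := by
    intro v v' hvv h
    obtain ⟨F, hF, h1, h2⟩ := (hV v').1 h
    exact (hV v).2 ⟨F, hF, (EReal.coe_le_coe_iff.2 hvv).trans h1, h2⟩
  have hVne : V.Nonempty := by
    obtain ⟨F, hF, h1, h2⟩ := hne
    obtain ⟨v, -, hv⟩ := EReal.lt_iff_exists_real_btwn.1 h2
    exact ⟨v, (hV v).2 ⟨F, hF, hv.le, h1⟩⟩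
  -- If all levels `k` were attainable, a common flow would have infinite reward, contradicting
  -- `reward_lt_top`.
  have hVb : BddAbove V := by
    by_contra hcon
    obtain ⟨F, hF, h1, -⟩ := hlim (fun k => k) Nat.mono_cast fun k => by
      obtain ⟨v, hv, hkv⟩ := not_bddAbove_iff.1 hcon k
      exact hdown _ v hkv.le hv
    obtain ⟨r, h2, -⟩ := EReal.lt_iff_exists_real_btwn.1 (reward_lt_top hw hui 0 hF.isOcc)
    obtain ⟨k, hk⟩ := exists_nat_gt r
    exact absurd (h1 k) (not_le.2 (h2.trans (EReal.coe_lt_coe_iff.2 hk)))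
  refine ⟨sSup V, ?_, fun F hF hFd => ?_⟩
  · rw [flowSet_nonempty_iff hfr.measurableEmbedding]
    change sSup V ∈ V
    rw [hV]
    obtain ⟨F, hF, h1, h2⟩ := hlim (fun k => sSup V - 1 / ((k : ℝ) + 1))
      (fun k k' hk => sub_le_sub_left (Nat.one_div_le_one_div hk) _)
      fun k => by
        obtain ⟨v, hv, hlt⟩ := exists_lt_of_lt_csSup hVne
          (sub_lt_self (sSup V) (Nat.one_div_pos_of_nat (α := ℝ) (n := k)))
        exact hdown _ v hlt.le hv
    refine ⟨F, hF, ?_, h2⟩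
    have ht : Tendsto (fun k : ℕ => ((sSup V - 1 / ((k : ℝ) + 1) : ℝ) : EReal)) atTop
        (𝓝 ((sSup V : ℝ) : EReal)) := by
      refine (continuous_coe_real_ereal.tendsto _).comp ?_
      simpa using tendsto_const_nhds.sub (tendsto_one_div_add_atTop_nhds_zero_nat (𝕜 := ℝ))
    exact le_of_tendsto' ht h1
  · by_contra hcon
    obtain ⟨v, h1, h2⟩ := EReal.lt_iff_exists_real_btwn.1 (not_le.1 hcon)
    exact absurd (le_csSup hVb ((hV v).2 ⟨F, hF, h2.le, hFd⟩))
      (not_le.2 (EReal.coe_lt_coe_iff.1 h1))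

/-! ### Extreme optimal occupation measures -/

variable (M) in
/-- The integrals of continuous functions with respect to the discounted sum of a sequence of
laws. -/
noncomputable def functional (y : ℕ → ProbabilityMeasure (Cube × Cube)) (h : C(Cube × Cube, ℝ)) :
    ℝ := ∑' n, M.β ^ n * ∫ x, h x ∂(y n : Measure (Cube × Cube))

variable (M) in
theorem continuous_functional : Continuous M.functional := by
  refine continuous_pi fun h => ?_
  refine continuous_tsum (u := fun n => M.β ^ n * ‖h‖) (fun n => ?_)
    ((summable_geometric_of_lt_one M.β_pos.le M.β_lt_one).mul_right _) fun n y => ?_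
  · exact continuous_const.mul ((ProbabilityMeasure.continuous_integral_boundedContinuousFunction
      (BoundedContinuousFunction.mkOfCompact h)).comp (continuous_apply n))
  · rw [norm_mul, Real.norm_of_nonneg (pow_nonneg M.β_pos.le n)]
    refine mul_le_mul_of_nonneg_left ?_ (pow_nonneg M.β_pos.le n)
    refine (norm_integral_le_of_norm_le_const (C := ‖h‖) ?_).trans_eq (by simp)
    exact Eventually.of_forall fun x => h.norm_coe_le_norm x

theorem functional_eq (hem : MeasurableEmbedding e) {F : ℕ → Measure M.K} (hF : M.IsFlow F)
    {y : ℕ → ProbabilityMeasure (Cube × Cube)}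
    (hy : ∀ n, (y n : Measure (Cube × Cube)) = (F n).map e) (h : C(Cube × Cube, ℝ)) :
    M.functional y h = ∫ x, h x ∂((M.occ F).map e) := by
  have := hF.isOcc.finite
  have hint : Integrable (fun x => h (e x)) (M.occ F) :=
    Integrable.of_bound (C := ‖h‖) (h.continuous.measurable.comp hem.measurable).aestronglyMeasurable
      (Eventually.of_forall fun x => h.norm_coe_le_norm _)
  rw [hem.integral_map, occ, integral_sum_measure hint, functional]
  refine tsum_congr fun n => ?_
  rw [hy n, hem.integral_map, integral_smul_measure, M.disc_pow,
    ENNReal.toReal_ofReal (pow_nonneg M.β_pos.le n), smul_eq_mul]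

theorem ConvergenceFrame.exists_extreme [StandardBorelSpace A] [Nonempty A]
    (hfr : M.ConvergenceFrame e 𝒪S 𝒪) {w : S → ℝ} (φ₀ : M.StationaryPolicy)
    (hw : M.IsUpperBoundFunction w) (hui : M.OccUniformlyIntegrable w) {D : Fin (m + 1) → ℝ}
    (hne : (M.flowSet e D).Nonempty) :
    ∃ Q, M.IsOcc Q ∧ (∀ i, (D i : EReal) ≤ M.reward i Q) ∧ ∀ Q₁ Q₂, M.IsOcc Q₁ → M.IsOcc Q₂ →
      (∀ i, (D i : EReal) ≤ M.reward i Q₁) → (∀ i, (D i : EReal) ≤ M.reward i Q₂) →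
      Q₁ + Q₂ = Q + Q → Q₁ = Q := by
  have hem := hfr.measurableEmbedding
  -- Distinct flows may have the same occupation measure, so extreme points are taken in the image
  -- under `functional`, which retains only the occupation measure as a functional on continuous
  -- functions. The ambient product space is locally convex.
  have hcomp : IsCompact (M.functional '' M.flowSet e D) :=
    (hfr.isClosed_flowSet hw hui D).isCompact.image M.continuous_functional
  obtain ⟨_, ⟨y, ⟨F, hF, hFy, hFD⟩, rfl⟩, hext⟩ := hcomp.extremePoints_nonempty (hne.image _)
  have hfun := functional_eq hem hF hFy
  refine ⟨M.occ F, hF.isOcc, hFD, fun Q₁ Q₂ hQ₁ hQ₂ hD₁ hD₂ hsum => ?_⟩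
  -- Each competitor lies in the image, since it is the occupation measure of the flow of some
  -- stationary policy.
  have hmem : ∀ Q, M.IsOcc Q → (∀ i, (D i : EReal) ≤ M.reward i Q) →
      (fun h : C(Cube × Cube, ℝ) => ∫ x, h x ∂(Q.map e)) ∈ M.functional '' M.flowSet e D := by
    intro Q hQ hD
    obtain ⟨φ, -, hφ⟩ := hQ.exists_stationary φ₀
    have hfl := φ.toPolicy.isFlow
    have hp : ∀ n, IsProbabilityMeasure ((φ.toPolicy.law n).map e) := fun n =>
      have := hfl.isProbabilityMeasure n
      Measure.isProbabilityMeasure_map hem.measurable.aemeasurable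
    let z : ℕ → ProbabilityMeasure (Cube × Cube) := fun n => ⟨(φ.toPolicy.law n).map e, hp n⟩
    refine ⟨z, ⟨φ.toPolicy.law, hfl, fun n => rfl, by rwa [hφ]⟩, funext fun h => ?_⟩
    rw [functional_eq hem hfl (y := z) (fun n => rfl), hφ]
  have hfin : ∀ Q, M.IsOcc Q → IsFiniteMeasure (Q.map e) := fun Q hQ =>
    have := hQ.finite
    inferInstance
  have hf := hfin _ hF.isOcc
  have hf₁ := hfin _ hQ₁
  have hf₂ := hfin _ hQ₂
  have hint : ∀ (ν : Measure (Cube × Cube)) [IsFiniteMeasure ν] (h : C(Cube × Cube, ℝ)),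
      Integrable h ν := fun ν _ h =>
    Integrable.of_bound (C := ‖h‖) h.continuous.measurable.aestronglyMeasurable
      (Eventually.of_forall fun x => h.norm_coe_le_norm _)
  have key := hext (hmem Q₁ hQ₁ hD₁) (hmem Q₂ hQ₂ hD₂)
    ⟨1 / 2, 1 / 2, by norm_num, by norm_num, by norm_num, funext fun h => by
      have h1 : ∫ x, h x ∂((Q₁ + Q₂).map e) = ∫ x, h x ∂((M.occ F + M.occ F).map e) := by rw [hsum]
      rw [Measure.map_add _ _ hem.measurable, Measure.map_add _ _ hem.measurable,
        integral_add_measure (hint _ h) (hint _ h), integral_add_measure (hint _ h) (hint _ h)] at h1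
      simp only [Pi.add_apply, Pi.smul_apply, smul_eq_mul, hfun]
      linarith⟩
  refine eq_of_map_eq hem (ext_of_forall_integral_eq_of_IsFiniteMeasure fun h => ?_)
  have := congrFun key h.toContinuousMap
  rw [hfun] at this
  exact this

end CMDP

/-! ### Chattering policies -/

namespace CMDP

variable {S : Type u} {A : Type v} [MeasurableSpace S] [MeasurableSpace A] {m : ℕ}
variable {M : CMDP S A m}

/-- A stationary policy which is finitely supported on a set of states can be modified outside of
this set to a chattering policy. -/
theorem StationaryPolicy.exists_isChattering (φ : M.StationaryPolicy) (f₀ : M.DetStationaryPolicy)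
    {N : ℕ} {G : Set S} (hG : MeasurableSet G) {γ : Fin (N + 1) → S → ℝ≥0∞}
    {c : Fin (N + 1) → S → A} (hγ : ∀ j, Measurable (γ j)) (hc : ∀ j, Measurable (c j))
    (h : ∀ s ∈ G, φ.kernel s = ∑ j, γ j s • Measure.dirac (c j s)) :
    ∃ φ' : M.StationaryPolicy, φ'.IsChattering (N + 1) ∧ ∀ s ∈ G, φ'.kernel s = φ.kernel s := by
  classical
  have hgraph : ∀ j, MeasurableSet {s | c j s ∈ M.actions s} := fun j =>
    (measurable_id.prodMk (hc j)) M.measurableSet_graph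
  have hsum : ∀ s ∈ G, ∑ j, γ j s = 1 := fun s hs => by
    have := congrArg (fun ν : Measure A => ν Set.univ) (h s hs)
    simpa [Measure.finsetSum_apply] using this.symm
  have hle : ∀ s ∈ G, ∀ j, γ j s ≤ 1 := fun s hs j =>
    (Finset.single_le_sum (f := fun j => γ j s) (fun _ _ => zero_le)
      (Finset.mem_univ j)).trans_eq (hsum s hs)
  -- Atoms with positive weight are feasible actions; those with weight zero may be infeasible and
  -- are replaced by `f₀` without effect.
  have hmem : ∀ s ∈ G, ∀ j, γ j s ≠ 0 → c j s ∈ M.actions s := by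
    intro s hs j hj
    by_contra hcon
    have h1 : φ.kernel s (M.actions s)ᶜ = 0 :=
      (prob_compl_eq_zero_iff (M.measurableSet_actions s)).2 (φ.feasible s)
    rw [h s hs, Measure.finsetSum_apply, Finset.sum_eq_zero_iff] at h1
    have h2 := h1 j (Finset.mem_univ j)
    rw [Measure.smul_apply, Measure.dirac_apply' _ (M.measurableSet_actions s).compl,
      Set.indicator_of_mem hcon] at h2
    exact hj (by simpa using h2)
  let f : Fin (N + 1) → M.DetStationaryPolicy := fun j =>
    { toFun := fun s => if c j s ∈ M.actions s then c j s else f₀.toFun s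
      measurable_toFun := Measurable.ite (hgraph j) (hc j) f₀.measurable_toFun
      feasible := fun s => by
        by_cases hs : c j s ∈ M.actions s
        · simp [hs]
        · simpa [hs] using f₀.feasible s }
  let f' : Fin (N + 1) → M.DetStationaryPolicy := fun j =>
    { toFun := fun s => if s ∈ G then (f j).toFun s else f₀.toFun s
      measurable_toFun := Measurable.ite hG (f j).measurable_toFun f₀.measurable_toFun
      feasible := fun s => by
        by_cases hs : s ∈ G
        · simpa [hs] using (f j).feasible s
        · simpa [hs] using f₀.feasible s }
  -- Outside `G` all the weight goes to component `0`, which exists because the number of components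
  -- is `N + 1`.
  let γ' : Fin (N + 1) → S → ℝ := fun j s => if s ∈ G then (γ j s).toReal else if j = 0 then 1 else 0
  let φ' : M.StationaryPolicy :=
    { kernel := Kernel.piecewise hG φ.kernel (Kernel.deterministic f₀.toFun f₀.measurable_toFun)
      isMarkovKernel_kernel := inferInstance
      feasible := fun s => by
        by_cases hs : s ∈ G
        · simpa [Kernel.piecewise_apply, hs] using φ.feasible s
        · simp [Kernel.piecewise_apply, hs, Kernel.deterministic_apply,
            Measure.dirac_apply' _ (M.measurableSet_actions s), f₀.feasible s] }
  refine ⟨φ', ⟨γ', f', fun j => ?_, fun j s => ?_, fun s => ?_, fun s => ?_⟩, fun s hs => ?_⟩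
  · exact Measurable.ite hG (hγ j).ennreal_toReal measurable_const
  · by_cases hs : s ∈ G
    · simp only [γ', hs, if_true]
      exact ⟨ENNReal.toReal_nonneg, ENNReal.toReal_le_of_le_ofReal zero_le_one
        (by simpa using hle s hs j)⟩
    · by_cases hj : j = 0 <;> simp [γ', hs, hj]
  · by_cases hs : s ∈ G
    · simp only [γ', hs, if_true]
      rw [← ENNReal.toReal_sum fun j _ => ne_top_of_le_ne_top ENNReal.one_ne_top (hle s hs j),
        hsum s hs, ENNReal.toReal_one]
    · simp [γ', hs]
  · by_cases hs : s ∈ G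
    · simp only [φ', γ', f', f, Kernel.piecewise_apply, hs, if_true]
      rw [h s hs]
      refine Finset.sum_congr rfl fun j _ => ?_
      rw [ENNReal.ofReal_toReal (ne_top_of_le_ne_top ENNReal.one_ne_top (hle s hs j))]
      by_cases hj : γ j s = 0
      · simp [hj]
      · rw [if_pos (hmem s hs j hj)]
    · simp only [φ', γ', f', Kernel.piecewise_apply, hs, if_false, Kernel.deterministic_apply]
      rw [Finset.sum_eq_single 0]
      · simp
      · intro j _ hj
        simp [hj]
      · simp
  · simp [φ', Kernel.piecewise_apply, hs]

theorem StationaryPolicy.lift_congr {φ φ' : M.StationaryPolicy} {s : S}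
    (h : φ'.kernel s = φ.kernel s) : φ'.lift s = φ.lift s := by
  ext B hB
  obtain ⟨B, hB, rfl⟩ := hB
  rw [φ.lift_apply' s hB, φ'.lift_apply' s hB, h]

/-- A policy is itself a kernel with full mass on the sets `A(s)`, as the selection theorem
requires. -/
theorem exists_detStationaryPolicy [StandardBorelSpace A] [Nonempty A] (φ : M.StationaryPolicy) :
    Nonempty M.DetStationaryPolicy := by
  obtain ⟨f, hf, hmem⟩ := φ.kernel.exists_measurable_selector M.measurableSet_graph φ.feasible
  exact ⟨⟨f, hf, hmem⟩⟩

/-- An extreme point of the optimal occupation measures is generated by a chattering policy. -/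
theorem IsOcc.exists_isChattering [StandardBorelSpace A] [Nonempty A] (φ₀ : M.StationaryPolicy)
    {Q : Measure M.K} (hQ : M.IsOcc Q) (hrew : ∀ i, M.RewardFinite i Q)
    (hopt : ∀ Q', M.IsOcc Q' → (∀ i : Fin m, M.reward i.succ Q ≤ M.reward i.succ Q') →
      M.reward 0 Q' ≤ M.reward 0 Q)
    (hext : ∀ Q₁ Q₂, M.IsOcc Q₁ → M.IsOcc Q₂ → (∀ i, M.reward i Q ≤ M.reward i Q₁) →
      (∀ i, M.reward i Q ≤ M.reward i Q₂) → Q₁ + Q₂ = Q + Q → Q₁ = Q) :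
    ∃ φ : M.StationaryPolicy, φ.IsChattering (m + 1) ∧ M.occ φ.toPolicy.law = Q := by
  obtain ⟨φ, hφ, -⟩ := hQ.exists_stationary φ₀
  obtain ⟨ι, _, B, hB, hBd, γ, c, hγ, hc, hdirac⟩ := φ.kernel.exists_eq_sum_dirac (m + 1)
  have hnull : ∀ i, M.stateLaw Q {s | ∀ j, φ.kernel s (B i j) ≠ 0} = 0 := by
    intro i
    by_contra hpos
    obtain ⟨Q₁, Q₂, δ, hQ₁, hQ₂, hne, hsum, hcon, h₁, h₂⟩ :=
      hQ.exists_midpoint hφ hrew (hB i) (hBd i) hpos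
    have h0 := (hrew 0).reward_eq
    have h3 := hopt Q₁ hQ₁ fun i => (hcon i).1.ge
    have h4 := hopt Q₂ hQ₂ fun i => (hcon i).2.ge
    rw [h₁, h0, EReal.coe_le_coe_iff] at h3
    rw [h₂, h0, EReal.coe_le_coe_iff] at h4
    -- Optimality applied to both perturbations gives `δ ≤ 0` and `-δ ≤ 0`; hence both are optimal
    -- and extremality applies.
    have hδ : δ = 0 := by linarith
    refine hne (hext Q₁ Q₂ hQ₁ hQ₂ (Fin.forall_fin_succ.2 ⟨?_, fun i => (hcon i).1.ge⟩)
      (Fin.forall_fin_succ.2 ⟨?_, fun i => (hcon i).2.ge⟩) hsum)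
    · rw [h₁, h0, hδ, add_zero]
    · rw [h₂, h0, hδ, sub_zero]
  let G : Set S := ⋂ i, ⋃ j, {s | φ.kernel s (B i j) = 0}
  have hG : MeasurableSet G := .iInter fun i => .iUnion fun j =>
    (Kernel.measurable_coe φ.kernel (hB i j)) (measurableSet_singleton 0)
  have hGmem : ∀ s, s ∈ G ↔ ∀ i, ∃ j, φ.kernel s (B i j) = 0 := fun s => by simp [G]
  obtain ⟨f₀⟩ := exists_detStationaryPolicy φ₀
  obtain ⟨φ', hchat, heq⟩ := φ.exists_isChattering f₀ hG hγ hc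
    fun s hs => hdirac s ((hGmem s).1 hs)
  refine ⟨φ', hchat, ?_⟩
  -- The index set `ι` is countable, so `G` is conull. Thus `φ'` also disintegrates `Q`, and `Q` is
  -- its occupation measure by uniqueness.
  have hae : ∀ᵐ s ∂M.stateLaw Q, φ'.lift s = φ.lift s := by
    filter_upwards [ae_all_iff.2 fun i => measure_eq_zero_iff_ae_notMem.1 (hnull i)] with s hs
    refine StationaryPolicy.lift_congr (heq s ((hGmem s).2 fun i => ?_))
    simpa using hs i
  have hφ' : φ'.lift ∘ₘ M.stateLaw Q = Q := (Measure.comp_congr hae).trans hφ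
  rw [φ'.occ_law, ← hQ.eq_potential hφ']

theorem ConvergenceFrame.exists_solves [StandardBorelSpace A] [Nonempty A]
    {e : M.K → Cube × Cube} {𝒪S : Set (Set S)} {𝒪 : Set (Set M.K)}
    (hfr : M.ConvergenceFrame e 𝒪S 𝒪) {d : Fin m → ℝ} (hd : M.Nontrivial d) {w : S → ℝ}
    (hw : M.IsUpperBoundFunction w) (hw' : M.IsUniformlyIntegrable w) :
    ∃ φ : M.StationaryPolicy, φ.IsChattering (m + 1) ∧ M.Solves d φ.toPolicy := by
  obtain ⟨π, hπ, hπ0⟩ := hd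
  have hui := hw'.occ π.initial hw
  simp only [IsFeasible, J_eq_reward] at hπ hπ0
  obtain ⟨v, hne, hmax⟩ := hfr.exists_optimal hw hui ⟨π.law, π.isFlow, hπ, hπ0⟩
  obtain ⟨Q, hQ, hQD, hext⟩ := hfr.exists_extreme π.initial hw hui hne
  have hQ0 : (v : EReal) ≤ M.reward 0 Q := by simpa using hQD 0
  have hQd : ∀ i : Fin m, (d i : EReal) ≤ M.reward i.succ Q := fun i => by simpa using hQD i.succ
  -- The levels `v` and `d i` are real, so a reward above its level has an integrable negative part.
  have hrew : ∀ i, M.RewardFinite i Q := fun i =>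
    have hP := lintegral_pos_r_ne_top hw hui i hQ
    ⟨hP, ((ereal_le_sub_iff hP _).1 (hQD i)).1⟩
  have hopt : ∀ Q', M.IsOcc Q' → (∀ i : Fin m, (d i : EReal) ≤ M.reward i.succ Q') →
      M.reward 0 Q' ≤ M.reward 0 Q := by
    intro Q' hQ' hQd'
    obtain ⟨φ, -, rfl⟩ := hQ'.exists_stationary π.initial
    exact (hmax _ φ.toPolicy.isFlow hQd').trans hQ0
  obtain ⟨φ, hchat, hφ⟩ := hQ.exists_isChattering π.initial hrew
    (fun Q' hQ' h => hopt Q' hQ' fun i => (hQd i).trans (h i))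
    (fun Q₁ Q₂ hQ₁ hQ₂ h₁ h₂ => hext Q₁ Q₂ hQ₁ hQ₂ (fun i => (hQD i).trans (h₁ i))
      fun i => (hQD i).trans (h₂ i))
  refine ⟨φ, hchat, fun i => ?_, fun π' hπ' => ?_⟩
  · rw [J_eq_reward, hφ]
    exact hQd i
  · simp only [IsFeasible, J_eq_reward] at hπ' ⊢
    rw [hφ]
    exact hopt _ π'.isFlow.isOcc hπ'

end CMDP

/-! ### The theorem for Borel spaces -/

theorem theorem2 {S : Type u} {A : Type v}
    [TopologicalSpace S] [MeasurableSpace S] [BorelSpace S] (hS : IsBorelSpace S)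
    [TopologicalSpace A] [MeasurableSpace A] [BorelSpace A] (hA : IsBorelSpace A)
    {m : ℕ} (M : CMDP S A m) (d : Fin m → ℝ) (hd : M.Nontrivial d)
    (w : S → ℝ) (hw : M.IsUpperBoundFunction w) (hw' : M.IsUniformlyIntegrable w)
    (hM : M.WeaklyContinuous ∨ M.SetwiseContinuous) :
    ∃ φ : M.StationaryPolicy, φ.IsChattering (m + 1) ∧ M.Solves d φ.toPolicy := by
  have := hS.secondCountableTopology
  have := hA.secondCountableTopology
  have := hS.metrizableSpace
  have := hA.metrizableSpace
  have := hS.standardBorelSpace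
  have := hA.standardBorelSpace
  have := hA.nonempty
  obtain ⟨eS, heS⟩ := hS.exists_isEmbedding_cube
  obtain ⟨eA, heA⟩ := hA.exists_isEmbedding_cube
  -- By the Lusin–Souslin theorem, an injective Borel map on a standard Borel space has Borel
  -- images.
  have heS' := heS.continuous.measurable.measurableEmbedding heS.injective
  have heA' := heA.continuous.measurable.measurableEmbedding heA.injective
  obtain hM | hM := hM
  · exact (hM.convergenceFrame heS heA heS' heA').exists_solves hd hw hw'
  · exact (hM.convergenceFrame heS heA heS' heA').exists_solves hd hw hw'
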